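/- **Theorem 3.1 (Classification of decay rates).** Let $H$ be a separable real Hilbert space with norm $|\cdot|$, let $A$ be a self-adjoint nonnegative linear operator on $H$ with dense domain $D(A)$, and assume that the spectrum $\sigma(A)$ is a finite or countable set of eigenvalues without finite accumulation points. Let $|x|_{D(A^{1/2})}:=(|x|^2+|A^{1/2}x|^2)^{1/2}$ for $x\in D(A^{1/2})$. Let $\delta>0$, $K_0\ge 0$, $p>0$, $q>0$. For $g:[0,\infty)\to H$, a *solution* of $u''+2\delta u'+Au=g$ is a function $u\in C^0([0,\infty),D(A^{1/2}))\cap C^1([0,\infty),H)$ such that for every $\varphi\in D(A^{1/2})$ and every $t\ge0$ the function $\langle u'(t),\varphi\rangle$ is differentiable with $$\tfrac{d}{dt}\langle u'(t),\varphi\rangle+2\delta\langle u'(t),\varphi\rangle+\langle A^{1/2}u(t),A^{1/2}\varphi\rangle=\langle g(t),\varphi\rangle .$$ Let $u$ be a global solution of $$|u''+2\delta u'+Au|\le K_0\left(|u|^{1+p}+|A^{1/2}u|^{1+q}\right),$$ that is, there is $g\in C^0([0,\infty),H)$ such that $u$ is a solution of $u''+2\delta u'+Au=g$ and $|g(t)|\le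 K_0(|u(t)|^{1+p}+|A^{1/2}u(t)|^{1+q})$ for every $t\ge 0$. Assume that $|u(t)|_{D(A^{1/2})}\to0$ as $t\to+\infty$. Let $\mathcal D$ be the (finite) set of the real parts of all complex roots of the polynomials $z^2-2\delta z+\lambda$, $\lambda\in\sigma(A)$. Every solution $v$ of the homogeneous equation $v''+2\delta v'+Av=0$ is a sum $v=\sum_{r\in\mathcal D}v_r$, where, with $P_\lambda$ the orthogonal projection onto $\ker(A-\lambda)$, the component $v_r$ is the sum of the following parts of the modes $P_\lambda v$, $\lambda\in\sigma(A)$: if $\lambda<\delta^2$ and $r$ is a root of $z^2-2\delta z+\lambda$, the part $\frac{P_\lambda v'(0)+(2\delta-r)P_\lambda v(0)}{2(\delta-r)}\,e^{-rt}$; if $\lambda\ge\delta^2$ and $r=\delta$, the whole mode $P_\lambda v(t)$. For $r_0\in\mathcal D$, the solution $v$ is called *$r_0$-pure* if $v_r\equiv0$ for every $r\in\mathcal D$ with $r\ne r_0$. Then one and only one of the following statements holds. 1. (Null solution) $u(t)=0$ for every $t\ge0$. 2. (Slow solutions) There exist $T_0\ge0$ and positive constants $M_1,M_2$ such that, for every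 $t\ge T_0$, $$|u(t)|\ge\frac{M_1}{(1+t)^{1/p}}\qquad\text{and}\qquad |u'(t)|+|A^{1/2}u(t)|\le M_2|u(t)|^{1+p}.$$ 3. (Fast solutions) There exist $r_0\in\mathcal D$ with $r_0>0$, and an $r_0$-pure solution $v_0$ of $v''+2\delta v'+Av=0$, not identically zero, such that $$\lim_{t\to+\infty}\left(|u'(t)-v_0'(t)|+|u(t)-v_0(t)|_{D(A^{1/2})}\right)e^{\gamma t}=0$$ for every real $\gamma<\min\{\beta_0,(1+p)r_0,(1+q)r_0\}$, where $\beta_0:=\min\{r\in\mathcal D: r>r_0\}$ if $r_0<\max\mathcal D$, and $\beta_0:=+\infty$ otherwise. -/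

import Mathlib

open Filter Topology Set

noncomputable section

namespace DissipativeEvolution

variable {H : Type*} [NormedAddCommGroup H] [InnerProductSpace ℝ H]

/-! ### Unbounded operators: nonnegativity, spectrum, eigenspaces -/

/-- `A` is nonnegative: `⟨A x, x⟩ ≥ 0` for every `x` in `D(A)`. -/
def IsNonneg (A : H →ₗ.[ℝ] H) : Prop :=
  ∀ x : A.domain, 0 ≤ inner ℝ (A x) (x : H)

/-- `l` is in the resolvent set of `A`: the operator `A - l : D(A) → H` has an everywhere defined
bounded two-sided inverse `R`. -/
def InResolventSet (A : H →ₗ.[ℝ] H) (l : ℝ) : Prop :=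
  ∃ R : H →L[ℝ] H,
    (∀ y : H, ∃ h : R y ∈ A.domain, A ⟨R y, h⟩ - l • R y = y) ∧
    (∀ x : A.domain, R (A x - l • (x : H)) = x)

/-- The spectrum of `A`. (It is used for self-adjoint operators, whose spectrum is real.) -/
def spec (A : H →ₗ.[ℝ] H) : Set ℝ := {l | ¬ InResolventSet A l}

/-- The eigenspace `ker (A - l)`. -/
def eigenspace (A : H →ₗ.[ℝ] H) (l : ℝ) : Submodule ℝ H where
  carrier := {x | ∃ h : x ∈ A.domain, A ⟨x, h⟩ = l • x}
  zero_mem' := ⟨A.domain.zero_mem, by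
    have : (⟨0, A.domain.zero_mem⟩ : A.domain) = 0 := rfl
    rw [this, A.map_zero, smul_zero]⟩
  add_mem' := by
    rintro x y ⟨hx, ex⟩ ⟨hy, ey⟩
    refine ⟨A.domain.add_mem hx hy, ?_⟩
    have : (⟨x + y, A.domain.add_mem hx hy⟩ : A.domain) = ⟨x, hx⟩ + ⟨y, hy⟩ := rfl
    rw [this, A.map_add, ex, ey, smul_add]
  smul_mem' := by
    rintro c x ⟨hx, ex⟩
    refine ⟨A.domain.smul_mem c hx, ?_⟩
    have : (⟨c • x, A.domain.smul_mem c hx⟩ : A.domain) = c • ⟨x, hx⟩ := rfl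
    rw [this, A.map_smul, ex, smul_comm]

/-- The spectrum of `A` is a finite or countable set of eigenvalues without finite accumulation
points. -/
def HasDiscreteSpectrum (A : H →ₗ.[ℝ] H) : Prop :=
  (spec A).Countable ∧ (∀ l ∈ spec A, eigenspace A l ≠ ⊥) ∧ ∀ a : ℝ, ¬ AccPt a (𝓟 (spec A))

variable [CompleteSpace H]

/-- The orthogonal projection of `H` onto `ker (A - l)`. (For a closed operator the eigenspace is
closed, so that taking its closure does not change it.) -/
def eigenproj (A : H →ₗ.[ℝ] H) (l : ℝ) : H →L[ℝ] H :=
  (eigenspace A l).topologicalClosure.starProjection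

/-! ### The square root

For a nonnegative self-adjoint `A` whose spectrum consists of isolated eigenvalues, the spectral
calculus gives `A^{1/2} x = ∑ √l • P_l x`, the sum being over the spectrum and `P_l` being the
orthogonal projection on `ker (A - l)`; the domain consists of those `x` for which the series
converges in `H`, which by orthogonality means `∑ l ‖P_l x‖² < ∞`. -/

/-- The domain `D(A^{1/2})`. -/
def sqrtDomain (A : H →ₗ.[ℝ] H) : Submodule ℝ H where
  carrier := {x | Summable fun l : spec A => Real.sqrt l • eigenproj A l x}
  zero_mem' := by simp [summable_zero]
  add_mem' := by
    intro x y hx hy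
    simpa only [Set.mem_ofPred_eq, map_add, smul_add] using Summable.add hx hy
  smul_mem' := by
    intro c x hx
    have h : Summable fun l : spec A => c • (Real.sqrt l • eigenproj A l x) :=
      Summable.const_smul c hx
    simpa only [Set.mem_ofPred_eq, map_smul, smul_comm c] using h

/-- The vector `A^{1/2} x`, for `x` in `D(A^{1/2})` (only used there). -/
def sqrtOp (A : H →ₗ.[ℝ] H) (x : H) : H :=
  ∑' l : spec A, Real.sqrt l • eigenproj A l x

/-- The norm `|x|_{D(A^{1/2})} = (|x|² + |A^{1/2} x|²)^{1/2}`. -/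
def sqrtNorm (A : H →ₗ.[ℝ] H) (x : H) : ℝ :=
  Real.sqrt (‖x‖ ^ 2 + ‖sqrtOp A x‖ ^ 2)

/-! ### Solutions

Functions on `[0, ∞)` are represented by functions `ℝ → H` of which only the restriction to
`[0, ∞)` matters. -/

/-- The velocity `u'(t)`, one-sided at `t = 0`. -/
def vel {H : Type*} [NormedAddCommGroup H] [InnerProductSpace ℝ H] (u : ℝ → H) (t : ℝ) : H :=
  derivWithin u (Ici 0) t

/-- `u ∈ C⁰([0,∞), D(A^{1/2})) ∩ C¹([0,∞), H)`. (Continuity for the norm of `D(A^{1/2})` is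
continuity in `H` of both `u` and `A^{1/2} u`.) -/
def HasEnergyRegularity (A : H →ₗ.[ℝ] H) (u : ℝ → H) : Prop :=
  (∀ t, 0 ≤ t → u t ∈ sqrtDomain A) ∧
  ContinuousOn (fun t => sqrtOp A (u t)) (Ici 0) ∧
  ContDiffOn ℝ 1 u (Ici 0)

/-- `u` is a weak solution of `u'' + 2δu' + Au = g` in `[0,∞)`, in the energy space: for every
test vector `φ ∈ D(A^{1/2})` and every `t ≥ 0`,
`d/dt ⟨u', φ⟩ + 2δ ⟨u', φ⟩ + ⟨A^{1/2} u, A^{1/2} φ⟩ = ⟨g, φ⟩`. -/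
def IsWeakSolution (A : H →ₗ.[ℝ] H) (δ : ℝ) (g u : ℝ → H) : Prop :=
  HasEnergyRegularity A u ∧
  ∀ φ ∈ sqrtDomain A, ∀ t, 0 ≤ t →
    HasDerivWithinAt (fun s => inner ℝ (vel u s) φ)
      (inner ℝ (g t) φ - 2 * δ * inner ℝ (vel u t) φ - inner ℝ (sqrtOp A (u t)) (sqrtOp A φ))
      (Ici 0) t

/-- `u` is a global solution of
`|u'' + 2δu' + Au| ≤ K₀ (|u|^{1+p} + |A^{1/2}u|^{1+q})`. -/
def IsGlobalSolution (A : H →ₗ.[ℝ] H) (δ K₀ p q : ℝ) (u : ℝ → H) : Prop :=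
  HasEnergyRegularity A u ∧
  ∃ g : ℝ → H, ContinuousOn g (Ici 0) ∧ IsWeakSolution A δ g u ∧
    ∀ t, 0 ≤ t → ‖g t‖ ≤ K₀ * (‖u t‖ ^ (1 + p) + ‖sqrtOp A (u t)‖ ^ (1 + q))

/-! ### Decay rates of the homogeneous equation and pure solutions -/

/-- The set `𝒟` of the real parts of the complex roots of `z² - 2δz + l`, for `l ∈ σ(A)`. -/
def decayRates {H : Type*} [NormedAddCommGroup H] [InnerProductSpace ℝ H]
    (A : H →ₗ.[ℝ] H) (δ : ℝ) : Set ℝ :=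
  {r | ∃ l ∈ spec A, ∃ z : ℂ, z ^ 2 - 2 * (δ : ℂ) * z + (l : ℂ) = 0 ∧ z.re = r}

open Classical in
/-- Let `x` be a solution of `x'' + 2δx' + l x = 0` (the projection on `ker (A - l)` of a solution
of the homogeneous equation), with `x(0) = x₀` and `x'(0) = x₁`. This is the part of `x` with
exponential factor `e^{-rt}`:
* if `l < δ²` there are two real roots, and the part belonging to the root `r`, the other root being
  `2δ - r`, is `e^{-rt} (x₁ + (2δ - r) x₀) / ((2δ - r) - r)`;
* if `l ≥ δ²` then all of `x` belongs to `r = δ` (this includes terms of type `t e^{-δt}`). -/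
def modeComponent {H : Type*} [NormedAddCommGroup H] [InnerProductSpace ℝ H]
    (δ l r : ℝ) (x : ℝ → H) (x₀ x₁ : H) (t : ℝ) : H :=
  if l < δ ^ 2 then
    if r ^ 2 - 2 * δ * r + l = 0 then
      (Real.exp (-(r * t)) / ((2 * δ - r) - r)) • (x₁ + (2 * δ - r) • x₀)
    else 0
  else
    if r = δ then x t else 0

/-- The component `u_r` in the decomposition `u = ∑ u_r`, `r ∈ 𝒟`, of a solution `u` of the
homogeneous equation: the sum of the parts with exponential factor `e^{-rt}` of all its modes. -/
def component (A : H →ₗ.[ℝ] H) (δ : ℝ) (u : ℝ → H) (r t : ℝ) : H :=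
  ∑' l : spec A, modeComponent δ l r (fun s => eigenproj A l (u s))
    (eigenproj A l (u 0)) (eigenproj A l (vel u 0)) t

/-- `v` is an `r₀`-pure solution of the homogeneous equation `v'' + 2δv' + Av = 0`: all its
components `v_r` with `r ≠ r₀` vanish identically. -/
def IsPureSolution (A : H →ₗ.[ℝ] H) (δ r₀ : ℝ) (v : ℝ → H) : Prop :=
  IsWeakSolution A δ (fun _ => 0) v ∧
  ∀ r ∈ decayRates A δ, r ≠ r₀ → ∀ t, 0 ≤ t → component A δ v r t = 0

/-- `β₀`: the smallest element of `𝒟` larger than `r₀`, and `+∞` if there is none. -/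
def nextRate {H : Type*} [NormedAddCommGroup H] [InnerProductSpace ℝ H]
    (A : H →ₗ.[ℝ] H) (δ r₀ : ℝ) : EReal :=
  sInf ((fun r : ℝ => (r : EReal)) '' {r | r ∈ decayRates A δ ∧ r₀ < r})

/-! ### The three alternatives -/

/-- `u ≡ 0` on `[0,∞)`. -/
def IsNull {H : Type*} [NormedAddCommGroup H] (u : ℝ → H) : Prop :=
  ∀ t, 0 ≤ t → u t = 0

/-- `u` is slow. -/
def IsSlow (A : H →ₗ.[ℝ] H) (p : ℝ) (u : ℝ → H) : Prop :=
  ∃ T₀ M₁ M₂ : ℝ, 0 ≤ T₀ ∧ 0 < M₁ ∧ 0 < M₂ ∧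
    (∀ t, T₀ ≤ t → M₁ / (1 + t) ^ (1 / p) ≤ ‖u t‖) ∧
    (∀ t, T₀ ≤ t → ‖vel u t‖ + ‖sqrtOp A (u t)‖ ≤ M₂ * ‖u t‖ ^ (1 + p))

/-- `u` is fast. -/
def IsFast (A : H →ₗ.[ℝ] H) (δ p q : ℝ) (u : ℝ → H) : Prop :=
  ∃ r₀ ∈ decayRates A δ, 0 < r₀ ∧
    ∃ v₀ : ℝ → H, IsPureSolution A δ r₀ v₀ ∧ ¬ IsNull v₀ ∧
      ∀ γ : ℝ,
        (γ : EReal) < min (nextRate A δ r₀)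
          (min (((1 + p) * r₀ : ℝ) : EReal) (((1 + q) * r₀ : ℝ) : EReal)) →
        Tendsto
          (fun t => (‖vel u t - vel v₀ t‖ + sqrtNorm A (u t - v₀ t)) * Real.exp (γ * t))
          atTop (𝓝 0)

end DissipativeEvolution

end

open DissipativeEvolution

/-! Spectral reduction. Since the spectrum is discrete, the eigenspaces of A are total
(`eq_zero_of_forall_inner_eigenspace`), so the equation splits into modes x'' + 2δx' + λx = g_λ.
Every λ ≥ δ² has rate δ and only finitely many λ lie below δ², so finitely many rates r occur.
Grouping by rate gives, on triples U = (u, A^{1/2}u, u'), finitely many projections S_r(0) with sum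
the identity (`sum_ratePropagator_zero`). On compatible triples in the range of S_r(0) the
homogeneous flow is a group S_r(t), bounded by a multiple of (1 + |t|)e^{-rt} for all real t.
Everything then rests on Duhamel's formula d/ds S_r(T - s)U(s) = S_r(T - s)(0, 0, g(s)), due to
`IsKernel.hasDerivAt_propagator`.

Slow or exponential (`slow_or_exponential`). The component a of rate 0 lives in ker A and satisfies
|a'| ≤ C|g| without linear term. All other components are dominated by a scalar R with R' = -νR +
|g|, ν > 0. As |g| is at most K|a|^{1+p} plus a small multiple of R, the region R ≤ M|a|^{1+p} is
eventually forward invariant (`neutral_stable_dichotomy`). If it is entered, then |a'| ≤ C|a|^{1+p},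
which forbids decay faster than t^{-1/p}, and the solution is slow. Otherwise R dominates and decays
exponentially, and a with it.

Exponential implies fast (`exists_profile`). Let θ be the supremum of the η with U = O(e^{-ηt}). It
is finite for a nonzero solution, because integration from infinity shows that too fast a decay
forces U = 0 (`exists_rate_forall_eq_zero`). Superlinearity makes g decay strictly faster than
e^{-θt}. Hence components of rate below θ, integrated from infinity, are as small as g. Those of
rate above θ follow the forcing or the next rate, and that of rate θ has a profile S_θ(t)z. If z
were 0, then U would decay faster than e^{-θt}; so z ≠ 0 and θ is a rate.

Exclusivity. The group property prevents a nonzero state of rate r from decaying faster than every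
e^{-γt} with γ > r (`eq_zero_of_tendsto_exp`), and exponential decay contradicts a polynomial lower
bound. -/

noncomputable section

namespace DissipativeEvolution

/-! ### Bounded symmetric operators on a real space: norm and spectral gaps. -/

section BoundedSymmetric

variable {H : Type*} [NormedAddCommGroup H] [InnerProductSpace ℝ H]

/-- `V² - ‖V‖²` is never invertible for a bounded symmetric operator `V`. -/
theorem not_isUnit_mul_self_sub_norm_sq [Nontrivial H] (V : H →L[ℝ] H)
    (hV : ∀ x y, inner ℝ (V x) y = inner ℝ x (V y)) :
    ¬ IsUnit (V * V - (‖V‖ ^ 2) • (1 : H →L[ℝ] H)) := by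
  rintro ⟨U, hU⟩
  set n := ‖V‖ with hn
  have hn0 : 0 ≤ n := norm_nonneg V
  set W : H →L[ℝ] H := (↑U⁻¹ : H →L[ℝ] H) with hW
  have hWU : ∀ x, W (V (V x) - (n ^ 2) • x) = x := by
    intro x
    have h : W * (U : H →L[ℝ] H) = 1 := U.inv_mul
    have h2 := congrArg (fun T : H →L[ℝ] H => T x) h
    rw [hU] at h2
    simpa using h2
  have hWpos : 0 < ‖W‖ := by
    rw [norm_pos_iff]
    intro h0
    obtain ⟨x, hx⟩ := exists_ne (0 : H)
    apply hx
    rw [← hWU x, h0]; simp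
  -- Invertibility of V² - n² keeps ‖Vx‖² below n²‖x‖² by a fixed proportion of ‖x‖², so the norm of
  -- V would be smaller than n.
  have key : ∀ x, ‖x‖ ^ 2 ≤ ‖W‖ ^ 2 * (n ^ 2 * (n ^ 2 * ‖x‖ ^ 2 - ‖V x‖ ^ 2)) := by
    intro x
    have h1 : ‖x‖ ≤ ‖W‖ * ‖V (V x) - (n ^ 2) • x‖ := by
      conv_lhs => rw [← hWU x]
      exact W.le_opNorm _
    have h2 : ‖V (V x) - (n ^ 2) • x‖ ^ 2 ≤ n ^ 2 * (n ^ 2 * ‖x‖ ^ 2 - ‖V x‖ ^ 2) := by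
      rw [norm_sub_sq_real, inner_smul_right, hV (V x) x, real_inner_self_eq_norm_sq, norm_smul]
      have h3 : ‖V (V x)‖ ^ 2 ≤ n ^ 2 * ‖V x‖ ^ 2 := by
        rw [← mul_pow]; gcongr; exact V.le_opNorm _
      rw [Real.norm_of_nonneg (by positivity)]
      nlinarith
    calc ‖x‖ ^ 2 ≤ (‖W‖ * ‖V (V x) - (n ^ 2) • x‖) ^ 2 := by gcongr
      _ = ‖W‖ ^ 2 * ‖V (V x) - (n ^ 2) • x‖ ^ 2 := by ring
      _ ≤ _ := by gcongr
  obtain ⟨x₀, hx₀⟩ := exists_ne (0 : H)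
  have hx₀' : 0 < ‖x₀‖ ^ 2 := by positivity
  have hnpos : 0 < n := by
    rcases hn0.eq_or_lt with h | h
    · have := key x₀
      rw [← h] at this
      simp at this
      exact absurd this hx₀
    · exact h
  set c := 1 / (‖W‖ ^ 2 * n ^ 2) with hc
  have hcpos : 0 < c := by positivity
  have key2 : ∀ x, ‖V x‖ ^ 2 ≤ (n ^ 2 - c) * ‖x‖ ^ 2 := by
    intro x
    have h := key x
    have h2 : c * ‖x‖ ^ 2 ≤ n ^ 2 * ‖x‖ ^ 2 - ‖V x‖ ^ 2 := by
      rw [hc, div_mul_eq_mul_div, one_mul, div_le_iff₀ (by positivity)]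
      linarith
    linarith
  have hnc : 0 ≤ n ^ 2 - c := by
    by_contra hneg
    push Not at hneg
    nlinarith [key2 x₀, sq_nonneg ‖V x₀‖]
  have h4 : n ≤ Real.sqrt (n ^ 2 - c) := by
    apply V.opNorm_le_bound (Real.sqrt_nonneg _)
    intro x
    rw [← Real.sqrt_sq (norm_nonneg x), ← Real.sqrt_mul hnc]
    exact Real.le_sqrt_of_sq_le (key2 x)
  have h5 := Real.sq_sqrt hnc
  nlinarith [Real.sqrt_nonneg (n ^ 2 - c)]

/-- A symmetric operator is bounded below near a gap of its spectrum. -/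
theorem mul_norm_le_of_gap (T : H →L[ℝ] H)
    (hT : ∀ x y, inner ℝ (T x) y = inner ℝ x (T y)) (a d : ℝ) (hd : 0 < d)
    (hgap : ∀ s, |s - a| < d → IsUnit (T - s • (1 : H →L[ℝ] H))) (x : H) :
    d * ‖x‖ ≤ ‖T x - a • x‖ := by
  rcases subsingleton_or_nontrivial H with hs | hs
  · simp [Subsingleton.elim x 0]
  obtain ⟨U, hU⟩ := hgap a (by simpa using hd)
  set V : H →L[ℝ] H := (↑U⁻¹ : H →L[ℝ] H) with hVdef
  have hVU : V * (T - a • (1 : H →L[ℝ] H)) = 1 := by rw [← hU]; exact U.inv_mul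
  have hUV : (T - a • (1 : H →L[ℝ] H)) * V = 1 := by rw [← hU]; exact U.mul_inv
  have hUV' : ∀ y, T (V y) - a • V y = y := fun y => by
    simpa using congrArg (fun T : H →L[ℝ] H => T y) hUV
  have hVU' : ∀ y, V (T y - a • y) = y := fun y => by
    simpa using congrArg (fun T : H →L[ℝ] H => T y) hVU
  have hVsymm : ∀ y z, inner ℝ (V y) z = inner ℝ y (V z) := by
    intro y z
    conv_lhs => rw [← hUV' z]
    conv_rhs => rw [← hUV' y]
    rw [inner_sub_right, inner_sub_left, inner_smul_left, inner_smul_right, hT]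
    simp
  set n := ‖V‖ with hn
  have hnpos : 0 < n := by
    rw [hn, norm_pos_iff]
    intro h0
    obtain ⟨y, hy⟩ := exists_ne (0 : H)
    exact hy (by rw [← hVU' y, h0]; simp)
  have hle : d ≤ 1 / n := by
    by_contra hlt
    push Not at hlt
    apply not_isUnit_mul_self_sub_norm_sq V hVsymm
    rw [← hn]
    have hunit : IsUnit V := ⟨U⁻¹, rfl⟩
    -- With V = (T - a)⁻¹, the points ±n of the spectrum of V correspond to the points a ± 1/n for
    -- T. If 1/n < d these lie in the gap, so both V - n and V + n, hence V² - n², would be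
    -- invertible.
    have fac : ∀ e : ℝ, e ≠ 0 → V - e • (1 : H →L[ℝ] H) =
        (-e) • (V * (T - (a + 1 / e) • (1 : H →L[ℝ] H))) := by
      intro e he
      have : T - (a + 1 / e) • (1 : H →L[ℝ] H) =
          (T - a • (1 : H →L[ℝ] H)) - (1 / e) • (1 : H →L[ℝ] H) := by
        rw [add_smul]; abel
      rw [this, mul_sub, hVU, mul_smul_comm, mul_one, smul_sub, smul_smul]
      field_simp
      simp
      abel
    have hu : ∀ e : ℝ, |e| = n → IsUnit (V - e • (1 : H →L[ℝ] H)) := by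
      intro e he
      have he0 : e ≠ 0 := by rintro rfl; simp at he; linarith
      rw [fac e he0]
      have h1 : IsUnit (V * (T - (a + 1 / e) • (1 : H →L[ℝ] H))) := by
        apply hunit.mul
        apply hgap
        rw [add_sub_cancel_left, abs_div, he, abs_one]
        exact hlt
      obtain ⟨w, hw⟩ := h1
      rw [← hw]
      exact ((Units.mk0 (-e) (neg_ne_zero.mpr he0)) • w).isUnit
    have : V * V - (n ^ 2) • (1 : H →L[ℝ] H) =
        (V - n • (1 : H →L[ℝ] H)) * (V - (-n) • (1 : H →L[ℝ] H)) := by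
      rw [neg_smul, sub_neg_eq_add, mul_add, sub_mul, sub_mul, mul_smul_comm, mul_smul_comm,
        smul_mul_assoc, mul_one, one_mul, mul_one, smul_smul, pow_two]
      abel
    rw [this]
    exact (hu n (abs_of_pos hnpos)).mul (hu (-n) (by rw [abs_neg, abs_of_pos hnpos]))
  have h1 : ‖x‖ ≤ n * ‖T x - a • x‖ := by
    conv_lhs => rw [← hVU' x]
    exact V.le_opNorm _
  calc d * ‖x‖ ≤ (1 / n) * (n * ‖T x - a • x‖) := by gcongr
    _ = ‖T x - a • x‖ := by field_simp

end BoundedSymmetric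

/-! ### Totality of the eigenspaces. -/

section Totality

variable {H : Type*} [NormedAddCommGroup H] [InnerProductSpace ℝ H]

theorem eigenspace_eq_bot_of_not_mem_spec {A : H →ₗ.[ℝ] H} {l : ℝ} (hl : l ∉ spec A) :
    eigenspace A l = ⊥ := by
  have hl' : InResolventSet A l := by
    by_contra h; exact hl h
  obtain ⟨R, -, hR⟩ := hl'
  rw [eq_bot_iff]
  rintro x ⟨hx, ex⟩
  have := hR ⟨x, hx⟩
  rw [ex] at this
  simp at this
  simp [← this]

theorem nonneg_of_mem_spec {A : H →ₗ.[ℝ] H} (hnonneg : IsNonneg A)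
    (hspec : HasDiscreteSpectrum A) {l : ℝ} (hl : l ∈ spec A) : 0 ≤ l := by
  obtain ⟨x, ⟨hx, ex⟩, hx0⟩ := Submodule.exists_mem_ne_zero_of_ne_bot (hspec.2.1 l hl)
  have h := hnonneg ⟨x, hx⟩
  rw [ex, inner_smul_left, real_inner_self_eq_norm_sq] at h
  have : 0 < ‖x‖ ^ 2 := by positivity
  simp only [conj_trivial] at h
  exact nonneg_of_mul_nonneg_left h this

theorem inner_map_eq_of_isSelfAdjoint [CompleteSpace H] {A : H →ₗ.[ℝ] H}
    (hdense : Dense (A.domain : Set H))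
    (hself : IsSelfAdjoint A) (x y : A.domain) :
    inner ℝ (A x) (y : H) = inner ℝ (x : H) (A y) := by
  have h := LinearPMap.adjoint_isFormalAdjoint (T := A) hdense
  have h2 : A.adjoint = A := hself
  rw [h2] at h
  exact h x y

theorem inner_eq_zero_of_mem_eigenspace [CompleteSpace H] {A : H →ₗ.[ℝ] H}
    (hdense : Dense (A.domain : Set H)) (hself : IsSelfAdjoint A) {l m : ℝ} (hlm : l ≠ m)
    {x y : H} (hx : x ∈ eigenspace A l) (hy : y ∈ eigenspace A m) : inner ℝ x y = 0 := by
  obtain ⟨hx, ex⟩ := hx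
  obtain ⟨hy, ey⟩ := hy
  have h := inner_map_eq_of_isSelfAdjoint hdense hself ⟨x, hx⟩ ⟨y, hy⟩
  rw [ex, ey, inner_smul_left, inner_smul_right] at h
  simp only [conj_trivial] at h
  have : (l - m) * inner ℝ x y = 0 := by linarith
  exact (mul_eq_zero.mp this).resolve_left (sub_ne_zero.mpr hlm)

/-- If a point is not an accumulation point of the spectrum of `A`, then the corresponding point is
not an accumulation point of the spectrum of the resolvent `R = (A + 1)⁻¹`. -/
theorem exists_gap_resolvent {A : H →ₗ.[ℝ] H}
    (hspec : ∀ a : ℝ, ¬ AccPt a (𝓟 (spec A))) {R : H →L[ℝ] H}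
    (hR₁ : ∀ y : H, ∃ h : R y ∈ A.domain, A ⟨R y, h⟩ - (-1 : ℝ) • R y = y)
    (hR₂ : ∀ x : A.domain, R (A x - (-1 : ℝ) • (x : H)) = x)
    {s : ℝ} (hs : 0 < s) :
    ∃ c > 0, ∀ t, t ≠ s → |t - s| < c → IsUnit (R - t • (1 : H →L[ℝ] H)) := by
  set m := 1 / s - 1 with hm
  have h1 : ∀ᶠ l in 𝓝[≠] m, l ∉ spec A := by
    have := hspec m
    rw [accPt_iff_frequently_nhdsNE] at this
    simpa using this
  rw [eventually_nhdsWithin_iff] at h1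
  have hcont : ContinuousAt (fun t : ℝ => 1 / t - 1) s := by
    have : s ≠ 0 := hs.ne'
    fun_prop (disch := assumption)
  have h2 := hcont.eventually h1
  obtain ⟨c, hc, h3⟩ := Metric.eventually_nhds_iff.mp (h2.and (lt_mem_nhds hs))
  refine ⟨c, hc, fun t hts htc => ?_⟩
  obtain ⟨h4, htpos⟩ := h3 (by rwa [Real.dist_eq])
  have h5 : InResolventSet A (1 / t - 1) := by
    by_contra hcon
    refine h4 ?_ hcon
    intro heq
    apply hts
    have : 1 / t = 1 / s := by
      have h : 1 / t - 1 = 1 / s - 1 := heq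
      linarith
    simpa using this
  obtain ⟨Q, hQ₁, hQ₂⟩ := h5
  have ht0 : t ≠ 0 := htpos.ne'
  -- With m = 1/t - 1 one has (A + 1)⁻¹ - t = -t(A - m)(A + 1)⁻¹. Its inverse is -(1/t)(A + 1)(A -
  -- m)⁻¹ = -(1/t)(1 + (1/t)Q), as m + 1 = 1/t.
  refine ⟨⟨R - t • (1 : H →L[ℝ] H), -(1 / t) • (1 + (1 / t) • Q), ?_, ?_⟩, rfl⟩
  · ext y
    obtain ⟨hy, ey⟩ := hQ₁ y
    have e1 : A ⟨Q y, hy⟩ - (-1 : ℝ) • Q y = y + (1 / t) • Q y := by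
      rw [← sub_eq_zero] at ey ⊢
      rw [← ey, sub_smul, neg_smul, one_smul]; abel
    have e2 := hR₂ ⟨Q y, hy⟩
    rw [e1, map_add, map_smul] at e2
    simp only [mul_apply_eq_comp, sub_apply,
      smul_apply, add_apply,
      one_apply_eq_self, map_smul, map_add, map_neg, neg_smul,
      neg_apply]
    have e3 : R y = Q y - (1 / t) • R (Q y) := by rw [eq_sub_iff_add_eq, e2]
    rw [e3]
    match_scalars <;> field_simp <;> ring
  · ext y
    obtain ⟨hy, ey⟩ := hR₁ y
    have e1 := hQ₂ ⟨R y, hy⟩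
    have e3 : R y - t • y = (-t) • (A ⟨R y, hy⟩ - (1 / t - 1) • R y) := by
      have e4 : y = A ⟨R y, hy⟩ + R y := by
        conv_lhs => rw [← ey]
        simp
      generalize A ⟨R y, hy⟩ = z at e4 ⊢
      generalize R y = w at e4 ⊢
      rw [e4]
      match_scalars <;> field_simp
    have e2 : Q (R y - t • y) = (-t) • R y := by rw [e3, map_smul, e1]
    simp only [mul_apply_eq_comp, sub_apply,
      smul_apply, add_apply,
      one_apply_eq_self, neg_smul,
      neg_apply]
    rw [e2, smul_smul]
    have : 1 / t * -t = -1 := by field_simp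
    rw [this]
    simp only [smul_sub, smul_add, smul_smul, one_smul, one_div, inv_mul_cancel₀ ht0, neg_smul]
    simp

/-- The eigenspaces of a nonnegative self-adjoint operator with discrete spectrum are total. -/
theorem eq_zero_of_forall_inner_eigenspace [CompleteSpace H] {A : H →ₗ.[ℝ] H}
    (hdense : Dense (A.domain : Set H)) (hself : IsSelfAdjoint A)
    (hnonneg : IsNonneg A) (hspec : HasDiscreteSpectrum A) {x₀ : H}
    (hx₀ : ∀ l : ℝ, ∀ e ∈ eigenspace A l, inner ℝ e x₀ = 0) : x₀ = 0 := by
  have hres : InResolventSet A (-1) := by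
    by_contra h
    have := nonneg_of_mem_spec hnonneg hspec h
    linarith
  obtain ⟨R, hR₁, hR₂⟩ := hres
  have hsymm := inner_map_eq_of_isSelfAdjoint hdense hself
  have hRsymm : ∀ y z, inner ℝ (R y) z = inner ℝ y (R z) := by
    intro y z
    obtain ⟨hy, ey⟩ := hR₁ y
    obtain ⟨hz, ez⟩ := hR₁ z
    conv_lhs => rw [← ez]
    conv_rhs => rw [← ey]
    rw [inner_sub_right, inner_sub_left, inner_smul_left, inner_smul_right]
    have := hsymm ⟨R y, hy⟩ ⟨R z, hz⟩
    simp only at this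
    rw [this]; simp
  have hRpos : ∀ y, ‖R y‖ ^ 2 ≤ inner ℝ (R y) y := by
    intro y
    obtain ⟨hy, ey⟩ := hR₁ y
    have h := hnonneg ⟨R y, hy⟩
    have : inner ℝ (R y) y = inner ℝ (A ⟨R y, hy⟩) (R y) + ‖R y‖ ^ 2 := by
      conv_lhs =>
        enter [3]
        rw [← ey]
      rw [inner_sub_right, inner_smul_right, real_inner_self_eq_norm_sq,
        real_inner_comm]
      ring
    simp only at h
    linarith
  have hRinj : ∀ y, R y = 0 → y = 0 := by
    intro y h0
    obtain ⟨hy, ey⟩ := hR₁ y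
    have : (⟨R y, hy⟩ : A.domain) = 0 := Subtype.ext h0
    rw [this, h0] at ey
    simpa using ey.symm
  -- N is invariant under R and contains no eigenvector. It is shown that the supremum s of the
  -- Rayleigh quotients of R on N could be lowered by the width of a spectral gap, which is absurd
  -- unless N = 0.
  set N : Submodule ℝ H := (⨆ l : ℝ, eigenspace A l)ᗮ with hN
  have memN : ∀ x, x ∈ N ↔ ∀ l : ℝ, ∀ e ∈ eigenspace A l, inner ℝ e x = 0 := by
    intro x
    rw [hN, ← Submodule.iInf_orthogonal]
    simp [Submodule.mem_iInf, Submodule.mem_orthogonal]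
  have hRN : ∀ x ∈ N, R x ∈ N := by
    intro x hx
    rw [memN] at hx ⊢
    intro l e he
    obtain ⟨hed, hAe⟩ := id he
    have h1 := hR₂ ⟨e, hed⟩
    rw [hAe] at h1
    have h2 : (l + 1) • R e = e := by
      rw [← map_smul, add_smul, one_smul]
      simpa using h1
    rw [← hRsymm]
    have h3 := hx l e he
    rw [← h2, inner_smul_left] at h3
    rcases mul_eq_zero.mp h3 with h4 | h4
    · have : l = -1 := by
        simp only [conj_trivial] at h4; linarith
      have : e = 0 := by rw [← h2, this]; simp
      rw [this]; simp
    · exact h4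
  by_contra hne
  have hx₀N : x₀ ∈ N := (memN x₀).mpr hx₀
  set Q : Set ℝ := {r | ∃ x ∈ N, x ≠ 0 ∧ r = inner ℝ (R x) x / ‖x‖ ^ 2} with hQ
  have hQb : BddAbove Q := by
    refine ⟨‖R‖, ?_⟩
    rintro r ⟨x, -, hx0, rfl⟩
    rw [div_le_iff₀ (by positivity)]
    calc inner ℝ (R x) x ≤ ‖R x‖ * ‖x‖ := real_inner_le_norm _ _
      _ ≤ ‖R‖ * ‖x‖ * ‖x‖ := by gcongr; exact R.le_opNorm x
      _ = _ := by ring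
  have hQne : Q.Nonempty := ⟨_, x₀, hx₀N, hne, rfl⟩
  set s := sSup Q with hs
  have hle : ∀ x ∈ N, inner ℝ (R x) x ≤ s * ‖x‖ ^ 2 := by
    intro x hx
    by_cases hx0 : x = 0
    · simp [hx0]
    · rw [← div_le_iff₀ (by positivity)]
      exact le_csSup hQb ⟨x, hx, hx0, rfl⟩
  have hspos : 0 < s := by
    have h1 : 0 < ‖R x₀‖ ^ 2 := by
      have : R x₀ ≠ 0 := fun h => hne (hRinj _ h)
      positivity
    have h2 := hRpos x₀
    have h3 := hle x₀ hx₀N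
    have h4 : 0 < ‖x₀‖ ^ 2 := by positivity
    by_contra hcon
    push Not at hcon
    nlinarith
  obtain ⟨c₀, hc₀, hgap₀⟩ := exists_gap_resolvent hspec.2.2 hR₁ hR₂ hspos
  set W : H →L[ℝ] H := s • (1 : H →L[ℝ] H) - R with hW
  have hWapp : ∀ x, W x = s • x - R x := fun x => by simp [hW]
  have hWN : ∀ x ∈ N, W x ∈ N := fun x hx => by
    rw [hWapp]; exact N.sub_mem (N.smul_mem _ hx) (hRN x hx)
  have hWsymm : ∀ y z, inner ℝ (W y) z = inner ℝ y (W z) := fun y z => by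
    rw [hWapp, hWapp, inner_sub_left, inner_sub_right, inner_smul_left, inner_smul_right, hRsymm]
    simp
  have hWpos : ∀ x ∈ N, 0 ≤ inner ℝ (W x) x := fun x hx => by
    rw [hWapp, inner_sub_left, inner_smul_left, real_inner_self_eq_norm_sq]
    have := hle x hx
    simpa using this
  have hWinj : ∀ x ∈ N, W x = 0 → x = 0 := by
    intro x hx h0
    rw [hWapp, sub_eq_zero] at h0
    obtain ⟨hd, ed⟩ := hR₁ x
    have hsx : x = s⁻¹ • R x := by rw [← h0, smul_smul, inv_mul_cancel₀ hspos.ne', one_smul]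
    have hmem : R x ∈ eigenspace A (s⁻¹ - 1) := by
      refine ⟨hd, ?_⟩
      have : A ⟨R x, hd⟩ = x - R x := by
        rw [eq_sub_iff_add_eq]; simpa using ed
      rw [this, sub_smul, one_smul, ← hsx]
    have hxmem : x ∈ eigenspace A (s⁻¹ - 1) := by
      rw [hsx]; exact Submodule.smul_mem _ _ hmem
    have := (memN x).mp hx _ x hxmem
    exact inner_self_eq_zero.mp this
  -- The spectrum of W avoids (0, c₀), which should mean W² ≥ c₀W. Without functional calculus this
  -- comes from squaring the bound ‖(W - c₀/2)x‖ ≥ (c₀/2)‖x‖ at the midpoint of the gap.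
  have hsq : ∀ x, c₀ * inner ℝ (W x) x ≤ ‖W x‖ ^ 2 := by
    intro x
    have h1 := mul_norm_le_of_gap R hRsymm (s - c₀ / 2) (c₀ / 2) (by positivity) (by
      intro t ht
      rw [abs_lt] at ht
      apply hgap₀ t
      · rintro rfl; linarith [ht.2]
      · rw [abs_lt]; constructor <;> linarith [ht.1, ht.2]) x
    have h2 : R x - (s - c₀ / 2) • x = (c₀ / 2) • x - W x := by
      rw [hWapp, sub_smul]; abel
    rw [h2] at h1
    have h3 : (c₀ / 2 * ‖x‖) ^ 2 ≤ ‖(c₀ / 2) • x - W x‖ ^ 2 := by gcongr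
    rw [norm_sub_sq_real, norm_smul, Real.norm_of_nonneg (by positivity), inner_smul_left,
      real_inner_comm] at h3
    simp only [conj_trivial] at h3
    linarith
  -- Cauchy-Schwarz for the semidefinite form ⟨Wx, y⟩ on N, with y = Wx, gives ‖y‖⁴ ≤ ⟨Wx, x⟩⟨Wy,
  -- y⟩. Together with `hsq` this bounds W below by c₀ on its range.
  have hcs : ∀ x ∈ N, c₀ * ‖W x‖ ^ 2 ≤ inner ℝ (W (W x)) (W x) := by
    intro x hx
    set y := W x with hy
    have hyN : y ∈ N := hWN x hx
    set α := inner ℝ (W x) x with hα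
    set β := inner ℝ (W y) y with hβ
    have hα0 : 0 ≤ α := hWpos x hx
    have hβ0 : 0 ≤ β := hWpos y hyN
    have hquad : ∀ r : ℝ, 0 ≤ β * (r * r) + (2 * ‖y‖ ^ 2) * r + α := by
      intro r
      have h := hWpos (x + r • y) (N.add_mem hx (N.smul_mem r hyN))
      have e : inner ℝ (W (x + r • y)) (x + r • y) =
          β * (r * r) + (2 * ‖y‖ ^ 2) * r + α := by
        rw [map_add, map_smul, inner_add_left, inner_add_right, inner_add_right,
          inner_smul_left, inner_smul_left, inner_smul_right, inner_smul_right,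
          hWsymm y x, ← hy, real_inner_self_eq_norm_sq]
        simp only [conj_trivial]
        ring
      rwa [e] at h
    have hd := discrim_le_zero hquad
    rw [discrim] at hd
    have h4 : ‖y‖ ^ 2 * ‖y‖ ^ 2 ≤ α * β := by nlinarith
    have h5 := hsq x
    rcases (sq_nonneg ‖y‖).eq_or_lt with h0 | h0
    · rw [← h0]; simpa using hβ0
    · have h6 : c₀ * (‖y‖ ^ 2 * ‖y‖ ^ 2) ≤ ‖y‖ ^ 2 * β := by nlinarith
      have h7 : ‖y‖ ^ 2 * (c₀ * ‖y‖ ^ 2) ≤ ‖y‖ ^ 2 * β := by linarith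
      exact le_of_mul_le_mul_left h7 h0
  set K : Submodule ℝ H := (N.map (W : H →ₗ[ℝ] H)).topologicalClosure with hK
  have hNclosed : IsClosed (N : Set H) := Submodule.isClosed_orthogonal _
  have hKN : K ≤ N := by
    apply Submodule.topologicalClosure_minimal _ _ hNclosed
    rintro _ ⟨x, hx, rfl⟩
    exact hWN x hx
  -- A symmetric injective operator on N has dense range, so the lower bound extends from W(N) to N.
  have hNK : N ≤ K := by
    intro x hx
    have : CompleteSpace K := (Submodule.isClosed_topologicalClosure _).completeSpace_coe
    have hk : K.starProjection x ∈ K := Submodule.starProjection_apply_mem K x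
    have hperp : x - K.starProjection x ∈ Kᗮ := Submodule.sub_starProjection_mem_orthogonal x
    have hdN : x - K.starProjection x ∈ N := N.sub_mem hx (hKN hk)
    have h0 : x - K.starProjection x = 0 := by
      apply hWinj _ hdN
      rw [← inner_self_eq_zero (𝕜 := ℝ), hWsymm, real_inner_comm]
      apply (Submodule.mem_orthogonal _ _).mp hperp
      apply Submodule.le_topologicalClosure
      exact ⟨_, hWN _ hdN, rfl⟩
    rw [sub_eq_zero] at h0
    rw [h0]; exact hk
  have hbelow : ∀ x ∈ N, c₀ * ‖x‖ ^ 2 ≤ inner ℝ (W x) x := by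
    intro x hx
    have hx' : x ∈ closure ((N.map (W : H →ₗ[ℝ] H) : Submodule ℝ H) : Set H) := hNK hx
    have hcl : IsClosed {x : H | c₀ * ‖x‖ ^ 2 ≤ inner ℝ (W x) x} :=
      isClosed_le (by fun_prop) (by fun_prop)
    refine hcl.closure_subset_iff.mpr ?_ hx'
    rintro _ ⟨z, hz, rfl⟩
    exact hcs z hz
  have : s ≤ s - c₀ := by
    apply csSup_le hQne
    rintro r ⟨x, hx, hx0, rfl⟩
    rw [div_le_iff₀ (by positivity)]
    have h1 := hbelow x hx
    rw [hWapp, inner_sub_left, inner_smul_left, real_inner_self_eq_norm_sq] at h1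
    simp only [conj_trivial] at h1
    linarith
  linarith

end Totality

/-! ### Differentiation through separating families of functionals. -/

section Separating

variable {E G κ : Type*} [NormedAddCommGroup E] [NormedSpace ℝ E] [CompleteSpace E]
  [NormedAddCommGroup G] [NormedSpace ℝ G]

/-- A fundamental theorem of calculus for curves that are differentiable after composition with a
separating family of continuous linear maps. -/
theorem sub_eq_integral_of_separating (L : κ → E →L[ℝ] G) (hL : ∀ x, (∀ k, L k x = 0) → x = 0)
    [CompleteSpace G] {f F : ℝ → E} {a b : ℝ} (hab : a ≤ b) (hf : ContinuousOn f (Icc a b))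
    (hF : ContinuousOn F (Icc a b))
    (h : ∀ k, ∀ t ∈ Ioo a b, HasDerivAt (fun s => L k (f s)) (L k (F t)) t) :
    f b - f a = ∫ t in a..b, F t := by
  have hint : IntervalIntegrable F MeasureTheory.volume a b := hF.intervalIntegrable_of_Icc hab
  rw [← sub_eq_zero]
  apply hL
  intro k
  rw [map_sub, map_sub, ← ContinuousLinearMap.intervalIntegral_comp_comm _ hint, sub_eq_zero]
  symm
  apply intervalIntegral.integral_eq_sub_of_hasDerivAt_of_le hab
  · exact (L k).continuous.comp_continuousOn hf
  · exact h k
  · exact ((L k).continuous.comp_continuousOn hF).intervalIntegrable_of_Icc hab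

/-- Continuity of the candidate derivative F makes f a primitive of F, so information on each mode,
or on each weak pairing, yields a strong derivative. -/
theorem hasDerivAt_of_separating (L : κ → E →L[ℝ] G) (hL : ∀ x, (∀ k, L k x = 0) → x = 0)
    [CompleteSpace G] {f F : ℝ → E} {a : ℝ} (hf : ContinuousOn f (Ici a))
    (hF : ContinuousOn F (Ici a))
    (h : ∀ k, ∀ t, a < t → HasDerivAt (fun s => L k (f s)) (L k (F t)) t) {t : ℝ} (ht : a < t) :
    HasDerivAt f (F t) t := by
  have hI : ∀ s, a < s → f s = f a + ∫ τ in a..s, F τ := by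
    intro s hs
    rw [← sub_eq_integral_of_separating L hL hs.le (hf.mono Icc_subset_Ici_self)
      (hF.mono Icc_subset_Ici_self) (fun k τ hτ => h k τ hτ.1)]
    abel
  have hFt : ContinuousAt F t := hF.continuousAt (Ici_mem_nhds ht)
  have hd : HasDerivAt (fun s => f a + ∫ τ in a..s, F τ) (F t) t := by
    apply HasDerivAt.const_add
    apply intervalIntegral.integral_hasDerivAt_right
    · exact (hF.mono Icc_subset_Ici_self).intervalIntegrable_of_Icc ht.le
    · exact ContinuousOn.stronglyMeasurableAtFilter_nhdsWithin
        (hF.mono Ioi_subset_Ici_self) measurableSet_Ioi t |>.filter_mono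
        (by rw [isOpen_Ioi.nhdsWithin_eq ht])
    · exact hFt
  apply hd.congr_of_eventuallyEq
  filter_upwards [Ioi_mem_nhds ht] with s hs
  exact hI s hs

end Separating

/-! ### Orthogonal resolutions, Parseval's identity and multipliers. -/

section Resolution

variable {H ι : Type*} [NormedAddCommGroup H] [InnerProductSpace ℝ H]

/-- A family of mutually orthogonal projections whose ranges span a dense subspace. -/
structure IsResolution (P : ι → H →L[ℝ] H) : Prop where
  symm : ∀ i x y, inner ℝ (P i x) y = inner ℝ x (P i y)
  comp_self : ∀ i x, P i (P i x) = P i x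
  comp_ne : ∀ i j, i ≠ j → ∀ x, P i (P j x) = 0
  total : ∀ x, (∀ i, P i x = 0) → x = 0

namespace IsResolution

variable {P : ι → H →L[ℝ] H} (hP : IsResolution P)
include hP

theorem ext {x y : H} (h : ∀ i, P i x = P i y) : x = y := by
  rw [← sub_eq_zero]
  exact hP.total _ fun i => by rw [map_sub, h, sub_self]

theorem inner_of_ne {i j : ι} (hij : i ≠ j) (x y : H) : inner ℝ (P i x) (P j y) = 0 := by
  rw [hP.symm, hP.comp_ne i j hij, inner_zero_right]

theorem summable_iff [CompleteSpace H] {y : ι → H} (hy : ∀ i, P i (y i) = y i) :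
    Summable y ↔ Summable fun i => ‖y i‖ ^ 2 := by
  have hV : OrthogonalFamily ℝ (fun i => LinearMap.range (P i : H →ₗ[ℝ] H))
      fun i => (LinearMap.range (P i : H →ₗ[ℝ] H)).subtypeₗᵢ := by
    rintro i j hij ⟨_, x, rfl⟩ ⟨_, z, rfl⟩
    exact hP.inner_of_ne hij x z
  exact hV.summable_iff_norm_sq_summable fun i => ⟨y i, y i, hy i⟩

theorem proj_hasSum {y : ι → H} (hy : ∀ i, P i (y i) = y i) {s : H} (hs : HasSum y s) (i : ι) :
    P i s = y i := by
  have h := (P i).hasSum hs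
  refine h.unique ?_
  have h0 : ∀ j, j ≠ i → P i (y j) = 0 := fun j hj => by
    rw [← hy j]; exact hP.comp_ne i j hj.symm _
  have := hasSum_single i h0
  rwa [hy i] at this

theorem norm_sq_hasSum {y : ι → H} (hy : ∀ i, P i (y i) = y i) {s : H} (hs : HasSum y s) :
    HasSum (fun i => ‖y i‖ ^ 2) (‖s‖ ^ 2) := by
  have h := (innerSL ℝ s).hasSum hs
  simp only [innerSL_apply_apply, real_inner_self_eq_norm_sq] at h
  have e : ∀ i, ‖y i‖ ^ 2 = inner ℝ s (y i) := fun i => by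
    rw [← hy i, ← hP.symm, hP.proj_hasSum hy hs, hy, real_inner_self_eq_norm_sq]
  simpa only [e] using h

/-- Bessel's inequality gives convergence; totality identifies the sum with x, since both have the
same projections. -/
theorem hasSum_proj [CompleteSpace H] (x : H) : HasSum (fun i => P i x) x := by
  have hb : ∀ F : Finset ι, ∑ i ∈ F, ‖P i x‖ ^ 2 ≤ ‖x‖ ^ 2 := by
    intro F
    have e1 : inner ℝ (∑ i ∈ F, P i x) x = ∑ i ∈ F, ‖P i x‖ ^ 2 := by
      rw [sum_inner]
      refine Finset.sum_congr rfl fun i _ => ?_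
      rw [← hP.comp_self, hP.symm, real_inner_self_eq_norm_sq, hP.comp_self]
    have e2 : ‖∑ i ∈ F, P i x‖ ^ 2 = ∑ i ∈ F, ‖P i x‖ ^ 2 := by
      rw [← e1, ← real_inner_self_eq_norm_sq, inner_sum, sum_inner]
      refine Finset.sum_congr rfl fun i hi => ?_
      rw [sum_inner, Finset.sum_eq_single i]
      · rw [← hP.symm, hP.comp_self]
      · intro j _ hj; exact hP.inner_of_ne hj x x
      · intro h; exact absurd hi h
    have e3 : inner ℝ (∑ i ∈ F, P i x) x ≤ ‖∑ i ∈ F, P i x‖ * ‖x‖ := real_inner_le_norm _ _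
    rw [e1, ← e2] at e3
    rw [← e2]
    gcongr
    rcases (norm_nonneg (∑ i ∈ F, P i x)).eq_or_lt with h0 | h0
    · rw [← h0]; exact norm_nonneg x
    · rw [pow_two] at e3
      exact le_of_mul_le_mul_left e3 h0
  have hs : Summable fun i => ‖P i x‖ ^ 2 :=
    summable_of_sum_le (fun i => by positivity) hb
  have hs' := (hP.summable_iff (y := fun i => P i x) (fun i => hP.comp_self i x)).mpr hs
  obtain ⟨s, hs''⟩ := hs'
  have : s = x := hP.ext fun i => hP.proj_hasSum (fun i => hP.comp_self i x) hs'' i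
  rwa [this] at hs''

theorem norm_sq_proj_hasSum [CompleteSpace H] (x : H) :
    HasSum (fun i => ‖P i x‖ ^ 2) (‖x‖ ^ 2) :=
  hP.norm_sq_hasSum (fun i => hP.comp_self i x) (hP.hasSum_proj x)

theorem norm_le_of_forall_proj [CompleteSpace H] {x y : H} {C : ℝ} (hC : 0 ≤ C)
    (h : ∀ i, ‖P i x‖ ≤ C * ‖P i y‖) : ‖x‖ ≤ C * ‖y‖ := by
  have h1 := hP.norm_sq_proj_hasSum x
  have h2 := (hP.norm_sq_proj_hasSum y).mul_left (C ^ 2)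
  have h3 : ‖x‖ ^ 2 ≤ C ^ 2 * ‖y‖ ^ 2 := by
    refine hasSum_le (fun i => ?_) h1 h2
    rw [← mul_pow]
    gcongr
    exact h i
  rw [← mul_pow] at h3
  exact le_of_sq_le_sq h3 (by positivity)

/-- A vector is determined by a square summable family of components. -/
theorem exists_of_summable [CompleteSpace H] {y : ι → H} (hy : ∀ i, P i (y i) = y i)
    (hs : Summable fun i => ‖y i‖ ^ 2) : ∃ s, ∀ i, P i s = y i := by
  obtain ⟨s, hs⟩ := (hP.summable_iff hy).mpr hs
  exact ⟨s, hP.proj_hasSum hy hs⟩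

theorem exists_multiplier [CompleteSpace H] {f : ι → ℝ} {C : ℝ} (hf : ∀ i, |f i| ≤ C) :
    ∃ T : H →L[ℝ] H, ∀ i x, P i (T x) = f i • P i x := by
  have h : ∀ x, ∃ s, ∀ i, P i s = f i • P i x := by
    intro x
    apply hP.exists_of_summable
    · intro i; rw [map_smul, hP.comp_self]
    · refine Summable.of_nonneg_of_le (fun i => by positivity) (fun i => ?_)
        ((hP.norm_sq_proj_hasSum x).summable.mul_left (C ^ 2))
      rw [norm_smul, mul_pow, Real.norm_eq_abs]
      gcongr
      exact hf i
  choose T hT using h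
  by_cases hι : IsEmpty ι
  · exact ⟨0, fun i => hι.elim i⟩
  rw [not_isEmpty_iff] at hι
  have hC : 0 ≤ C := (abs_nonneg _).trans (hf hι.some)
  let T' : H →ₗ[ℝ] H :=
    { toFun := T
      map_add' := fun x y => hP.ext fun i => by simp [hT]
      map_smul' := fun c x => hP.ext fun i => by simp [hT, smul_comm c] }
  refine ⟨T'.mkContinuous C fun x => ?_, fun i x => hT x i⟩
  apply hP.norm_le_of_forall_proj hC
  intro i
  change ‖P i (T x)‖ ≤ _
  rw [hT, norm_smul, Real.norm_eq_abs]
  gcongr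
  exact hf i

end IsResolution

open Classical in
/-- The operator which acts as multiplication by `f i` on the range of `P i`. It is `0` if there is
no such bounded operator. -/
def multiplier (P : ι → H →L[ℝ] H) (f : ι → ℝ) : H →L[ℝ] H :=
  if h : ∃ T : H →L[ℝ] H, ∀ i x, P i (T x) = f i • P i x then h.choose else 0

namespace IsResolution

variable {P : ι → H →L[ℝ] H} (hP : IsResolution P) [CompleteSpace H]
include hP

theorem proj_multiplier {f : ι → ℝ} (hf : ∃ C, ∀ i, |f i| ≤ C) (i : ι) (x : H) :
    P i (multiplier P f x) = f i • P i x := by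
  obtain ⟨C, hf⟩ := hf
  rw [multiplier, dif_pos (hP.exists_multiplier hf)]
  exact (hP.exists_multiplier hf).choose_spec i x

theorem norm_multiplier_le {f : ι → ℝ} {C : ℝ} (hC : 0 ≤ C) (hf : ∀ i, |f i| ≤ C) (x : H) :
    ‖multiplier P f x‖ ≤ C * ‖x‖ := by
  apply hP.norm_le_of_forall_proj hC
  intro i
  rw [hP.proj_multiplier ⟨C, hf⟩, norm_smul, Real.norm_eq_abs]
  gcongr
  exact hf i

/-- Only strong continuity can be expected, because the frequencies are unbounded over the modes. It
follows from dominated convergence in Parseval's series. -/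
theorem continuousAt_multiplier {f : ℝ → ι → ℝ} {C : ℝ → ℝ} (hC : Continuous C)
    (hf : ∀ t i, |f t i| ≤ C t) (hfc : ∀ i, Continuous fun t => f t i) (x : H) (t₀ : ℝ) :
    Tendsto (fun t => multiplier P (f t) x) (𝓝 t₀) (𝓝 (multiplier P (f t₀) x)) := by
  rw [tendsto_iff_norm_sub_tendsto_zero]
  have hsq : Tendsto (fun t => ‖multiplier P (f t) x - multiplier P (f t₀) x‖ ^ 2) (𝓝 t₀)
      (𝓝 0) := by
    have e : ∀ t, ‖multiplier P (f t) x - multiplier P (f t₀) x‖ ^ 2 =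
        ∑' i, |f t i - f t₀ i| ^ 2 * ‖P i x‖ ^ 2 := by
      intro t
      rw [← (hP.norm_sq_proj_hasSum _).tsum_eq]
      congr 1
      ext i
      rw [map_sub, hP.proj_multiplier ⟨_, hf t⟩, hP.proj_multiplier ⟨_, hf t₀⟩, ← sub_smul,
        norm_smul, mul_pow, Real.norm_eq_abs]
    simp_rw [e]
    have : (0 : ℝ) = ∑' i : ι, (0 : ℝ) := by simp
    rw [this]
    apply tendsto_tsum_of_dominated_convergence
      (bound := fun i => (C t₀ + 1 + C t₀) ^ 2 * ‖P i x‖ ^ 2)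
    · exact (hP.norm_sq_proj_hasSum x).summable.mul_left _
    · intro i
      have h1 : Tendsto (fun t => |f t i - f t₀ i| ^ 2 * ‖P i x‖ ^ 2) (𝓝 t₀)
          (𝓝 (|f t₀ i - f t₀ i| ^ 2 * ‖P i x‖ ^ 2)) := by
        apply Continuous.tendsto (f := fun t => |f t i - f t₀ i| ^ 2 * ‖P i x‖ ^ 2)
        have := hfc i
        fun_prop
      simpa using h1
    · have h1 : ∀ᶠ t in 𝓝 t₀, C t < C t₀ + 1 :=
        hC.continuousAt.eventually (gt_mem_nhds (by linarith))
      filter_upwards [h1] with t ht i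
      rw [Real.norm_of_nonneg (by positivity)]
      gcongr
      calc |f t i - f t₀ i| ≤ |f t i| + |f t₀ i| := abs_sub _ _
        _ ≤ C t₀ + 1 + C t₀ := add_le_add ((hf t i).trans ht.le) (hf t₀ i)
  have := hsq.sqrt
  simpa [Real.sqrt_sq (norm_nonneg _)] using this

/-- Strong continuity together with a locally uniform operator bound allows the vector to vary with
t as well. -/
theorem continuousOn_multiplier {f : ℝ → ι → ℝ} {C : ℝ → ℝ} (hC : Continuous C)
    (hf : ∀ t i, |f t i| ≤ C t) (hfc : ∀ i, Continuous fun t => f t i) {x : ℝ → H} {s : Set ℝ}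
    (hx : ContinuousOn x s) : ContinuousOn (fun t => multiplier P (f t) (x t)) s := by
  intro t₀ ht₀
  have h1 : Tendsto (fun t => multiplier P (f t) (x t₀)) (𝓝[s] t₀)
      (𝓝 (multiplier P (f t₀) (x t₀))) :=
    (hP.continuousAt_multiplier hC hf hfc (x t₀) t₀).mono_left nhdsWithin_le_nhds
  have h2 : Tendsto (fun t => multiplier P (f t) (x t - x t₀)) (𝓝[s] t₀) (𝓝 0) := by
    have h3 : Tendsto (fun t => |C t| * ‖x t - x t₀‖) (𝓝[s] t₀) (𝓝 0) := by
      have h4 : Tendsto (fun t => |C t|) (𝓝[s] t₀) (𝓝 |C t₀|) :=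
        (hC.abs.tendsto t₀).mono_left nhdsWithin_le_nhds
      have h5 : Tendsto (fun t => ‖x t - x t₀‖) (𝓝[s] t₀) (𝓝 0) :=
        tendsto_iff_norm_sub_tendsto_zero.mp (hx t₀ ht₀)
      simpa using h4.mul h5
    refine squeeze_zero_norm (fun t => ?_) h3
    exact hP.norm_multiplier_le (abs_nonneg _) (fun i => (hf t i).trans (le_abs_self _)) _
  have h6 := h1.add h2
  simp only [map_sub, add_sub_cancel, add_zero] at h6
  exact h6

end IsResolution

end Resolution

/-! ### Solutions described mode by mode. -/

section ModalSolution

variable {H ι : Type*} [NormedAddCommGroup H] [InnerProductSpace ℝ H]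

/-- The triple `U = (u, A^{1/2} u, u')` satisfies `u'' + 2δu' + Au = g` mode by mode
in `[a, ∞)`. -/
structure IsModalSolution (P : ι → H →L[ℝ] H) (lam : ι → ℝ) (δ a : ℝ) (g : ℝ → H)
    (U : ℝ → H × H × H) : Prop where
  cont : ContinuousOn U (Ici a)
  sqrt : ∀ t, a ≤ t → ∀ i, P i (U t).2.1 = Real.sqrt (lam i) • P i (U t).1
  deriv_fst : ∀ t, a < t → ∀ i, HasDerivAt (fun s => P i (U s).1) (P i (U t).2.2) t
  deriv_vel : ∀ t, a < t → ∀ i, HasDerivAt (fun s => P i (U s).2.2)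
    (P i (g t) - (2 * δ) • P i (U t).2.2 - lam i • P i (U t).1) t

variable {P : ι → H →L[ℝ] H} (hP : IsResolution P) [CompleteSpace H]
  {lam : ι → ℝ} {δ a : ℝ} {g : ℝ → H} {U : ℝ → H × H × H}

theorem IsModalSolution.hasDerivAt_fst (hP : IsResolution P) (hU : IsModalSolution P lam δ a g U)
    {t : ℝ} (ht : a < t) :
    HasDerivAt (fun s => (U s).1) (U t).2.2 t :=
  hasDerivAt_of_separating P hP.total (F := fun t => (U t).2.2)
    (continuous_fst.comp_continuousOn hU.cont)
    ((continuous_snd.comp continuous_snd).comp_continuousOn hU.cont)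
    (fun k t ht => hU.deriv_fst t ht k) ht

/-- The weak formulation of the homogeneous equation, for modal solutions. -/
theorem IsModalSolution.hasDerivAt_inner (hP : IsResolution P)
    (hU : IsModalSolution P lam δ a (fun _ => 0) U)
    (hlam : ∀ i, 0 ≤ lam i)
    {φ ψ : H} (hφ : ∀ i, P i ψ = Real.sqrt (lam i) • P i φ) {t : ℝ} (ht : a < t) :
    HasDerivAt (fun s => inner ℝ (U s).2.2 φ)
      (- 2 * δ * inner ℝ (U t).2.2 φ - inner ℝ (U t).2.1 ψ) t := by
  have c1 : ContinuousOn (fun s => (U s).2.1) (Ici a) :=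
    (continuous_fst.comp continuous_snd).comp_continuousOn hU.cont
  have c2 : ContinuousOn (fun s => (U s).2.2) (Ici a) :=
    (continuous_snd.comp continuous_snd).comp_continuousOn hU.cont
  have hF : ContinuousOn (fun s => - 2 * δ * inner ℝ (U s).2.2 φ - inner ℝ (U s).2.1 ψ)
      (Ici a) :=
    (continuousOn_const.mul (c2.inner continuousOn_const)).sub (c1.inner continuousOn_const)
  have hI : ∀ s, a < s → inner ℝ (U s).2.2 φ - inner ℝ (U a).2.2 φ =
      ∫ τ in a..s, (- 2 * δ * inner ℝ (U τ).2.2 φ - inner ℝ (U τ).2.1 ψ) := by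
    intro s hs
    have i1 : IntervalIntegrable (fun τ => (U τ).2.1) MeasureTheory.volume a s :=
      (c1.mono Icc_subset_Ici_self).intervalIntegrable_of_Icc hs.le
    have i2 : IntervalIntegrable (fun τ => (U τ).2.2) MeasureTheory.volume a s :=
      (c2.mono Icc_subset_Ici_self).intervalIntegrable_of_Icc hs.le
    have j1 : ∫ τ in a..s, inner ℝ (U τ).2.1 ψ = inner ℝ (∫ τ in a..s, (U τ).2.1) ψ := by
      have := ContinuousLinearMap.intervalIntegral_comp_comm (innerSL ℝ ψ) i1
      simpa [real_inner_comm] using this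
    have j2 : ∫ τ in a..s, inner ℝ (U τ).2.2 φ = inner ℝ (∫ τ in a..s, (U τ).2.2) φ := by
      have := ContinuousLinearMap.intervalIntegral_comp_comm (innerSL ℝ φ) i2
      simpa [real_inner_comm] using this
    have k1 : IntervalIntegrable (fun τ => inner ℝ (U τ).2.1 ψ) MeasureTheory.volume a s :=
      ((c1.inner continuousOn_const).mono Icc_subset_Ici_self).intervalIntegrable_of_Icc hs.le
    have k2 : IntervalIntegrable (fun τ => inner ℝ (U τ).2.2 φ) MeasureTheory.volume a s :=
      ((c2.inner continuousOn_const).mono Icc_subset_Ici_self).intervalIntegrable_of_Icc hs.le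
    rw [intervalIntegral.integral_sub (k2.const_mul _) k1, intervalIntegral.integral_const_mul,
      j1, j2]
    set M := ∫ τ in a..s, (U τ).2.1 with hM
    set V := ∫ τ in a..s, (U τ).2.2 with hV
    -- Formally d = -∫Au = -A^{1/2}M. Since M need not belong to D(A^{1/2}), this is only asserted
    -- on each mode; pairing with φ and summing the modes then moves the square root onto φ.
    set d := (U s).2.2 - (U a).2.2 + (2 * δ) • V with hd
    have hPd : ∀ i, P i d = - Real.sqrt (lam i) • P i M := by
      intro i
      have e1 : P i (U s).2.2 - P i (U a).2.2 =
          ∫ τ in a..s, P i ((-(2 * δ)) • (U τ).2.2 - Real.sqrt (lam i) • (U τ).2.1) := by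
        symm
        apply intervalIntegral.integral_eq_sub_of_hasDerivAt_of_le hs.le
          (f := fun τ => P i (U τ).2.2)
        · exact (P i).continuous.comp_continuousOn (c2.mono Icc_subset_Ici_self)
        · intro τ hτ
          convert hU.deriv_vel τ hτ.1 i using 1
          rw [map_sub, map_smul, map_smul, hU.sqrt τ hτ.1.le, smul_smul,
            Real.mul_self_sqrt (hlam i)]
          simp
        · apply ContinuousOn.intervalIntegrable_of_Icc hs.le
          apply (P i).continuous.comp_continuousOn
          exact ((c2.const_smul _).sub (c1.const_smul _)).mono Icc_subset_Ici_self
      have e2 : ∫ τ in a..s, ((-(2 * δ)) • (U τ).2.2 - Real.sqrt (lam i) • (U τ).2.1) =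
          (-(2 * δ)) • V - Real.sqrt (lam i) • M := by
        have i3 : IntervalIntegrable (fun τ => (-(2 * δ)) • (U τ).2.2) MeasureTheory.volume a s :=
          i2.smul _
        have i4 : IntervalIntegrable (fun τ => Real.sqrt (lam i) • (U τ).2.1)
          MeasureTheory.volume a s := i1.smul _
        rw [intervalIntegral.integral_sub i3 i4,
          intervalIntegral.integral_smul, intervalIntegral.integral_smul]
      have e3 := ContinuousLinearMap.intervalIntegral_comp_comm (P i) (a := a) (b := s)
        (f := fun τ => (-(2 * δ)) • (U τ).2.2 - Real.sqrt (lam i) • (U τ).2.1)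
        ((i2.smul _).sub (i1.smul _))
      rw [e3, e2] at e1
      rw [hd, map_add, map_sub, e1, map_sub]
      simp
      abel
    have h1 : inner ℝ d φ = - inner ℝ M ψ := by
      have s1 := (innerSL ℝ d).hasSum (hP.hasSum_proj φ)
      have s2 := ((innerSL ℝ M).hasSum (hP.hasSum_proj ψ)).neg
      simp only [innerSL_apply_apply] at s1 s2
      refine s1.unique ?_
      have e : ∀ i, inner ℝ d (P i φ) = - inner ℝ M (P i ψ) := fun i => ?_
      · simpa only [e] using s2
      rw [← hP.comp_self, ← hP.symm, hPd, ← hP.comp_self, hP.comp_self, ← hP.comp_self i ψ,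
        ← hP.symm i M, hφ, inner_smul_left, inner_smul_right]
      simp
    rw [hd, inner_add_left, inner_sub_left, inner_smul_left] at h1
    simp only [conj_trivial] at h1
    linarith
  have hd : HasDerivAt (fun s => inner ℝ (U a).2.2 φ +
      ∫ τ in a..s, (- 2 * δ * inner ℝ (U τ).2.2 φ - inner ℝ (U τ).2.1 ψ))
      (- 2 * δ * inner ℝ (U t).2.2 φ - inner ℝ (U t).2.1 ψ) t := by
    apply HasDerivAt.const_add
    apply intervalIntegral.integral_hasDerivAt_right
    · exact (hF.mono Icc_subset_Ici_self).intervalIntegrable_of_Icc ht.le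
    · exact ContinuousOn.stronglyMeasurableAtFilter_nhdsWithin
        (hF.mono Ioi_subset_Ici_self) measurableSet_Ioi t |>.filter_mono
        (by rw [isOpen_Ioi.nhdsWithin_eq ht])
    · exact hF.continuousAt (Ici_mem_nhds ht)
  apply hd.congr_of_eventuallyEq
  filter_upwards [Ioi_mem_nhds ht] with s hs
  rw [← hI s hs]
  ring

end ModalSolution

/-! ### From weak solutions to modal solutions and back. -/

section Operator

variable {H : Type*} [NormedAddCommGroup H] [InnerProductSpace ℝ H] [CompleteSpace H]
  {A : H →ₗ.[ℝ] H}

/-- The eigenprojections, indexed by the spectrum. -/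
abbrev specProj (A : H →ₗ.[ℝ] H) (l : spec A) : H →L[ℝ] H := eigenproj A l

theorem isResolution_specProj (hdense : Dense (A.domain : Set H)) (hself : IsSelfAdjoint A)
    (hnonneg : IsNonneg A) (hspec : HasDiscreteSpectrum A) : IsResolution (specProj A) where
  symm l x y := Submodule.inner_starProjection_left_eq_right _ x y
  comp_self l x := by
    apply Submodule.starProjection_eq_self_iff.mpr
    exact Submodule.starProjection_apply_mem _ _
  comp_ne l m hlm x := by
    apply (Submodule.starProjection_apply_eq_zero_iff _).mpr
    have h1 : (eigenspace A m).topologicalClosure ≤ ((eigenspace A l).topologicalClosure)ᗮ := by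
      rw [Submodule.orthogonal_closure]
      apply Submodule.topologicalClosure_minimal _ _ (Submodule.isClosed_orthogonal _)
      intro y hy
      rw [Submodule.mem_orthogonal]
      intro z hz
      exact inner_eq_zero_of_mem_eigenspace hdense hself (fun h => hlm (Subtype.ext h)) hz hy
    exact h1 (Submodule.starProjection_apply_mem _ _)
  total x hx := by
    apply eq_zero_of_forall_inner_eigenspace hdense hself hnonneg hspec
    intro l e he
    by_cases hl : l ∈ spec A
    · have h1 := (Submodule.starProjection_apply_eq_zero_iff _).mp (hx ⟨l, hl⟩)
      exact (Submodule.mem_orthogonal _ _).mp h1 e (Submodule.le_topologicalClosure _ he)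
    · rw [eigenspace_eq_bot_of_not_mem_spec hl, Submodule.mem_bot] at he
      rw [he, inner_zero_left]

theorem proj_sqrtOp (hP : IsResolution (specProj A)) {x : H} (hx : x ∈ sqrtDomain A) (l : spec A) :
    specProj A l (sqrtOp A x) = Real.sqrt l • specProj A l x :=
  hP.proj_hasSum (y := fun l : spec A => Real.sqrt l • specProj A l x)
    (fun i => by rw [map_smul, hP.comp_self]) (Summable.hasSum hx) l

/-- Membership in D(A^{1/2}) and the value of A^{1/2} can thereby both be read off from the modes of
a candidate vector m. -/
theorem hasSum_sqrtOp (hP : IsResolution (specProj A)) {x m : H}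
    (h : ∀ l : spec A, specProj A l m = Real.sqrt l • specProj A l x) :
    HasSum (fun l : spec A => Real.sqrt l • specProj A l x) m := by
  simpa only [h] using hP.hasSum_proj m

theorem mem_sqrtDomain_of_proj (hP : IsResolution (specProj A)) {x m : H}
    (h : ∀ l : spec A, specProj A l m = Real.sqrt l • specProj A l x) : x ∈ sqrtDomain A :=
  (hasSum_sqrtOp hP h).summable

theorem sqrtOp_eq_of_proj (hP : IsResolution (specProj A)) {x m : H}
    (h : ∀ l : spec A, specProj A l m = Real.sqrt l • specProj A l x) : sqrtOp A x = m :=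
  (hasSum_sqrtOp hP h).tsum_eq

/-- This exhibits √l • P_l x as A^{1/2} of P_l x, so that projected vectors are admissible test
vectors in the weak formulation. -/
theorem proj_smul_eq (hP : IsResolution (specProj A)) (l m : spec A) (x : H) :
    specProj A m (Real.sqrt l • specProj A l x) =
      Real.sqrt m • specProj A m (specProj A l x) := by
  rw [map_smul]
  by_cases h : m = l
  · rw [h]
  · rw [hP.comp_ne _ _ h, smul_zero, smul_zero]

/-- The triple `(u, A^{1/2} u, u')`. -/
def stateCurve (A : H →ₗ.[ℝ] H) (u : ℝ → H) (t : ℝ) : H × H × H :=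
  (u t, sqrtOp A (u t), vel u t)

theorem hasDerivAt_of_contDiffOn {u : ℝ → H} (hu : ContDiffOn ℝ 1 u (Ici 0)) {t : ℝ}
    (ht : 0 < t) : HasDerivAt u (vel u t) t :=
  ((hu.differentiableOn one_ne_zero t ht.le).hasDerivWithinAt).hasDerivAt (Ici_mem_nhds ht)

theorem IsWeakSolution.isModalSolution (hP : IsResolution (specProj A))
    (hlam : ∀ l : spec A, (0 : ℝ) ≤ l) {δ : ℝ} {g u : ℝ → H}
    (hg : ContinuousOn g (Ici 0)) (hu : IsWeakSolution A δ g u) :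
    IsModalSolution (specProj A) (fun l => (l : ℝ)) δ 0 g (stateCurve A u) := by
  obtain ⟨⟨hdom, hsq, hC⟩, hw⟩ := hu
  have hv : ContinuousOn (vel u) (Ici 0) :=
    hC.continuousOn_derivWithin (uniqueDiffOn_Ici 0) le_rfl
  refine ⟨hC.continuousOn.prodMk (hsq.prodMk hv), fun t ht l => proj_sqrtOp hP (hdom t ht) l,
    fun t ht l => (specProj A l).hasFDerivAt.comp_hasDerivAt t (hasDerivAt_of_contDiffOn hC ht),
    fun t ht l => ?_⟩
  have := hasDerivAt_of_separating (fun φ : H => (innerSL ℝ φ : H →L[ℝ] ℝ))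
    (fun x hx => by simpa using hx x) (f := fun s => specProj A l (vel u s))
    (F := fun t => specProj A l (g t) - (2 * δ) • specProj A l (vel u t) -
      (l : ℝ) • specProj A l (u t)) (a := 0)
    ((specProj A l).continuous.comp_continuousOn hv)
    ((((specProj A l).continuous.comp_continuousOn hg).sub
      (((specProj A l).continuous.comp_continuousOn hv).const_smul _)).sub
      (((specProj A l).continuous.comp_continuousOn hC.continuousOn).const_smul _)) ?_ ht
  · exact this
  -- By symmetry of the projection, pairing a mode with an arbitrary φ is the same as testing the
  -- equation with P_l φ, which lies in D(A^{1/2}).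
  · intro φ t ht
    have h1 := (hw (specProj A l φ)
      (mem_sqrtDomain_of_proj hP (proj_smul_eq hP l · φ)) t ht.le).hasDerivAt (Ici_mem_nhds ht)
    rw [sqrtOp_eq_of_proj hP (proj_smul_eq hP l · φ)] at h1
    simp only [innerSL_apply_apply]
    convert h1 using 1
    · ext s
      rw [← hP.symm, real_inner_comm]
    · have e : inner ℝ (sqrtOp A (u t)) (Real.sqrt l • specProj A l φ) =
          l * inner ℝ (u t) (specProj A l φ) := by
        rw [inner_smul_right, ← hP.symm, proj_sqrtOp hP (hdom t ht.le), inner_smul_left,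
          hP.symm, conj_trivial, ← mul_assoc, Real.mul_self_sqrt (hlam l)]
      rw [e, inner_sub_right, inner_sub_right, inner_smul_right, inner_smul_right,
        ← hP.symm, ← hP.symm, ← hP.symm, real_inner_comm, real_inner_comm (vel u t),
        real_inner_comm (u t)]

/-- A negative starting time makes t = 0 an interior point, so the one-sided velocity there is an
ordinary derivative. -/
theorem IsModalSolution.vel_eq (hP : IsResolution (specProj A)) {δ a : ℝ} (ha : a < 0)
    {V : ℝ → H × H × H}
    (hV : IsModalSolution (specProj A) (fun l => (l : ℝ)) δ a (fun _ => 0) V) {t : ℝ} (ht : 0 ≤ t) :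
    vel (fun s => (V s).1) t = (V t).2.2 :=
  (hV.hasDerivAt_fst hP (ha.trans_le ht)).hasDerivWithinAt.derivWithin
    (uniqueDiffOn_Ici 0 t ht)

/-- A modal solution of the homogeneous equation is a weak solution. -/
theorem IsModalSolution.isWeakSolution (hP : IsResolution (specProj A))
    (hlam : ∀ l : spec A, (0 : ℝ) ≤ l) {δ a : ℝ} (ha : a < 0) {V : ℝ → H × H × H}
    (hV : IsModalSolution (specProj A) (fun l => (l : ℝ)) δ a (fun _ => 0) V) :
    IsWeakSolution A δ (fun _ => 0) (fun t => (V t).1) := by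
  have hc : ContinuousOn V (Ici 0) := hV.cont.mono (Ici_subset_Ici.mpr ha.le)
  have hs : ∀ t, 0 ≤ t → sqrtOp A (V t).1 = (V t).2.1 := fun t ht =>
    sqrtOp_eq_of_proj hP (hV.sqrt t (ha.le.trans ht))
  have hv : ∀ t, 0 ≤ t → vel (fun s => (V s).1) t = (V t).2.2 := fun t ht => hV.vel_eq hP ha ht
  refine ⟨⟨fun t ht => mem_sqrtDomain_of_proj hP (hV.sqrt t (ha.le.trans ht)), ?_, ?_⟩, ?_⟩
  · exact ((continuous_fst.comp continuous_snd).comp_continuousOn hc).congr hs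
  · rw [show (1 : WithTop ℕ∞) = 0 + 1 by simp, contDiffOn_succ_iff_derivWithin (uniqueDiffOn_Ici 0)]
    refine ⟨fun t ht => ?_, by simp, ?_⟩
    · exact (hV.hasDerivAt_fst hP (ha.trans_le ht)).differentiableAt.differentiableWithinAt
    · rw [contDiffOn_zero]
      exact ((continuous_snd.comp continuous_snd).comp_continuousOn hc).congr hv
  · intro φ hφ t ht
    have h := (hV.hasDerivAt_inner hP hlam (fun i => proj_sqrtOp hP hφ i)
      (ha.trans_le ht)).hasDerivWithinAt (s := Ici 0)
    have h2 := h.congr_of_mem (f₁ := fun s => inner ℝ (vel (fun s => (V s).1) s) φ)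
      (fun s hs => by rw [hv s hs]) ht
    refine h2.congr_deriv ?_
    rw [hv t ht, hs t ht]
    simp

end Operator

/-! ### Propagators built from scalar kernels, and Duhamel's formula. -/

section Kernel

variable {H ι : Type*} [NormedAddCommGroup H] [InnerProductSpace ℝ H]

/-- `K i` solves `K'' + 2δK' + lam i K = 0`, has derivative `dK i`, and generates a one-parameter
group on the range of a projection; `C` bounds the kernel uniformly in `i`. -/
structure IsKernel (lam : ι → ℝ) (δ : ℝ) (K dK : ι → ℝ → ℝ) (C : ℝ → ℝ) : Prop where
  deriv : ∀ i t, HasDerivAt (K i) (dK i t) t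
  deriv_deriv : ∀ i t, HasDerivAt (dK i) (-(2 * δ) * dK i t - lam i * K i t) t
  -- On one mode the propagator acts on (x, x') by the matrix M(t) with rows (dK + 2δK, K) and (-λK,
  -- dK). The two identities are the second column of M(t)M(0) = M(t). The values (K, dK) at 0 need
  -- not be (0, 1), since a kernel may carry just a part of the mode.
  idem : ∀ i t, dK i t * K i 0 + K i t * (dK i 0 + 2 * δ * K i 0) = K i t
  idem' : ∀ i t, dK i t * dK i 0 - lam i * K i t * K i 0 = dK i t
  cont : Continuous C
  le : ∀ t i, |K i t| ≤ C t
  le' : ∀ t i, |dK i t| ≤ C t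
  -- No uniform bound on λK is available in general. Treating A^{1/2}u as a separate coordinate
  -- replaces λK by √λK, and the propagator becomes a bounded operator.
  le_sqrt : ∀ t i, |Real.sqrt (lam i) * K i t| ≤ C t

/-- The propagator of the homogeneous equation on the triples `(u, A^{1/2} u, u')`, restricted to
the invariant subspace selected by the kernel. -/
def propagator (P : ι → H →L[ℝ] H) (lam : ι → ℝ) (δ : ℝ) (K dK : ι → ℝ → ℝ) (t : ℝ) :
    (H × H × H) →L[ℝ] (H × H × H) :=
  let π₁ := ContinuousLinearMap.fst ℝ H (H × H)
  let π₂ := (ContinuousLinearMap.fst ℝ H H).comp (ContinuousLinearMap.snd ℝ H (H × H))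
  let π₃ := (ContinuousLinearMap.snd ℝ H H).comp (ContinuousLinearMap.snd ℝ H (H × H))
  let φ := multiplier P fun i => dK i t + 2 * δ * K i t
  let σ := multiplier P fun i => Real.sqrt (lam i) * K i t
  (φ.comp π₁ + (multiplier P fun i => K i t).comp π₃).prod
    ((φ.comp π₂ + σ.comp π₃).prod ((multiplier P fun i => dK i t).comp π₃ - σ.comp π₂))

variable {P : ι → H →L[ℝ] H} {lam : ι → ℝ} {δ : ℝ} {K dK : ι → ℝ → ℝ} {C : ℝ → ℝ}

theorem propagator_fst (t : ℝ) (y : H × H × H) : (propagator P lam δ K dK t y).1 =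
    multiplier P (fun i => dK i t + 2 * δ * K i t) y.1 +
      multiplier P (fun i => K i t) y.2.2 := rfl

theorem propagator_snd (t : ℝ) (y : H × H × H) : (propagator P lam δ K dK t y).2.1 =
    multiplier P (fun i => dK i t + 2 * δ * K i t) y.2.1 +
      multiplier P (fun i => Real.sqrt (lam i) * K i t) y.2.2 := rfl

theorem propagator_thd (t : ℝ) (y : H × H × H) : (propagator P lam δ K dK t y).2.2 =
    multiplier P (fun i => dK i t) y.2.2 -
      multiplier P (fun i => Real.sqrt (lam i) * K i t) y.2.1 := rfl

theorem IsKernel.le_phi (hK : IsKernel lam δ K dK C) (hδ : 0 ≤ δ) (t : ℝ) (i : ι) :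
    |dK i t + 2 * δ * K i t| ≤ (1 + 2 * δ) * C t := by
  calc |dK i t + 2 * δ * K i t| ≤ |dK i t| + |2 * δ * K i t| := abs_add_le _ _
    _ = |dK i t| + 2 * δ * |K i t| := by rw [abs_mul, abs_of_nonneg (by positivity : 0 ≤ 2 * δ)]
    _ ≤ C t + 2 * δ * C t := by gcongr; exacts [hK.le' t i, hK.le t i]
    _ = _ := by ring

variable [CompleteSpace H]

theorem IsKernel.proj_fst (hP : IsResolution P) (hK : IsKernel lam δ K dK C) (hδ : 0 ≤ δ) (t : ℝ)
    (y : H × H × H) (i : ι) : P i (propagator P lam δ K dK t y).1 =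
    (dK i t + 2 * δ * K i t) • P i y.1 + K i t • P i y.2.2 := by
  rw [propagator_fst, map_add, hP.proj_multiplier ⟨_, hK.le_phi hδ t⟩,
    hP.proj_multiplier ⟨_, hK.le t⟩]

theorem IsKernel.proj_snd (hP : IsResolution P) (hK : IsKernel lam δ K dK C) (hδ : 0 ≤ δ) (t : ℝ)
    (y : H × H × H) (i : ι) : P i (propagator P lam δ K dK t y).2.1 =
    (dK i t + 2 * δ * K i t) • P i y.2.1 + (Real.sqrt (lam i) * K i t) • P i y.2.2 := by
  rw [propagator_snd, map_add, hP.proj_multiplier ⟨_, hK.le_phi hδ t⟩,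
    hP.proj_multiplier ⟨_, hK.le_sqrt t⟩]

theorem IsKernel.proj_thd (hP : IsResolution P) (hK : IsKernel lam δ K dK C) (t : ℝ)
    (y : H × H × H) (i : ι) : P i (propagator P lam δ K dK t y).2.2 =
    dK i t • P i y.2.2 - (Real.sqrt (lam i) * K i t) • P i y.2.1 := by
  rw [propagator_thd, map_sub, hP.proj_multiplier ⟨_, hK.le' t⟩,
    hP.proj_multiplier ⟨_, hK.le_sqrt t⟩]

theorem IsKernel.norm_propagator_le (hP : IsResolution P) (hK : IsKernel lam δ K dK C)
    (hδ : 0 ≤ δ) (hι : Nonempty ι) (t : ℝ) (y : H × H × H) :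
    ‖propagator P lam δ K dK t y‖ ≤ (2 + 2 * δ) * C t * ‖y‖ := by
  have hC : 0 ≤ C t := (abs_nonneg _).trans (hK.le t hι.some)
  have h1 : ‖y.1‖ ≤ ‖y‖ := norm_fst_le y
  have h2 : ‖y.2.1‖ ≤ ‖y‖ := (norm_fst_le y.2).trans (norm_snd_le y)
  have h3 : ‖y.2.2‖ ≤ ‖y‖ := (norm_snd_le y.2).trans (norm_snd_le y)
  rw [Prod.norm_def, Prod.norm_def]
  refine max_le ?_ (max_le ?_ ?_)
  · rw [propagator_fst]
    calc _ ≤ (1 + 2 * δ) * C t * ‖y.1‖ + C t * ‖y.2.2‖ := (norm_add_le _ _).trans (add_le_add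
          (hP.norm_multiplier_le (by positivity) (hK.le_phi hδ t) _)
          (hP.norm_multiplier_le hC (hK.le t) _))
      _ ≤ (1 + 2 * δ) * C t * ‖y‖ + C t * ‖y‖ := by gcongr
      _ = _ := by ring
  · rw [propagator_snd]
    calc _ ≤ (1 + 2 * δ) * C t * ‖y.2.1‖ + C t * ‖y.2.2‖ := (norm_add_le _ _).trans (add_le_add
          (hP.norm_multiplier_le (by positivity) (hK.le_phi hδ t) _)
          (hP.norm_multiplier_le hC (hK.le_sqrt t) _))
      _ ≤ (1 + 2 * δ) * C t * ‖y‖ + C t * ‖y‖ := by gcongr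
      _ = _ := by ring
  · rw [propagator_thd]
    calc _ ≤ C t * ‖y.2.2‖ + C t * ‖y.2.1‖ := (norm_sub_le _ _).trans (add_le_add
          (hP.norm_multiplier_le hC (hK.le' t) _)
          (hP.norm_multiplier_le hC (hK.le_sqrt t) _))
      _ ≤ C t * ‖y‖ + C t * ‖y‖ := by gcongr
      _ ≤ (2 + 2 * δ) * C t * ‖y‖ := by nlinarith [mul_nonneg (mul_nonneg hδ hC) (norm_nonneg y)]

theorem IsKernel.continuousOn_propagator (hP : IsResolution P) (hK : IsKernel lam δ K dK C)
    (hδ : 0 ≤ δ) {y : ℝ → H × H × H} {s : Set ℝ} (hy : ContinuousOn y s) {θ : ℝ → ℝ}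
    (hθ : Continuous θ) :
    ContinuousOn (fun t => propagator P lam δ K dK (θ t) (y t)) s := by
  have y1 : ContinuousOn (fun t => (y t).1) s := continuous_fst.comp_continuousOn hy
  have y2 : ContinuousOn (fun t => (y t).2.1) s :=
    (continuous_fst.comp continuous_snd).comp_continuousOn hy
  have y3 : ContinuousOn (fun t => (y t).2.2) s :=
    (continuous_snd.comp continuous_snd).comp_continuousOn hy
  have cK : ∀ i, Continuous fun t => K i (θ t) := fun i =>
    (continuous_iff_continuousAt.mpr fun t => (hK.deriv i t).continuousAt).comp hθ
  have cdK : ∀ i, Continuous fun t => dK i (θ t) := fun i =>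
    (continuous_iff_continuousAt.mpr fun t => (hK.deriv_deriv i t).continuousAt).comp hθ
  have cC : Continuous fun t => C (θ t) := hK.cont.comp hθ
  have cφ : ∀ i, Continuous fun t => dK i (θ t) + 2 * δ * K i (θ t) := fun i =>
    (cdK i).add (continuous_const.mul (cK i))
  have cσ : ∀ i, Continuous fun t => Real.sqrt (lam i) * K i (θ t) := fun i =>
    continuous_const.mul (cK i)
  have hφ : ∀ {x : ℝ → H}, ContinuousOn x s → ContinuousOn
      (fun t => multiplier P (fun i => dK i (θ t) + 2 * δ * K i (θ t)) (x t)) s := fun hx =>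
    hP.continuousOn_multiplier (f := fun t i => dK i (θ t) + 2 * δ * K i (θ t))
      (continuous_const.mul cC) (fun t => hK.le_phi hδ (θ t)) cφ hx
  have hσ : ∀ {x : ℝ → H}, ContinuousOn x s → ContinuousOn
      (fun t => multiplier P (fun i => Real.sqrt (lam i) * K i (θ t)) (x t)) s := fun hx =>
    hP.continuousOn_multiplier (f := fun t i => Real.sqrt (lam i) * K i (θ t))
      cC (fun t => hK.le_sqrt (θ t)) cσ hx
  refine ContinuousOn.prodMk ((hφ y1).add ?_) (((hφ y2).add (hσ y3)).prodMk (.sub ?_ (hσ y2)))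
  · exact hP.continuousOn_multiplier (f := fun t i => K i (θ t)) cC (fun t => hK.le (θ t)) cK y3
  · exact hP.continuousOn_multiplier (f := fun t i => dK i (θ t)) cC (fun t => hK.le' (θ t)) cdK y3

/-- The variation of constants formula, in differential form. -/
theorem IsKernel.hasDerivAt_propagator (hP : IsResolution P) (hK : IsKernel lam δ K dK C)
    (hδ : 0 ≤ δ) (hlam : ∀ i, 0 ≤ lam i) {a : ℝ} {g : ℝ → H} {U : ℝ → H × H × H}
    (hU : IsModalSolution P lam δ a g U) (hg : ContinuousOn g (Ici a)) (T : ℝ) {t : ℝ}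
    (ht : a < t) :
    HasDerivAt (fun s => propagator P lam δ K dK (T - s) (U s))
      (propagator P lam δ K dK (T - t) (0, 0, g t)) t := by
  let L : ι ⊕ ι ⊕ ι → (H × H × H) →L[ℝ] H := Sum.elim
    (fun i => (P i).comp (ContinuousLinearMap.fst ℝ H (H × H)))
    (Sum.elim
      (fun i => (P i).comp ((ContinuousLinearMap.fst ℝ H H).comp
        (ContinuousLinearMap.snd ℝ H (H × H))))
      (fun i => (P i).comp ((ContinuousLinearMap.snd ℝ H H).comp
        (ContinuousLinearMap.snd ℝ H (H × H)))))
  have hθ : Continuous fun s : ℝ => T - s := continuous_const.sub continuous_id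
  have hKd : ∀ i t, HasDerivAt (fun s => K i (T - s)) (-(dK i (T - t))) t := fun i t => by
    simpa using (hK.deriv i (T - t)).comp_const_sub T t
  have hdKd : ∀ i t, HasDerivAt (fun s => dK i (T - s))
      (-(-(2 * δ) * dK i (T - t) - lam i * K i (T - t))) t := fun i t => by
    simpa using (hK.deriv_deriv i (T - t)).comp_const_sub T t
  refine hasDerivAt_of_separating L ?_ (hK.continuousOn_propagator hP hδ hU.cont hθ)
    (hK.continuousOn_propagator hP hδ
      (continuousOn_const.prodMk (continuousOn_const.prodMk hg)) hθ)
    (F := fun t => propagator P lam δ K dK (T - t) (0, 0, g t)) ?_ ht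
  · rintro ⟨x, y, z⟩ h
    have h1 : x = 0 := hP.total _ fun i => h (Sum.inl i)
    have h2 : y = 0 := hP.total _ fun i => h (Sum.inr (Sum.inl i))
    have h3 : z = 0 := hP.total _ fun i => h (Sum.inr (Sum.inr i))
    rw [h1, h2, h3]; rfl
  -- The equations for K and for the mode cancel everything except the forcing. The second
  -- coordinate is √λ times this one, by compatibility.
  · have key : ∀ t, a < t → ∀ i, HasDerivAt (fun s => (dK i (T - s) + 2 * δ * K i (T - s)) •
        P i (U s).1 + K i (T - s) • P i (U s).2.2) (K i (T - t) • P i (g t)) t := by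
      intro t ht i
      have h1 := (((hdKd i t).add ((hKd i t).const_mul (2 * δ))).smul (hU.deriv_fst t ht i)).add
        ((hKd i t).smul (hU.deriv_vel t ht i))
      refine h1.congr_deriv ?_
      simp only [Pi.add_apply]
      module
    rintro (i | i | i) t ht
    · have e : (fun s => L (Sum.inl i) (propagator P lam δ K dK (T - s) (U s))) =
          fun s => (dK i (T - s) + 2 * δ * K i (T - s)) • P i (U s).1 +
            K i (T - s) • P i (U s).2.2 := funext fun s => hK.proj_fst hP hδ _ _ i
      have e2 : L (Sum.inl i) (propagator P lam δ K dK (T - t) (0, 0, g t)) =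
          K i (T - t) • P i (g t) := by
        refine (hK.proj_fst hP hδ _ _ i).trans ?_
        simp
      rw [e, e2]
      exact key t ht i
    · have e2 : L (Sum.inr (Sum.inl i)) (propagator P lam δ K dK (T - t) (0, 0, g t)) =
          Real.sqrt (lam i) • K i (T - t) • P i (g t) := by
        refine (hK.proj_snd hP hδ _ _ i).trans ?_
        simp [smul_smul]
      rw [e2]
      refine ((key t ht i).const_smul (Real.sqrt (lam i))).congr_of_eventuallyEq ?_
      filter_upwards [Ioi_mem_nhds ht] with s hs
      refine (hK.proj_snd hP hδ _ _ i).trans ?_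
      rw [hU.sqrt s (le_of_lt hs)]
      simp only [Pi.smul_apply]
      module
    · have e2 : L (Sum.inr (Sum.inr i)) (propagator P lam δ K dK (T - t) (0, 0, g t)) =
          dK i (T - t) • P i (g t) := by
        refine (hK.proj_thd hP _ _ i).trans ?_
        simp
      rw [e2]
      have h1 := ((hdKd i t).smul (hU.deriv_vel t ht i)).sub
        (((hKd i t).smul (hU.deriv_fst t ht i)).const_smul (lam i))
      refine (h1.congr_deriv ?_).congr_of_eventuallyEq ?_
      · module
      · filter_upwards [Ioi_mem_nhds ht] with s hs
        refine (hK.proj_thd hP _ _ i).trans ?_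
        rw [hU.sqrt s (le_of_lt hs), smul_smul, mul_right_comm, Real.mul_self_sqrt (hlam i),
          mul_smul]
        rfl

/-- The compatible triples: those of the form `(u, A^{1/2} u, v)`. -/
def IsCompatible (P : ι → H →L[ℝ] H) (lam : ι → ℝ) (y : H × H × H) : Prop :=
  ∀ i, P i y.2.1 = Real.sqrt (lam i) • P i y.1

/-- The propagator yields solutions of the homogeneous equation. -/
theorem IsKernel.isModalSolution (hP : IsResolution P) (hK : IsKernel lam δ K dK C)
    (hδ : 0 ≤ δ) (hlam : ∀ i, 0 ≤ lam i) {y : H × H × H} (hy : IsCompatible P lam y) (a : ℝ) :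
    IsModalSolution P lam δ a (fun _ => 0) (fun t => propagator P lam δ K dK t y) := by
  have hs : ∀ i t, Real.sqrt (lam i) * K i t * Real.sqrt (lam i) = lam i * K i t := fun i t => by
    rw [mul_right_comm, Real.mul_self_sqrt (hlam i)]
  refine ⟨hK.continuousOn_propagator hP hδ continuousOn_const continuous_id, fun t _ i => ?_,
    fun t _ i => ?_, fun t _ i => ?_⟩
  · rw [hK.proj_fst hP hδ, hK.proj_snd hP hδ, hy i]
    module
  · simp_rw [hK.proj_fst hP hδ, hK.proj_thd hP]
    have h1 := ((((hK.deriv_deriv i t).add ((hK.deriv i t).const_mul (2 * δ))).smul_const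
      (P i y.1))).add ((hK.deriv i t).smul_const (P i y.2.2))
    refine h1.congr_deriv ?_
    rw [hy i, smul_smul, hs]
    module
  · simp_rw [hK.proj_fst hP hδ, hK.proj_thd hP, hy i, smul_smul, hs]
    have h1 := ((hK.deriv_deriv i t).smul_const (P i y.2.2)).sub
      (((hK.deriv i t).const_mul (lam i)).smul_const (P i y.1))
    refine h1.congr_deriv ?_
    rw [map_zero]
    module

theorem IsKernel.isCompatible (hP : IsResolution P) (hK : IsKernel lam δ K dK C)
    (hδ : 0 ≤ δ) {y : H × H × H} (hy : IsCompatible P lam y) (t : ℝ) :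
    IsCompatible P lam (propagator P lam δ K dK t y) := by
  intro i
  rw [hK.proj_fst hP hδ, hK.proj_snd hP hδ, hy i]
  module

theorem ext_triple (hP : IsResolution P) {y z : H × H × H} (h1 : ∀ i, P i y.1 = P i z.1)
    (h2 : ∀ i, P i y.2.1 = P i z.2.1) (h3 : ∀ i, P i y.2.2 = P i z.2.2) : y = z :=
  Prod.ext (hP.ext h1) (Prod.ext (hP.ext h2) (hP.ext h3))

/-- At time 0 the propagator is a projection, in general not the identity; the relations `idem` and
`idem'` say that it is absorbed. -/
theorem IsKernel.propagator_propagator_zero (hP : IsResolution P) (hK : IsKernel lam δ K dK C)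
    (hδ : 0 ≤ δ) (hlam : ∀ i, 0 ≤ lam i) {y : H × H × H} (hy : IsCompatible P lam y) (t : ℝ) :
    propagator P lam δ K dK t (propagator P lam δ K dK 0 y) = propagator P lam δ K dK t y := by
  have hs : ∀ i, Real.sqrt (lam i) * Real.sqrt (lam i) = lam i := fun i =>
    Real.mul_self_sqrt (hlam i)
  have key : ∀ i, (dK i t + 2 * δ * K i t) • P i (propagator P lam δ K dK 0 y).1 +
      K i t • P i (propagator P lam δ K dK 0 y).2.2 =
      (dK i t + 2 * δ * K i t) • P i y.1 + K i t • P i y.2.2 := by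
    intro i
    rw [hK.proj_fst hP hδ, hK.proj_thd hP, hy i]
    have e1 := hK.idem i t
    have e2 := hK.idem' i t
    match_scalars
    · linear_combination e2 + 2 * δ * e1 - K i t * K i 0 * hs i
    · linear_combination e1
  apply ext_triple hP
  · intro i
    rw [hK.proj_fst hP hδ, key, hK.proj_fst hP hδ]
  · intro i
    rw [hK.isCompatible hP hδ (hK.isCompatible hP hδ hy 0) t i, hK.isCompatible hP hδ hy t i,
      hK.proj_fst hP hδ, key, hK.proj_fst hP hδ]
  · intro i
    rw [hK.proj_thd hP, hK.isCompatible hP hδ hy 0 i, hK.proj_fst hP hδ, hK.proj_thd hP,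
      hK.proj_thd hP, hy i]
    have e1 := hK.idem i t
    have e2 := hK.idem' i t
    match_scalars
    · linear_combination e2 - K i t * K i 0 * hs i
    · linear_combination - Real.sqrt (lam i) ^ 2 * e1

/-- By Duhamel without forcing, S(t + s - τ)S(τ)y does not depend on τ; compare τ = s with τ = 0. -/
theorem IsKernel.propagator_propagator (hP : IsResolution P) (hK : IsKernel lam δ K dK C)
    (hδ : 0 ≤ δ) (hlam : ∀ i, 0 ≤ lam i) {y : H × H × H} (hy : IsCompatible P lam y) (t s : ℝ) :
    propagator P lam δ K dK t (propagator P lam δ K dK s y) =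
      propagator P lam δ K dK (t + s) y := by
  have hd : ∀ τ, HasDerivAt (fun τ => propagator P lam δ K dK (t + s - τ)
      (propagator P lam δ K dK τ y)) 0 τ := by
    intro τ
    have := hK.hasDerivAt_propagator hP hδ hlam (hK.isModalSolution hP hδ hlam hy (τ - 1))
      continuousOn_const (t + s) (t := τ) (by linarith)
    refine this.congr_deriv ?_
    exact map_zero (propagator P lam δ K dK (t + s - τ))
  have hc := is_const_of_deriv_eq_zero (fun τ => (hd τ).differentiableAt) (fun τ => (hd τ).deriv)
    s 0
  simp only [add_sub_cancel_right, sub_zero] at hc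
  rw [hc, hK.propagator_propagator_zero hP hδ hlam hy]

end Kernel

/-! ### The kernel of each decay rate. -/

section Rates

/-- The function `sin (ω t) / ω`, extended by continuity at `ω = 0`. -/
def sinDiv (ω t : ℝ) : ℝ := if ω = 0 then t else Real.sin (ω * t) / ω

theorem hasDerivAt_sinDiv (ω t : ℝ) : HasDerivAt (sinDiv ω) (Real.cos (ω * t)) t := by
  by_cases h : ω = 0
  · have : sinDiv ω = fun t => t := funext fun t => by simp [sinDiv, h]
    rw [this, h]
    simpa using hasDerivAt_id' t
  · have : sinDiv ω = fun t => Real.sin (ω * t) / ω := funext fun t => by simp [sinDiv, h]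
    rw [this]
    have h1 := (((hasDerivAt_id' t).const_mul ω).sin).div_const ω
    refine h1.congr_deriv ?_
    field_simp

theorem hasDerivAt_cos_mul (ω t : ℝ) :
    HasDerivAt (fun t => Real.cos (ω * t)) (-(ω ^ 2 * sinDiv ω t)) t := by
  have h1 := ((hasDerivAt_id' t).const_mul ω).cos
  refine h1.congr_deriv ?_
  by_cases h : ω = 0
  · simp [h]
  · simp only [sinDiv, h, if_false]
    field_simp

theorem sinDiv_zero (ω : ℝ) : sinDiv ω 0 = 0 := by simp [sinDiv]

theorem abs_sinDiv_le (ω t : ℝ) : |sinDiv ω t| ≤ |t| := by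
  by_cases h : ω = 0
  · simp [sinDiv, h]
  · simp only [sinDiv, h, if_false]
    rw [abs_div, div_le_iff₀ (abs_pos.mpr h), ← abs_mul, mul_comm t]
    exact Real.abs_sin_le_abs

theorem abs_mul_sinDiv_le (ω t : ℝ) : |ω * sinDiv ω t| ≤ 1 := by
  by_cases h : ω = 0
  · simp [h]
  · simp only [sinDiv, h, if_false]
    rw [mul_div_cancel₀ _ h]
    exact Real.abs_sin_le_one _

variable {ι : Type*}

/-- The modes that contribute to the decay rate `r`. -/
def Selects (lam : ι → ℝ) (δ r : ℝ) (i : ι) : Prop :=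
  (r = δ ∧ δ ^ 2 ≤ lam i) ∨ (r ≠ δ ∧ lam i = r * (2 * δ - r))

open Classical in
/-- The kernel of the propagator on the component of decay rate `r`. -/
def rateKernel (lam : ι → ℝ) (δ r : ℝ) (i : ι) (t : ℝ) : ℝ :=
  if Selects lam δ r i then
    if r = δ then Real.exp (-(δ * t)) * sinDiv (Real.sqrt (lam i - δ ^ 2)) t
    else Real.exp (-(r * t)) / (2 * (δ - r))
  else 0

open Classical in
/-- The derivative of `rateKernel`. -/
def rateKernelDeriv (lam : ι → ℝ) (δ r : ℝ) (i : ι) (t : ℝ) : ℝ :=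
  if Selects lam δ r i then
    if r = δ then Real.exp (-(δ * t)) * (Real.cos (Real.sqrt (lam i - δ ^ 2) * t) -
      δ * sinDiv (Real.sqrt (lam i - δ ^ 2)) t)
    else -r * (Real.exp (-(r * t)) / (2 * (δ - r)))
  else 0

theorem hasDerivAt_exp_neg_mul (r t : ℝ) :
    HasDerivAt (fun t => Real.exp (-(r * t))) (-r * Real.exp (-(r * t))) t := by
  have := ((hasDerivAt_id' t).const_mul r).fun_neg.exp
  refine this.congr_deriv ?_
  ring

variable {lam : ι → ℝ} {δ r : ℝ}

theorem rateKernel_of_not {i : ι} (h : ¬ Selects lam δ r i) (t : ℝ) :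
    rateKernel lam δ r i t = 0 := by simp [rateKernel, h]

theorem rateKernelDeriv_of_not {i : ι} (h : ¬ Selects lam δ r i) (t : ℝ) :
    rateKernelDeriv lam δ r i t = 0 := by simp [rateKernelDeriv, h]

theorem rateKernel_of_eq {i : ι} (h : δ ^ 2 ≤ lam i) (t : ℝ) :
    rateKernel lam δ δ i t =
      Real.exp (-(δ * t)) * sinDiv (Real.sqrt (lam i - δ ^ 2)) t := by
  simp [rateKernel, Selects, h]

theorem rateKernelDeriv_of_eq {i : ι} (h : δ ^ 2 ≤ lam i) (t : ℝ) :
    rateKernelDeriv lam δ δ i t =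
      Real.exp (-(δ * t)) * (Real.cos (Real.sqrt (lam i - δ ^ 2) * t) -
      δ * sinDiv (Real.sqrt (lam i - δ ^ 2)) t) := by
  simp [rateKernelDeriv, Selects, h]

theorem rateKernel_of_ne {i : ι} (hr : r ≠ δ) (h : lam i = r * (2 * δ - r)) (t : ℝ) :
    rateKernel lam δ r i t = Real.exp (-(r * t)) / (2 * (δ - r)) := by
  simp [rateKernel, Selects, h, hr]

theorem rateKernelDeriv_of_ne {i : ι} (hr : r ≠ δ) (h : lam i = r * (2 * δ - r)) (t : ℝ) :
    rateKernelDeriv lam δ r i t = -r * (Real.exp (-(r * t)) / (2 * (δ - r))) := by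
  simp [rateKernelDeriv, Selects, h, hr]

/-- √l ≤ √(l - δ²) + δ trades √l, unbounded over the spectrum, for the frequency, which cancels the
denominator of sin(ωt)/ω. -/
theorem abs_sqrt_mul_sinDiv_le (hδ : 0 ≤ δ) {l : ℝ} (h : δ ^ 2 ≤ l) (t : ℝ) :
    |Real.sqrt l * sinDiv (Real.sqrt (l - δ ^ 2)) t| ≤ 1 + δ * |t| := by
  have h1 : Real.sqrt l ≤ Real.sqrt (l - δ ^ 2) + δ := by
    apply Real.sqrt_le_left (by positivity) |>.mpr
    nlinarith [Real.sq_sqrt (sub_nonneg.mpr h), Real.sqrt_nonneg (l - δ ^ 2),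
      mul_nonneg (Real.sqrt_nonneg (l - δ ^ 2)) hδ]
  rw [abs_mul, abs_of_nonneg (Real.sqrt_nonneg l)]
  calc Real.sqrt l * |sinDiv (Real.sqrt (l - δ ^ 2)) t|
      ≤ (Real.sqrt (l - δ ^ 2) + δ) * |sinDiv (Real.sqrt (l - δ ^ 2)) t| := by gcongr
    _ = |Real.sqrt (l - δ ^ 2) * sinDiv (Real.sqrt (l - δ ^ 2)) t| +
        δ * |sinDiv (Real.sqrt (l - δ ^ 2)) t| := by
      rw [abs_mul, abs_of_nonneg (Real.sqrt_nonneg _)]; ring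
    _ ≤ 1 + δ * |t| := add_le_add (abs_mul_sinDiv_le _ _)
      (mul_le_mul_of_nonneg_left (abs_sinDiv_le _ _) hδ)

/-- The factor 1 + |t| is due to the rate δ: |sin(ωt)/ω| ≤ |t| holds uniformly in ω and includes the
double root ω = 0. The bound is also valid for negative t, as integration from infinity requires. -/
theorem exists_isKernel (lam : ι → ℝ) (hδ : 0 ≤ δ) (r : ℝ) : ∃ M, 0 < M ∧
    IsKernel lam δ (rateKernel lam δ r) (rateKernelDeriv lam δ r)
      (fun t => M * ((1 + |t|) * Real.exp (-(r * t)))) := by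
  set N : ℝ := |1 / (2 * (δ - r))| with hN
  have hN0 : 0 ≤ N := abs_nonneg _
  set M : ℝ := 1 + δ + N * (1 + |r| + Real.sqrt (r * (2 * δ - r))) with hM
  have hM0 : 0 < M := by positivity
  have hM1 : 1 + δ ≤ M := by
    have : 0 ≤ N * (1 + |r| + Real.sqrt (r * (2 * δ - r))) := by positivity
    linarith
  have hB : ∀ t, 0 ≤ M * ((1 + |t|) * Real.exp (-(r * t))) := fun t => by positivity
  have bnd : ∀ t c x, |c| ≤ 1 + (1 + δ) * |t| → x = Real.exp (-(r * t)) * c →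
      |x| ≤ M * ((1 + |t|) * Real.exp (-(r * t))) := by
    rintro t c x hc rfl
    rw [abs_mul, abs_of_nonneg (Real.exp_nonneg _), ← mul_assoc, mul_comm]
    gcongr
    nlinarith [abs_nonneg t]
  have bnd' : ∀ t c, |c| ≤ 1 + |r| + Real.sqrt (r * (2 * δ - r)) →
      |c * (Real.exp (-(r * t)) / (2 * (δ - r)))| ≤ M * ((1 + |t|) * Real.exp (-(r * t))) := by
    intro t c hc
    have e : c * (Real.exp (-(r * t)) / (2 * (δ - r))) =
        (1 / (2 * (δ - r)) * c) * Real.exp (-(r * t)) := by ring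
    rw [e, abs_mul, abs_of_nonneg (Real.exp_nonneg _), ← mul_assoc, abs_mul, ← hN]
    refine mul_le_mul_of_nonneg_right ?_ (Real.exp_nonneg _)
    calc N * |c| ≤ N * (1 + |r| + Real.sqrt (r * (2 * δ - r))) := by gcongr
      _ ≤ M := by rw [hM]; linarith
      _ ≤ M * (1 + |t|) := by nlinarith [abs_nonneg t]
  refine ⟨M, hM0, ?_, ?_, ?_, ?_, by fun_prop, ?_, ?_, ?_⟩
  · intro i t
    by_cases h : Selects lam δ r i
    · rcases h with ⟨rfl, h⟩ | ⟨hr, h⟩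
      · rw [funext (rateKernel_of_eq h), rateKernelDeriv_of_eq h]
        refine ((hasDerivAt_exp_neg_mul r t).mul (hasDerivAt_sinDiv _ t)).congr_deriv ?_
        ring
      · rw [funext (rateKernel_of_ne hr h), rateKernelDeriv_of_ne hr h]
        refine ((hasDerivAt_exp_neg_mul r t).div_const _).congr_deriv ?_
        ring
    · rw [funext (rateKernel_of_not h), rateKernelDeriv_of_not h]
      exact hasDerivAt_const t 0
  · intro i t
    by_cases h : Selects lam δ r i
    · rcases h with ⟨rfl, h⟩ | ⟨hr, h⟩
      · rw [funext (rateKernelDeriv_of_eq h), rateKernel_of_eq h]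
        refine ((hasDerivAt_exp_neg_mul r t).mul ((hasDerivAt_cos_mul _ t).sub
          ((hasDerivAt_sinDiv _ t).const_mul r))).congr_deriv ?_
        rw [Real.sq_sqrt (sub_nonneg.mpr h)]
        simp only [Pi.sub_apply]
        ring
      · rw [funext (rateKernelDeriv_of_ne hr h), rateKernel_of_ne hr h, h]
        refine (((hasDerivAt_exp_neg_mul r t).div_const _).const_mul _).congr_deriv ?_
        ring
    · rw [funext (rateKernelDeriv_of_not h), rateKernel_of_not h]
      exact (hasDerivAt_const t 0).congr_deriv (by ring)
  · intro i t
    by_cases h : Selects lam δ r i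
    · rcases h with ⟨rfl, h⟩ | ⟨hr, h⟩
      · simp only [rateKernelDeriv_of_eq h, rateKernel_of_eq h, sinDiv_zero]
        simp
      · simp only [rateKernelDeriv_of_ne hr h, rateKernel_of_ne hr h]
        have : δ - r ≠ 0 := sub_ne_zero.mpr hr.symm
        simp only [mul_zero, neg_zero, Real.exp_zero]
        field_simp
        ring
    · simp [rateKernelDeriv_of_not h, rateKernel_of_not h]
  · intro i t
    by_cases h : Selects lam δ r i
    · rcases h with ⟨rfl, h⟩ | ⟨hr, h⟩
      · simp only [rateKernelDeriv_of_eq h, rateKernel_of_eq h, sinDiv_zero]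
        simp
      · simp only [rateKernelDeriv_of_ne hr h, rateKernel_of_ne hr h]
        have : δ - r ≠ 0 := sub_ne_zero.mpr hr.symm
        rw [h]
        simp only [mul_zero, neg_zero, Real.exp_zero]
        field_simp
        ring
    · simp [rateKernelDeriv_of_not h, rateKernel_of_not h]
  · intro t i
    by_cases h : Selects lam δ r i
    · rcases h with ⟨rfl, h⟩ | ⟨hr, h⟩
      · refine bnd t _ _ ?_ (rateKernel_of_eq h t)
        nlinarith [abs_sinDiv_le (Real.sqrt (lam i - r ^ 2)) t, abs_nonneg t,
          mul_nonneg hδ (abs_nonneg t)]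
      · rw [rateKernel_of_ne hr h, ← one_mul (_ / _)]
        apply bnd'
        rw [abs_one]
        nlinarith [abs_nonneg r, Real.sqrt_nonneg (r * (2 * δ - r))]
    · rw [rateKernel_of_not h, abs_zero]; exact hB t
  · intro t i
    by_cases h : Selects lam δ r i
    · rcases h with ⟨rfl, h⟩ | ⟨hr, h⟩
      · refine bnd t _ _ ?_ (rateKernelDeriv_of_eq h t)
        calc _ ≤ |Real.cos (Real.sqrt (lam i - r ^ 2) * t)| +
              |r * sinDiv (Real.sqrt (lam i - r ^ 2)) t| := abs_sub _ _
          _ ≤ 1 + r * |t| := by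
            rw [abs_mul, abs_of_nonneg hδ]
            exact add_le_add (Real.abs_cos_le_one _)
              (mul_le_mul_of_nonneg_left (abs_sinDiv_le _ _) hδ)
          _ ≤ _ := by nlinarith [abs_nonneg t]
      · rw [rateKernelDeriv_of_ne hr h]
        apply bnd'
        rw [abs_neg]
        nlinarith [abs_nonneg r, Real.sqrt_nonneg (r * (2 * δ - r))]
    · rw [rateKernelDeriv_of_not h, abs_zero]; exact hB t
  · intro t i
    by_cases h : Selects lam δ r i
    · rcases h with ⟨rfl, h⟩ | ⟨hr, h⟩
      · refine bnd t (Real.sqrt (lam i) * sinDiv (Real.sqrt (lam i - r ^ 2)) t) _ ?_ ?_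
        · refine (abs_sqrt_mul_sinDiv_le hδ h t).trans ?_
          nlinarith [abs_nonneg t]
        · rw [rateKernel_of_eq h]; ring
      · rw [rateKernel_of_ne hr h, h]
        apply bnd'
        rw [abs_of_nonneg (Real.sqrt_nonneg _)]
        nlinarith [abs_nonneg r]
    · rw [rateKernel_of_not h, mul_zero, abs_zero]; exact hB t

theorem selects_iff_of_lt (i : ι) (h : lam i < δ ^ 2) :
    Selects lam δ r i ↔ r = δ - Real.sqrt (δ ^ 2 - lam i) ∨ r = δ + Real.sqrt (δ ^ 2 - lam i) := by
  have hpos : 0 < Real.sqrt (δ ^ 2 - lam i) := Real.sqrt_pos.mpr (sub_pos.mpr h)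
  have hsq := Real.sq_sqrt (sub_pos.mpr h).le
  constructor
  · rintro (⟨-, h2⟩ | ⟨-, h2⟩)
    · linarith
    · have : (r - (δ - Real.sqrt (δ ^ 2 - lam i))) * (r - (δ + Real.sqrt (δ ^ 2 - lam i))) = 0 := by
        nlinarith
      rcases mul_eq_zero.mp this with h3 | h3
      · left; linarith
      · right; linarith
  · rintro (rfl | rfl)
    · right; exact ⟨by linarith, by nlinarith⟩
    · right; exact ⟨by linarith, by nlinarith⟩

theorem selects_iff_of_le (i : ι) (h : δ ^ 2 ≤ lam i) : Selects lam δ r i ↔ r = δ := by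
  constructor
  · rintro (⟨h1, -⟩ | ⟨h1, h2⟩)
    · exact h1
    · have : 0 < (r - δ) ^ 2 := by
        have := sub_ne_zero.mpr h1
        positivity
      nlinarith
  · intro h1; left; exact ⟨h1, h⟩

/-- Summed over the rates, the kernels have at time 0 the data (0, 1) of the fundamental solution of
each mode; this is why the rate projections add up to the identity. -/
theorem sum_rateKernel_zero (D : Finset ℝ) (hD : ∀ r i, Selects lam δ r i → r ∈ D) (i : ι) :
    ∑ r ∈ D, rateKernel lam δ r i 0 = 0 ∧ ∑ r ∈ D, rateKernelDeriv lam δ r i 0 = 1 := by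
  rcases lt_or_ge (lam i) (δ ^ 2) with h | h
  · set ω := Real.sqrt (δ ^ 2 - lam i) with hω
    have hpos : 0 < ω := Real.sqrt_pos.mpr (sub_pos.mpr h)
    have hsq : ω ^ 2 = δ ^ 2 - lam i := Real.sq_sqrt (sub_pos.mpr h).le
    have s1 : Selects lam δ (δ - ω) i := (selects_iff_of_lt i h).mpr (Or.inl rfl)
    have s2 : Selects lam δ (δ + ω) i := (selects_iff_of_lt i h).mpr (Or.inr rfl)
    have hne : δ - ω ≠ δ + ω := by intro h; linarith
    have n1 : δ - ω ≠ δ := by intro h; linarith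
    have n2 : δ + ω ≠ δ := by intro h; linarith
    have l1 : lam i = (δ - ω) * (2 * δ - (δ - ω)) := by nlinarith
    have l2 : lam i = (δ + ω) * (2 * δ - (δ + ω)) := by nlinarith
    constructor
    · rw [Finset.sum_eq_add (δ - ω) (δ + ω) hne]
      · rw [rateKernel_of_ne n1 l1, rateKernel_of_ne n2 l2]
        simp only [mul_zero, neg_zero, Real.exp_zero, sub_sub_cancel, sub_add_cancel_left]
        field_simp
        ring
      · intro c _ hc
        apply rateKernel_of_not
        rw [selects_iff_of_lt i h]
        tauto
      · intro h; exact absurd (hD _ _ s1) h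
      · intro h; exact absurd (hD _ _ s2) h
    · rw [Finset.sum_eq_add (δ - ω) (δ + ω) hne]
      · rw [rateKernelDeriv_of_ne n1 l1, rateKernelDeriv_of_ne n2 l2]
        simp only [mul_zero, neg_zero, Real.exp_zero, sub_sub_cancel, sub_add_cancel_left]
        field_simp
        ring
      · intro c _ hc
        apply rateKernelDeriv_of_not
        rw [selects_iff_of_lt i h]
        tauto
      · intro h; exact absurd (hD _ _ s1) h
      · intro h; exact absurd (hD _ _ s2) h
  · have s1 : Selects lam δ δ i := (selects_iff_of_le i h).mpr rfl
    constructor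
    · rw [Finset.sum_eq_single δ]
      · rw [rateKernel_of_eq h, sinDiv_zero, mul_zero]
      · intro c _ hc
        apply rateKernel_of_not
        rwa [selects_iff_of_le i h]
      · intro h; exact absurd (hD _ _ s1) h
    · rw [Finset.sum_eq_single δ]
      · rw [rateKernelDeriv_of_eq h, sinDiv_zero]
        simp
      · intro c _ hc
        apply rateKernelDeriv_of_not
        rwa [selects_iff_of_le i h]
      · intro h; exact absurd (hD _ _ s1) h

end Rates

/-! ### Decomposition of the state space by rates. -/

section RatePropagator

variable {H ι : Type*} [NormedAddCommGroup H] [InnerProductSpace ℝ H]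

/-- The propagator on the component of decay rate `r`. -/
def ratePropagator (P : ι → H →L[ℝ] H) (lam : ι → ℝ) (δ r t : ℝ) :
    (H × H × H) →L[ℝ] (H × H × H) :=
  propagator P lam δ (rateKernel lam δ r) (rateKernelDeriv lam δ r) t

variable {P : ι → H →L[ℝ] H} {lam : ι → ℝ} {δ : ℝ} [CompleteSpace H]

theorem sum_ratePropagator_zero (hP : IsResolution P) (hδ : 0 ≤ δ) (D : Finset ℝ)
    (hD : ∀ r i, Selects lam δ r i → r ∈ D) (y : H × H × H) :
    ∑ r ∈ D, ratePropagator P lam δ r 0 y = y := by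
  have hK := fun r => (exists_isKernel lam hδ r).choose_spec.2
  have e : ∀ (z : ℝ → H × H × H), (∑ r ∈ D, z r).1 = ∑ r ∈ D, (z r).1 := fun z =>
    map_sum (AddMonoidHom.fst H (H × H)) _ _
  have e' : ∀ (z : ℝ → H × H × H), (∑ r ∈ D, z r).2 = ∑ r ∈ D, (z r).2 := fun z =>
    map_sum (AddMonoidHom.snd H (H × H)) _ _
  have e1 : ∀ (z : ℝ → H × H), (∑ r ∈ D, z r).1 = ∑ r ∈ D, (z r).1 := fun z =>
    map_sum (AddMonoidHom.fst H H) _ _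
  have e2 : ∀ (z : ℝ → H × H), (∑ r ∈ D, z r).2 = ∑ r ∈ D, (z r).2 := fun z =>
    map_sum (AddMonoidHom.snd H H) _ _
  apply ext_triple hP
  · intro i
    obtain ⟨h1, h2⟩ := sum_rateKernel_zero D hD i
    rw [e, map_sum]
    simp_rw [ratePropagator, (hK _).proj_fst hP hδ, add_smul, mul_smul]
    rw [Finset.sum_add_distrib, Finset.sum_add_distrib, ← Finset.smul_sum, ← Finset.smul_sum,
      ← Finset.sum_smul, ← Finset.sum_smul, ← Finset.sum_smul, h1, h2]
    simp
  · intro i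
    obtain ⟨h1, h2⟩ := sum_rateKernel_zero D hD i
    rw [e', e1, map_sum]
    simp_rw [ratePropagator, (hK _).proj_snd hP hδ, add_smul, mul_smul]
    rw [Finset.sum_add_distrib, Finset.sum_add_distrib, ← Finset.smul_sum, ← Finset.smul_sum,
      ← Finset.smul_sum, ← Finset.sum_smul, ← Finset.sum_smul, ← Finset.sum_smul, h1, h2]
    simp
  · intro i
    obtain ⟨h1, h2⟩ := sum_rateKernel_zero D hD i
    rw [e', e2, map_sum]
    simp_rw [ratePropagator, (hK _).proj_thd hP, mul_smul]
    rw [Finset.sum_sub_distrib, ← Finset.smul_sum,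
      ← Finset.sum_smul, ← Finset.sum_smul, h1, h2]
    simp

theorem ratePropagator_eq_zero (hP : IsResolution P) (hδ : 0 ≤ δ) {r : ℝ}
    (hr : ∀ i, ¬ Selects lam δ r i) (t : ℝ) (y : H × H × H) :
    ratePropagator P lam δ r t y = 0 := by
  have hK := (exists_isKernel lam hδ r).choose_spec.2
  apply ext_triple hP
  · intro i
    rw [ratePropagator, hK.proj_fst hP hδ, rateKernel_of_not (hr i), rateKernelDeriv_of_not (hr i)]
    simp
  · intro i
    rw [ratePropagator, hK.proj_snd hP hδ, rateKernel_of_not (hr i), rateKernelDeriv_of_not (hr i)]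
    simp
  · intro i
    rw [ratePropagator, hK.proj_thd hP, rateKernel_of_not (hr i), rateKernelDeriv_of_not (hr i)]
    simp

end RatePropagator

/-! ### Scalar differential inequalities. -/

section RealAnalysis

variable {E : Type*} [NormedAddCommGroup E] [NormedSpace ℝ E]

theorem norm_sub_le_of_norm_deriv_le {f f' : ℝ → E} {B B' : ℝ → ℝ} {a b : ℝ} (hab : a ≤ b)
    (hf : ∀ t ∈ Icc a b, HasDerivAt f (f' t) t) (hB : ∀ t ∈ Icc a b, HasDerivAt B (B' t) t)
    (h : ∀ t ∈ Icc a b, ‖f' t‖ ≤ B' t) : ‖f b - f a‖ ≤ B b - B a := by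
  refine image_norm_le_of_norm_deriv_right_le_deriv_boundary' (f := fun t => f t - f a) (f' := f')
    (B := fun t => B t - B a) (B' := B') (a := a) (b := b)
    ?_ ?_ (by simp) ?_ ?_ ?_ (right_mem_Icc.mpr hab)
  · exact fun t ht => ((hf t ht).sub_const _).continuousAt.continuousWithinAt
  · exact fun t ht => ((hf t (Ico_subset_Icc_self ht)).sub_const _).hasDerivWithinAt
  · exact fun t ht => ((hB t ht).sub_const _).continuousAt.continuousWithinAt
  · exact fun t ht => ((hB t (Ico_subset_Icc_self ht)).sub_const _).hasDerivWithinAt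
  · exact fun t ht => h t (Ico_subset_Icc_self ht)

theorem sub_le_of_deriv_le {f f' B B' : ℝ → ℝ} {a b : ℝ} (hab : a ≤ b)
    (hf : ∀ t ∈ Icc a b, HasDerivAt f (f' t) t) (hB : ∀ t ∈ Icc a b, HasDerivAt B (B' t) t)
    (h : ∀ t ∈ Icc a b, f' t ≤ B' t) : f b - f a ≤ B b - B a := by
  have hmono : MonotoneOn (fun t => B t - f t) (Icc a b) := by
    apply monotoneOn_of_hasDerivWithinAt_nonneg (convex_Icc a b) (f' := fun t => B' t - f' t)
    · exact fun t ht => ((hB t ht).sub (hf t ht)).continuousAt.continuousWithinAt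
    · intro t ht
      have ht := interior_subset ht
      exact ((hB t ht).sub (hf t ht)).hasDerivWithinAt
    · intro t ht
      exact sub_nonneg.mpr (h t (interior_subset ht))
  have := hmono (left_mem_Icc.mpr hab) (right_mem_Icc.mpr hab) hab
  simp only at this
  linarith

theorem hasDerivAt_exp_const_mul (r t : ℝ) :
    HasDerivAt (fun t => Real.exp (r * t)) (r * Real.exp (r * t)) t := by
  refine ((hasDerivAt_id' t).const_mul r).exp.congr_deriv ?_
  ring

/-- Serves to absorb the polynomial factor of the kernels at the price of an arbitrarily small loss
in the exponent. -/
theorem one_add_le_mul_exp {ε : ℝ} (hε : 0 < ε) {t : ℝ} (ht : 0 ≤ t) :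
    1 + t ≤ (1 + 1 / ε) * Real.exp (ε * t) := by
  have h1 : ε * t + 1 ≤ Real.exp (ε * t) := Real.add_one_le_exp _
  calc 1 + t ≤ (1 + 1 / ε) * (ε * t + 1) := by
        have e : (1 + 1 / ε) * (ε * t + 1) = ε * t + 1 + t + 1 / ε := by field_simp; ring
        have : 0 < 1 / ε := by positivity
        nlinarith [mul_nonneg hε.le ht]
    _ ≤ _ := by gcongr

/-- Solutions of `R' = -νR + b` tend to zero if `b` does. -/
theorem tendsto_zero_of_deriv_eq {R b : ℝ → ℝ} {ν T : ℝ} (hν : 0 < ν)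
    (hR : ∀ t, T ≤ t → HasDerivAt R (-ν * R t + b t) t) (hR0 : ∀ t, T ≤ t → 0 ≤ R t)
    (hb : Tendsto b atTop (𝓝 0)) : Tendsto R atTop (𝓝 0) := by
  rw [Metric.tendsto_atTop]
  intro ε hε
  obtain ⟨T₁, hT₁⟩ := (eventually_atTop.mp
    (hb.eventually (gt_mem_nhds (show 0 < ν * (ε / 2) by positivity))))
  set T₂ := max T T₁ with hT₂
  -- Once b < νε/2, the function e^{νt}(R - ε/2) is nonincreasing.
  have hle : ∀ t, T₂ ≤ t → Real.exp (ν * t) * (R t - ε / 2) ≤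
      Real.exp (ν * T₂) * (R T₂ - ε / 2) := by
    intro t ht
    have h1 := sub_le_of_deriv_le (f := fun t => Real.exp (ν * t) * (R t - ε / 2))
      (f' := fun t => Real.exp (ν * t) * (b t - ν * (ε / 2)))
      (B := fun _ => 0) (B' := fun _ => 0) ht ?_ (fun t _ => hasDerivAt_const t 0) ?_
    · linarith
    · intro s hs
      refine ((hasDerivAt_exp_const_mul ν s).mul
        ((hR s ((le_max_left _ _).trans hs.1)).sub_const _)).congr_deriv ?_
      ring
    · intro s hs
      have := hT₁ s ((le_max_right _ _).trans hs.1)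
      exact mul_nonpos_of_nonneg_of_nonpos (Real.exp_nonneg _) (by linarith)
  have hlim : Tendsto (fun t => Real.exp (-(ν * t)) * (Real.exp (ν * T₂) * (R T₂ - ε / 2)))
      atTop (𝓝 0) := by
    have : Tendsto (fun t => Real.exp (-(ν * t))) atTop (𝓝 0) :=
      Real.tendsto_exp_neg_atTop_nhds_zero.comp (tendsto_id.const_mul_atTop hν)
    simpa using this.mul_const (Real.exp (ν * T₂) * (R T₂ - ε / 2))
  obtain ⟨T₃, hT₃⟩ := eventually_atTop.mp
    (hlim.eventually (gt_mem_nhds (show 0 < ε / 2 by positivity)))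
  refine ⟨max T₂ T₃, fun t ht => ?_⟩
  have ht2 : T₂ ≤ t := (le_max_left _ _).trans ht
  have h1 := hle t ht2
  have h2 := hT₃ t ((le_max_right _ _).trans ht)
  rw [Real.dist_eq, sub_zero, abs_of_nonneg (hR0 t ((le_max_left _ _).trans ht2))]
  have h3 : R t - ε / 2 ≤ Real.exp (-(ν * t)) * (Real.exp (ν * T₂) * (R T₂ - ε / 2)) := by
    calc R t - ε / 2 = Real.exp (-(ν * t)) * (Real.exp (ν * t) * (R t - ε / 2)) := by
          rw [← mul_assoc, ← Real.exp_add]; simp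
      _ ≤ _ := by gcongr
  linarith

theorem exp_decay_of_deriv_le {R R' : ℝ → ℝ} {ν T : ℝ}
    (hR : ∀ t, T ≤ t → HasDerivAt R (R' t) t) (h : ∀ t, T ≤ t → R' t ≤ -ν * R t)
    {t : ℝ} (ht : T ≤ t) : R t ≤ Real.exp (ν * T) * R T * Real.exp (-(ν * t)) := by
  have h1 := sub_le_of_deriv_le (f := fun t => Real.exp (ν * t) * R t)
      (f' := fun t => Real.exp (ν * t) * (R' t + ν * R t))
      (B := fun _ => 0) (B' := fun _ => 0) ht ?_ (fun t _ => hasDerivAt_const t 0) ?_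
  · simp only [sub_self] at h1
    calc R t = Real.exp (-(ν * t)) * (Real.exp (ν * t) * R t) := by
          rw [← mul_assoc, ← Real.exp_add]; simp
      _ ≤ Real.exp (-(ν * t)) * (Real.exp (ν * T) * R T) :=
          mul_le_mul_of_nonneg_left (by linarith) (Real.exp_nonneg _)
      _ = _ := by ring
  · intro s hs
    refine ((hasDerivAt_exp_const_mul ν s).mul (hR s hs.1)).congr_deriv ?_
    ring
  · intro s hs
    have := h s hs.1
    exact mul_nonpos_of_nonneg_of_nonpos (Real.exp_nonneg _) (by linarith)

end RealAnalysis

/-! ### Competition between the neutral and the stable part. -/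

section Dichotomy

variable {H : Type*} [NormedAddCommGroup H] [InnerProductSpace ℝ H]

theorem hasDerivAt_norm_rpow_comp {a : ℝ → H} {a' : H} {t p : ℝ} (hp : 0 < p)
    (ha : HasDerivAt a a' t) :
    HasDerivAt (fun s => ‖a s‖ ^ (1 + p)) ((1 + p) * ‖a t‖ ^ (p - 1) * inner ℝ (a t) a') t := by
  have h := (hasFDerivAt_norm_rpow (a t) (p := 1 + p) (by linarith)).comp_hasDerivAt t ha
  refine h.congr_deriv ?_
  simp only [smul_apply, innerSL_apply_apply, smul_eq_mul]
  rw [show 1 + p - 2 = p - 1 by ring]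

theorem neg_le_deriv_norm_rpow {x x' : H} {p : ℝ} (hp : 0 < p) (hx : x ≠ 0) :
    -((1 + p) * ‖x‖ ^ p * ‖x'‖) ≤ (1 + p) * ‖x‖ ^ (p - 1) * inner ℝ x x' := by
  have h1 : -(‖x‖ * ‖x'‖) ≤ inner ℝ x x' := neg_le_of_abs_le (abs_real_inner_le_norm x x')
  have h2 : ‖x‖ ^ p = ‖x‖ ^ (p - 1) * ‖x‖ := by
    rw [Real.rpow_sub_one (norm_ne_zero_iff.mpr hx)]
    field_simp
  have h3 : 0 ≤ (1 + p) * ‖x‖ ^ (p - 1) := by positivity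
  calc -((1 + p) * ‖x‖ ^ p * ‖x'‖) = (1 + p) * ‖x‖ ^ (p - 1) * (-(‖x‖ * ‖x'‖)) := by
        rw [h2]; ring
    _ ≤ _ := by gcongr

/-- Either the neutral part `a` dominates the stable part `R`, or the stable part dominates. -/
theorem neutral_stable_dichotomy {a a' : ℝ → H} {R R' : ℝ → ℝ} {p ν C : ℝ} (hp : 0 < p)
    (hν : 0 < ν) (hC : 0 < C)
    (ha : ∀ᶠ t in atTop, HasDerivAt a (a' t) t)
    (hR : ∀ᶠ t in atTop, HasDerivAt R (R' t) t)
    (ha' : ∀ᶠ t in atTop, ‖a' t‖ ≤ C * (‖a t‖ ^ (1 + p) + R t))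
    (hR' : ∀ᶠ t in atTop, R' t ≤ -ν * R t + C * ‖a t‖ ^ (1 + p))
    (hlim : Tendsto a atTop (𝓝 0)) :
    (∀ᶠ t in atTop, a t ≠ 0 ∧ R t ≤ 2 * C / ν * ‖a t‖ ^ (1 + p)) ∨
      (∀ᶠ t in atTop, 2 * C / ν * ‖a t‖ ^ (1 + p) ≤ R t) := by
  set M := 2 * C / ν with hM
  have hM0 : 0 < M := by positivity
  by_cases hcase : ∀ᶠ t in atTop, M * ‖a t‖ ^ (1 + p) ≤ R t
  · exact Or.inr hcase
  left
  -- This smallness makes the boundary M‖a‖^{1+p} descend more slowly than R does when R touches it.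
  have hsmall : ∀ᶠ t in atTop, M * (1 + p) * (1 + M) * ‖a t‖ ^ p < 1 := by
    have h1 : Tendsto (fun t => M * (1 + p) * (1 + M) * ‖a t‖ ^ p) atTop (𝓝 0) := by
      have h2 : Tendsto (fun t => ‖a t‖ ^ p) atTop (𝓝 0) := by
        have := hlim.norm.rpow_const (p := p) (Or.inr hp.le)
        simpa [Real.zero_rpow hp.ne'] using this
      simpa using h2.const_mul (M * (1 + p) * (1 + M))
    exact h1.eventually (gt_mem_nhds one_pos)
  have hone : ∀ᶠ t in atTop, ‖a t‖ < 1 := by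
    have := hlim.norm
    rw [norm_zero] at this
    exact this.eventually (gt_mem_nhds one_pos)
  obtain ⟨T₀, hT₀⟩ := eventually_atTop.mp
    (ha.and (hR.and (ha'.and (hR'.and (hsmall.and hone)))))
  have hfreq : ∃ᶠ t in atTop, R t < M * ‖a t‖ ^ (1 + p) := by
    simpa [Filter.Frequently] using hcase
  obtain ⟨T, hT, hTlt⟩ := (frequently_atTop.mp hfreq) T₀
  have pos_rpow : ∀ t, a t ≠ 0 → 0 < ‖a t‖ ^ (1 + p) := fun t h =>
    Real.rpow_pos_of_pos (norm_pos_iff.mpr h) _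
  -- Nonnegativity of R is not assumed, but where a vanishes the bound on ‖a'‖ forces R ≥ 0.
  have haT : a T ≠ 0 := by
    intro h0
    rw [h0, norm_zero, Real.zero_rpow (by positivity), mul_zero] at hTlt
    obtain ⟨-, -, h1, -⟩ := hT₀ T hT
    rw [h0, norm_zero, Real.zero_rpow (by positivity), zero_add] at h1
    have : 0 ≤ C * R T := (norm_nonneg _).trans h1
    nlinarith
  -- Where R = M‖a‖^{1+p}, the choice M = 2C/ν gives R' ≤ -C‖a‖^{1+p}, while the boundary has
  -- derivative greater than that. So R cannot cross it as long as a ≠ 0.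
  have hcomp : ∀ t₁, (∀ t ∈ Ico T t₁, a t ≠ 0) →
      ∀ t ∈ Icc T t₁, R t ≤ M * ‖a t‖ ^ (1 + p) := by
    intro t₁ hne
    have hBd : ∀ t, T ≤ t → HasDerivAt (fun t => M * ‖a t‖ ^ (1 + p))
        (M * ((1 + p) * ‖a t‖ ^ (p - 1) * inner ℝ (a t) (a' t))) t := fun t ht =>
      (hasDerivAt_norm_rpow_comp hp (hT₀ t (hT.trans ht)).1).const_mul M
    intro t ht
    refine image_le_of_deriv_right_lt_deriv_boundary' (f := R) (f' := R') (a := T) (b := t₁)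
      (B := fun t => M * ‖a t‖ ^ (1 + p))
      (B' := fun t => M * ((1 + p) * ‖a t‖ ^ (p - 1) * inner ℝ (a t) (a' t)))
      ?_ ?_ hTlt.le ?_ ?_ ?_ ht
    · exact fun t ht => (hT₀ t (hT.trans ht.1)).2.1.continuousAt.continuousWithinAt
    · exact fun t ht => (hT₀ t (hT.trans ht.1)).2.1.hasDerivWithinAt
    · exact fun t ht => (hBd t ht.1).continuousAt.continuousWithinAt
    · exact fun t ht => (hBd t ht.1).hasDerivWithinAt
    · intro t ht heq
      obtain ⟨-, -, h1, h2, h3, -⟩ := hT₀ t (hT.trans ht.1)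
      have hx := pos_rpow t (hne t ht)
      rw [heq] at h1 h2
      have h4 := neg_le_deriv_norm_rpow (x' := a' t) hp (hne t ht)
      have h5 : (1 + p) * ‖a t‖ ^ p * ‖a' t‖ ≤
          (1 + p) * ‖a t‖ ^ p * (C * (‖a t‖ ^ (1 + p) + M * ‖a t‖ ^ (1 + p))) := by gcongr
      have h6 : M * ((1 + p) * ‖a t‖ ^ p * (C * (‖a t‖ ^ (1 + p) + M * ‖a t‖ ^ (1 + p)))) <
          C * ‖a t‖ ^ (1 + p) := by
        have : M * ((1 + p) * ‖a t‖ ^ p * (C * (‖a t‖ ^ (1 + p) + M * ‖a t‖ ^ (1 + p)))) =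
            (M * (1 + p) * (1 + M) * ‖a t‖ ^ p) * (C * ‖a t‖ ^ (1 + p)) := by ring
        rw [this]
        exact mul_lt_of_lt_one_left (by positivity) h3
      have h7 : -ν * (M * ‖a t‖ ^ (1 + p)) = -(2 * C * ‖a t‖ ^ (1 + p)) := by
        rw [hM]; field_simp
      rw [h7] at h2
      have h8 : M * (-((1 + p) * ‖a t‖ ^ p * ‖a' t‖)) ≤
          M * ((1 + p) * ‖a t‖ ^ (p - 1) * inner ℝ (a t) (a' t)) := by gcongr
      nlinarith
  have hne : ∀ t, T ≤ t → a t ≠ 0 := by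
    intro t₂ ht₂ h0
    have hcont : ContinuousOn a (Icc T t₂) := fun t ht =>
      (hT₀ t (hT.trans ht.1)).1.continuousAt.continuousWithinAt
    set Z := Icc T t₂ ∩ a ⁻¹' {0} with hZ
    have hZc : IsClosed Z := hcont.preimage_isClosed_of_isClosed isClosed_Icc isClosed_singleton
    have hZne : Z.Nonempty := ⟨t₂, ⟨ht₂, le_rfl⟩, h0⟩
    have hZb : BddBelow Z := ⟨T, fun t ht => ht.1.1⟩
    set t₁ := sInf Z with ht₁
    have ht₁Z : t₁ ∈ Z := hZc.csInf_mem hZne hZb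
    have hTt₁ : T ≤ t₁ := ht₁Z.1.1
    have hlt : ∀ t ∈ Ico T t₁, a t ≠ 0 := by
      intro t ht h
      have : t₁ ≤ t := csInf_le hZb ⟨⟨ht.1, ht.2.le.trans ht₁Z.1.2⟩, h⟩
      exact absurd ht.2 (not_lt.mpr this)
    have hle := hcomp t₁ hlt
    -- Below the boundary and with ‖a‖ < 1 one has ‖a'‖ ≤ C(1 + M)‖a‖, so ‖a‖²e^{2C(1+M)t} is
    -- nondecreasing and a cannot reach 0 at a first time t₁.
    have h1 := sub_le_of_deriv_le
      (f := fun _ => 0) (f' := fun _ => 0)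
      (B := fun t => ‖a t‖ ^ 2 * Real.exp (2 * (C * (1 + M)) * t))
      (B' := fun t => 2 * inner ℝ (a t) (a' t) * Real.exp (2 * (C * (1 + M)) * t) +
        ‖a t‖ ^ 2 * (2 * (C * (1 + M)) * Real.exp (2 * (C * (1 + M)) * t)))
      hTt₁ (fun t _ => hasDerivAt_const t 0) ?_ ?_
    · have e : a t₁ = 0 := ht₁Z.2
      simp only [e, norm_zero] at h1
      have : 0 < ‖a T‖ ^ 2 * Real.exp (2 * (C * (1 + M)) * T) := by
        have := norm_pos_iff.mpr haT
        positivity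
      norm_num at h1
      linarith
    · intro t ht
      exact ((hT₀ t (hT.trans ht.1)).1.norm_sq).mul (hasDerivAt_exp_const_mul _ t)
    · intro t ht
      obtain ⟨-, -, h2, -, -, h3⟩ := hT₀ t (hT.trans ht.1)
      have h4 : ‖a t‖ ^ (1 + p) ≤ ‖a t‖ := by
        rcases (norm_nonneg (a t)).eq_or_lt with h | h
        · rw [← h, Real.zero_rpow (by positivity)]
        · calc ‖a t‖ ^ (1 + p) ≤ ‖a t‖ ^ (1 : ℝ) :=
                Real.rpow_le_rpow_of_exponent_ge h h3.le (by linarith)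
            _ = ‖a t‖ := Real.rpow_one _
      have h5 : ‖a' t‖ ≤ C * (1 + M) * ‖a t‖ := by
        calc ‖a' t‖ ≤ C * (‖a t‖ ^ (1 + p) + R t) := h2
          _ ≤ C * (‖a t‖ ^ (1 + p) + M * ‖a t‖ ^ (1 + p)) := by gcongr; exact hle t ht
          _ = C * (1 + M) * ‖a t‖ ^ (1 + p) := by ring
          _ ≤ _ := by gcongr
      have h6 : -(‖a t‖ * ‖a' t‖) ≤ inner ℝ (a t) (a' t) :=
        neg_le_of_abs_le (abs_real_inner_le_norm _ _)
      have h7 : ‖a t‖ * ‖a' t‖ ≤ ‖a t‖ * (C * (1 + M) * ‖a t‖) := by gcongr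
      have h8 : 0 ≤ inner ℝ (a t) (a' t) + C * (1 + M) * ‖a t‖ ^ 2 := by nlinarith
      have h9 := mul_nonneg h8 (Real.exp_nonneg (2 * (C * (1 + M)) * t))
      nlinarith
  filter_upwards [eventually_ge_atTop T] with t ht
  exact ⟨hne t ht, hcomp t (fun s hs => hne s hs.1) t ⟨ht, le_rfl⟩⟩

/-- The derivative of ‖a‖^{-p} is at most pC, so ‖a‖^{-p} grows at most linearly. -/
theorem polynomial_lower_bound {a a' : ℝ → H} {p C : ℝ} (hp : 0 < p) (hC : 0 < C)
    (ha : ∀ᶠ t in atTop, HasDerivAt a (a' t) t) (ha0 : ∀ᶠ t in atTop, a t ≠ 0)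
    (ha' : ∀ᶠ t in atTop, ‖a' t‖ ≤ C * ‖a t‖ ^ (1 + p)) :
    ∃ c > 0, ∀ᶠ t in atTop, c / (1 + t) ^ (1 / p) ≤ ‖a t‖ := by
  obtain ⟨T, hT⟩ := eventually_atTop.mp
    (ha.and (ha0.and (ha'.and (eventually_ge_atTop 0))))
  have hT0 : 0 ≤ T := (hT T le_rfl).2.2.2
  -- This is ‖a‖^{-p}, written through the smooth function ‖a‖².
  set ψ : ℝ → ℝ := fun t => (‖a t‖ ^ 2) ^ (-p / 2) with hψ
  have hψpos : ∀ t, T ≤ t → 0 < ψ t := fun t ht => by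
    have := norm_pos_iff.mpr (hT t ht).2.1
    positivity
  set N := ψ T + p * C with hN
  have hNpos : 0 < N := by have := hψpos T le_rfl; positivity
  have hbound : ∀ t, T ≤ t → ψ t ≤ N * (1 + t) := by
    intro t ht
    have h1 := sub_le_of_deriv_le (f := ψ)
      (f' := fun t => 2 * inner ℝ (a t) (a' t) * (-p / 2) * (‖a t‖ ^ 2) ^ (-p / 2 - 1))
      (B := fun t => p * C * t) (B' := fun _ => p * C) ht ?_ ?_ ?_
    · have := hψpos T le_rfl
      have h3 : 0 ≤ ψ T * t := mul_nonneg this.le (hT0.trans ht)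
      have h4 : 0 ≤ p * C * T := by positivity
      have h5 : 0 < p * C := by positivity
      rw [hN]
      nlinarith
    · intro s hs
      have := norm_pos_iff.mpr (hT s hs.1).2.1
      exact ((hT s hs.1).1.norm_sq).rpow_const (Or.inl (by positivity))
    · intro s _
      simpa using (hasDerivAt_id' s).const_mul (p * C)
    · intro s hs
      obtain ⟨-, h0, h2, -⟩ := hT s hs.1
      have hx := norm_pos_iff.mpr h0
      have e1 : (‖a s‖ ^ 2) ^ (-p / 2 - 1) = (‖a s‖ ^ (2 + p))⁻¹ := by
        rw [← Real.rpow_natCast, ← Real.rpow_mul hx.le, ← Real.rpow_neg hx.le]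
        congr 1
        push_cast
        ring
      have e2 : ‖a s‖ ^ (2 + p) = ‖a s‖ * ‖a s‖ ^ (1 + p) := by
        rw [show 2 + p = 1 + (1 + p) by ring, Real.rpow_add hx, Real.rpow_one]
      rw [e1]
      have h6 : -(‖a s‖ * ‖a' s‖) ≤ inner ℝ (a s) (a' s) :=
        neg_le_of_abs_le (abs_real_inner_le_norm _ _)
      have h7 : ‖a s‖ * ‖a' s‖ ≤ ‖a s‖ * (C * ‖a s‖ ^ (1 + p)) := by gcongr
      rw [mul_inv_le_iff₀ (by positivity), e2]
      nlinarith
  refine ⟨N ^ (-(1 / p)), by positivity, ?_⟩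
  filter_upwards [eventually_ge_atTop T] with t ht
  have hx := norm_pos_iff.mpr (hT t ht).2.1
  have ht0 : 0 < 1 + t := by have := hT0.trans ht; linarith
  have h1 := hbound t ht
  have h2 : (N * (1 + t)) ^ (-(1 / p)) ≤ ψ t ^ (-(1 / p)) :=
    Real.rpow_le_rpow_of_nonpos (hψpos t ht) h1 (by rw [neg_nonpos]; positivity)
  have h3 : ψ t ^ (-(1 / p)) = ‖a t‖ := by
    rw [hψ]
    simp only
    rw [← Real.rpow_natCast, ← Real.rpow_mul hx.le, ← Real.rpow_mul hx.le]
    have : ((2 : ℕ) : ℝ) * (-p / 2) * -(1 / p) = 1 := by push_cast; field_simp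
    rw [this, Real.rpow_one]
  rw [h3, Real.mul_rpow hNpos.le ht0.le, Real.rpow_neg ht0.le] at h2
  rwa [div_eq_mul_inv]

end Dichotomy

open Asymptotics

/-! ### Forced linear estimates for each rate. -/

section LinearEstimates

variable {H ι : Type*} [NormedAddCommGroup H] [InnerProductSpace ℝ H] [CompleteSpace H]
  {P : ι → H →L[ℝ] H} {lam : ι → ℝ} {δ : ℝ} {g : ℝ → H} {U : ℝ → H × H × H} {r : ℝ}

theorem exists_isKernel_rate (lam : ι → ℝ) (hδ : 0 ≤ δ) (r : ℝ) : ∃ C,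
    IsKernel lam δ (rateKernel lam δ r) (rateKernelDeriv lam δ r) C :=
  let ⟨_, _, h⟩ := exists_isKernel lam hδ r
  ⟨_, h⟩

theorem norm_ratePropagator_le (hP : IsResolution P) (hδ : 0 ≤ δ) (r : ℝ) : ∃ M, 0 < M ∧
    ∀ t y, ‖ratePropagator P lam δ r t y‖ ≤ M * ((1 + |t|) * Real.exp (-(r * t))) * ‖y‖ := by
  obtain ⟨M, hM, hK⟩ := exists_isKernel lam hδ r
  rcases isEmpty_or_nonempty ι with hι | hι
  · refine ⟨1, one_pos, fun t y => ?_⟩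
    rw [ratePropagator_eq_zero hP hδ (fun i => hι.elim i), norm_zero]
    positivity
  · refine ⟨(2 + 2 * δ) * M, by positivity, fun t y => ?_⟩
    rw [mul_assoc (2 + 2 * δ)]
    exact hK.norm_propagator_le hP hδ hι t y

/-- Forward in time the exponent is lowered from r to ρ in exchange for the factor 1 + t. -/
theorem norm_ratePropagator_le_of_lt (hP : IsResolution P) (hδ : 0 ≤ δ) {ρ : ℝ} (hρ : ρ < r) :
    ∃ M, 0 < M ∧ ∀ t, 0 ≤ t → ∀ y,
      ‖ratePropagator P lam δ r t y‖ ≤ M * Real.exp (-(ρ * t)) * ‖y‖ := by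
  obtain ⟨M, hM, h⟩ := norm_ratePropagator_le (lam := lam) hP hδ r
  have hε : 0 < r - ρ := sub_pos.mpr hρ
  refine ⟨M * (1 + 1 / (r - ρ)), by positivity, fun t ht y => (h t y).trans ?_⟩
  have h1 := one_add_le_mul_exp hε ht
  rw [abs_of_nonneg ht, mul_assoc M, mul_assoc M, mul_assoc M]
  gcongr M * (?_ * _)
  calc (1 + t) * Real.exp (-(r * t))
      ≤ (1 + 1 / (r - ρ)) * Real.exp ((r - ρ) * t) * Real.exp (-(r * t)) := by gcongr
    _ = _ := by
      rw [mul_assoc, ← Real.exp_add]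
      ring_nf

/-- Backward in time the propagator grows, and the loss in the exponent goes the other way. -/
theorem norm_ratePropagator_le_of_gt (hP : IsResolution P) (hδ : 0 ≤ δ) {ρ : ℝ} (hρ : r < ρ) :
    ∃ M, 0 < M ∧ ∀ t, t ≤ 0 → ∀ y,
      ‖ratePropagator P lam δ r t y‖ ≤ M * Real.exp (-(ρ * t)) * ‖y‖ := by
  obtain ⟨M, hM, h⟩ := norm_ratePropagator_le (lam := lam) hP hδ r
  have hε : 0 < ρ - r := sub_pos.mpr hρ
  refine ⟨M * (1 + 1 / (ρ - r)), by positivity, fun t ht y => (h t y).trans ?_⟩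
  have h1 := one_add_le_mul_exp hε (neg_nonneg.mpr ht)
  rw [abs_of_nonpos ht, mul_assoc M, mul_assoc M, mul_assoc M]
  gcongr M * (?_ * _)
  calc (1 + -t) * Real.exp (-(r * t))
      ≤ (1 + 1 / (ρ - r)) * Real.exp ((ρ - r) * -t) * Real.exp (-(r * t)) := by gcongr
    _ = _ := by
      rw [mul_assoc, ← Real.exp_add]
      ring_nf

theorem hasDerivAt_ratePropagator (hP : IsResolution P) (hδ : 0 ≤ δ) (hlam : ∀ i, 0 ≤ lam i)
    (hU : IsModalSolution P lam δ 0 g U) (hg : ContinuousOn g (Ici 0)) (r T : ℝ) {t : ℝ}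
    (ht : 0 < t) :
    HasDerivAt (fun s => ratePropagator P lam δ r (T - s) (U s))
      (ratePropagator P lam δ r (T - t) (0, 0, g t)) t :=
  (exists_isKernel_rate lam hδ r).choose_spec.hasDerivAt_propagator hP hδ hlam hU hg T ht

theorem ratePropagator_ratePropagator (hP : IsResolution P) (hδ : 0 ≤ δ) (hlam : ∀ i, 0 ≤ lam i)
    {y : H × H × H} (hy : IsCompatible P lam y) (r t s : ℝ) :
    ratePropagator P lam δ r t (ratePropagator P lam δ r s y) =
      ratePropagator P lam δ r (t + s) y :=
  (exists_isKernel_rate lam hδ r).choose_spec.propagator_propagator hP hδ hlam hy t s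

theorem IsCompatible.ratePropagator (hP : IsResolution P) (hδ : 0 ≤ δ) {y : H × H × H}
    (hy : IsCompatible P lam y) (r t : ℝ) :
    IsCompatible P lam (ratePropagator P lam δ r t y) :=
  (exists_isKernel_rate lam hδ r).choose_spec.isCompatible hP hδ hy t

theorem norm_triple (x : H) : ‖((0, 0, x) : H × H × H)‖ = ‖x‖ := by
  simp [Prod.norm_def]

theorem norm_sub_ratePropagator_le (hP : IsResolution P) (hδ : 0 ≤ δ) (hlam : ∀ i, 0 ≤ lam i)
    (hU : IsModalSolution P lam δ 0 g U) (hg : ContinuousOn g (Ici 0)) {r T s t : ℝ} (hs : 0 < s)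
    (hst : s ≤ t) {B B' : ℝ → ℝ} (hB : ∀ τ ∈ Icc s t, HasDerivAt B (B' τ) τ)
    (h : ∀ τ ∈ Icc s t, ‖ratePropagator P lam δ r (T - τ) (0, 0, g τ)‖ ≤ B' τ) :
    ‖ratePropagator P lam δ r (T - t) (U t) - ratePropagator P lam δ r (T - s) (U s)‖ ≤
      B t - B s :=
  norm_sub_le_of_norm_deriv_le hst
    (fun τ hτ => hasDerivAt_ratePropagator hP hδ hlam hU hg r T (hs.trans_le hτ.1)) hB h

theorem sub_ratePropagator_eq_sum (hP : IsResolution P) (hδ : 0 ≤ δ) (D : Finset ℝ)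
    (hD : ∀ r i, Selects lam δ r i → r ∈ D) (r : ℝ) (y : H × H × H) :
    y - ratePropagator P lam δ r 0 y = ∑ s ∈ D.erase r, ratePropagator P lam δ s 0 y := by
  by_cases hr : r ∈ D
  · rw [sub_eq_iff_eq_add]
    conv_lhs => rw [← sum_ratePropagator_zero hP hδ D hD y]
    rw [← Finset.add_sum_erase D _ hr, add_comm]
  · rw [ratePropagator_eq_zero hP hδ (fun i hi => hr (hD r i hi)), Finset.erase_eq_of_notMem hr,
      sum_ratePropagator_zero hP hδ D hD y, sub_zero]

/-- The solution of `R' = -νR + ‖g‖` with `R(1) = e^{-ν} c`. -/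
def majorant (g : ℝ → H) (ν c t : ℝ) : ℝ :=
  Real.exp (-(ν * t)) * (c + ∫ τ in (1 : ℝ)..t, Real.exp (ν * τ) * ‖g τ‖)

theorem hasDerivAt_integral_exp (hg : ContinuousOn g (Ici 0)) (ν : ℝ) {t : ℝ} (ht : 0 < t) :
    HasDerivAt (fun t => ∫ τ in (1 : ℝ)..t, Real.exp (ν * τ) * ‖g τ‖)
      (Real.exp (ν * t) * ‖g t‖) t := by
  have hc : ContinuousOn (fun τ => Real.exp (ν * τ) * ‖g τ‖) (Ioi 0) :=
    (Continuous.continuousOn (by fun_prop)).mul (hg.mono Ioi_subset_Ici_self).norm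
  apply intervalIntegral.integral_hasDerivAt_right
  · apply ContinuousOn.intervalIntegrable
    apply hc.mono
    intro x hx
    exact (lt_min one_pos ht).trans_le hx.1
  · exact (hc.stronglyMeasurableAtFilter_nhdsWithin measurableSet_Ioi t).filter_mono
      (by rw [isOpen_Ioi.nhdsWithin_eq ht])
  · exact hc.continuousAt (Ioi_mem_nhds ht)

theorem hasDerivAt_majorant (hg : ContinuousOn g (Ici 0)) (ν c : ℝ) {t : ℝ} (ht : 0 < t) :
    HasDerivAt (majorant g ν c) (-ν * majorant g ν c t + ‖g t‖) t := by
  refine ((hasDerivAt_exp_neg_mul ν t).mul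
    ((hasDerivAt_integral_exp hg ν ht).const_add c)).congr_deriv ?_
  rw [majorant, ← mul_assoc (Real.exp _), ← Real.exp_add]
  simp
  ring

theorem majorant_nonneg (g : ℝ → H) (ν : ℝ) {c : ℝ} (hc : 0 ≤ c) {t : ℝ} (ht : 1 ≤ t) :
    0 ≤ majorant g ν c t :=
  mul_nonneg (Real.exp_nonneg _)
    (add_nonneg hc (intervalIntegral.integral_nonneg ht fun _ _ => by positivity))

/-- Duhamel from time 1, since modal derivatives are available only at positive times. The majorant
is preferred to the norm of the component because it satisfies an exact scalar equation. -/
theorem norm_ratePropagator_le_majorant (hP : IsResolution P) (hδ : 0 ≤ δ)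
    (hlam : ∀ i, 0 ≤ lam i) (hU : IsModalSolution P lam δ 0 g U) (hg : ContinuousOn g (Ici 0))
    {ν : ℝ} (hν : ν < r) : ∃ M, 0 < M ∧ ∀ t, 1 ≤ t →
      ‖ratePropagator P lam δ r 0 (U t)‖ ≤ M * majorant g ν (Real.exp ν * ‖U 1‖) t := by
  obtain ⟨M, hM, h⟩ := norm_ratePropagator_le_of_lt (lam := lam) hP hδ hν
  refine ⟨M, hM, fun t ht => ?_⟩
  have h1 := norm_sub_ratePropagator_le hP hδ hlam hU hg (r := r) (T := t) one_pos ht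
    (B := fun s => M * Real.exp (-(ν * t)) * ∫ τ in (1 : ℝ)..s, Real.exp (ν * τ) * ‖g τ‖)
    (fun τ hτ => (hasDerivAt_integral_exp hg ν (one_pos.trans_le hτ.1)).const_mul _) ?_
  · rw [sub_self, intervalIntegral.integral_same, mul_zero, sub_zero] at h1
    have h2 := h (t - 1) (by linarith) (U 1)
    have h3 : ‖ratePropagator P lam δ r 0 (U t)‖ ≤
        ‖ratePropagator P lam δ r 0 (U t) - ratePropagator P lam δ r (t - 1) (U 1)‖ +
          ‖ratePropagator P lam δ r (t - 1) (U 1)‖ := by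
      simpa using norm_add_le (ratePropagator P lam δ r 0 (U t) -
        ratePropagator P lam δ r (t - 1) (U 1)) (ratePropagator P lam δ r (t - 1) (U 1))
    have e : Real.exp (-(ν * (t - 1))) = Real.exp (-(ν * t)) * Real.exp ν := by
      rw [← Real.exp_add]; ring_nf
    rw [e] at h2
    rw [majorant]
    nlinarith
  · intro τ hτ
    refine (h (t - τ) (by linarith [hτ.2]) _).trans (le_of_eq ?_)
    have e : Real.exp (-(ν * (t - τ))) = Real.exp (-(ν * t)) * Real.exp (ν * τ) := by
      rw [← Real.exp_add]; ring_nf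
    rw [norm_triple, e]
    ring

theorem isBigO_exp_of_le {f : ℝ → H × H × H} {γ γ' : ℝ} (h : γ ≤ γ')
    (hf : f =O[atTop] fun t => Real.exp (-(γ' * t))) :
    f =O[atTop] fun t => Real.exp (-(γ * t)) := by
  refine hf.trans (IsBigO.of_bound 1 ?_)
  filter_upwards [eventually_ge_atTop 0] with t ht
  rw [one_mul, Real.norm_of_nonneg (Real.exp_nonneg _), Real.norm_of_nonneg (Real.exp_nonneg _)]
  gcongr

theorem majorant_isBigO (hg : ContinuousOn g (Ici 0)) {γ ν : ℝ} (hγ : γ < ν)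
    (hgO : g =O[atTop] fun t => Real.exp (-(γ * t))) {c : ℝ} (hc : 0 ≤ c) :
    majorant g ν c =O[atTop] fun t => Real.exp (-(γ * t)) := by
  obtain ⟨C, hC, hb⟩ := hgO.exists_pos
  obtain ⟨T₀, hT₀⟩ := eventually_atTop.mp hb.bound
  set T := max 1 T₀ with hT
  have hε : 0 < ν - γ := sub_pos.mpr hγ
  set A := Real.exp (ν * T) * majorant g ν c T with hA
  have hA0 : 0 ≤ A := mul_nonneg (Real.exp_nonneg _) (majorant_nonneg g ν hc (le_max_left _ _))
  -- The first constant comes from A e^{-νt}, compared with e^{-γt} for t ≥ T; the second from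
  -- integrating C e^{(ν-γ)τ}.
  refine IsBigO.of_bound (A * Real.exp (-((ν - γ) * T)) + C / (ν - γ)) ?_
  filter_upwards [eventually_ge_atTop T] with t ht
  have ht1 : 1 ≤ t := (le_max_left _ _).trans ht
  have h1 := sub_le_of_deriv_le (f := fun t => Real.exp (ν * t) * majorant g ν c t)
      (f' := fun t => Real.exp (ν * t) * ‖g t‖)
      (B := fun t => C / (ν - γ) * Real.exp ((ν - γ) * t))
      (B' := fun t => C / (ν - γ) * ((ν - γ) * Real.exp ((ν - γ) * t))) ht ?_
      (fun t _ => (hasDerivAt_exp_const_mul _ t).const_mul _) ?_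
  · have h2 : Real.exp (ν * t) * majorant g ν c t ≤ A + C / (ν - γ) * Real.exp ((ν - γ) * t) := by
      have : 0 ≤ C / (ν - γ) * Real.exp ((ν - γ) * T) := by positivity
      rw [hA]; linarith
    rw [Real.norm_of_nonneg (majorant_nonneg g ν hc ht1), Real.norm_of_nonneg (Real.exp_nonneg _)]
    calc majorant g ν c t = Real.exp (-(ν * t)) * (Real.exp (ν * t) * majorant g ν c t) := by
          rw [← mul_assoc, ← Real.exp_add]; simp
      _ ≤ Real.exp (-(ν * t)) * (A + C / (ν - γ) * Real.exp ((ν - γ) * t)) := by gcongr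
      _ = A * Real.exp (-(ν * t)) + C / (ν - γ) * Real.exp (-(γ * t)) := by
          have e : Real.exp (-(γ * t)) = Real.exp (-(ν * t)) * Real.exp ((ν - γ) * t) := by
            rw [← Real.exp_add]; ring_nf
          rw [e]; ring
      _ ≤ A * (Real.exp (-((ν - γ) * T)) * Real.exp (-(γ * t))) +
            C / (ν - γ) * Real.exp (-(γ * t)) := by
          rw [← Real.exp_add]
          gcongr
          nlinarith
      _ = _ := by ring
  · intro s hs
    refine ((hasDerivAt_exp_const_mul ν s).mul (hasDerivAt_majorant hg ν c
      (one_pos.trans_le ((le_max_left _ _).trans hs.1)))).congr_deriv ?_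
    ring
  · intro s hs
    have h3 := hT₀ s ((le_max_right _ _).trans hs.1)
    rw [Real.norm_of_nonneg (Real.exp_nonneg _)] at h3
    calc Real.exp (ν * s) * ‖g s‖ ≤ Real.exp (ν * s) * (C * Real.exp (-(γ * s))) := by gcongr
      _ = C * Real.exp ((ν - γ) * s) := by
          rw [mul_left_comm, ← Real.exp_add]; ring_nf
      _ = _ := by field_simp

/-- A component whose own rate exceeds that of the forcing inherits the rate of the forcing; an
exponent ν strictly between the two leaves no polynomial loss. -/
theorem ratePropagator_isBigO_of_lt (hP : IsResolution P) (hδ : 0 ≤ δ)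
    (hlam : ∀ i, 0 ≤ lam i) (hU : IsModalSolution P lam δ 0 g U) (hg : ContinuousOn g (Ici 0))
    {γ : ℝ} (hγ : γ < r) (hgO : g =O[atTop] fun t => Real.exp (-(γ * t))) :
    (fun t => ratePropagator P lam δ r 0 (U t)) =O[atTop] fun t => Real.exp (-(γ * t)) := by
  obtain ⟨ν, h1, h2⟩ := exists_between hγ
  obtain ⟨M, hM, h⟩ := norm_ratePropagator_le_majorant hP hδ hlam hU hg h2
  refine IsBigO.trans (IsBigO.of_bound M ?_)
    (majorant_isBigO hg h1 hgO (c := Real.exp ν * ‖U 1‖) (by positivity))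
  filter_upwards [eventually_ge_atTop 1] with t ht
  refine (h t ht).trans ?_
  gcongr
  exact le_abs_self _

/-- Duhamel on [s, τ], pulled back to the earlier time t: the backward growth e^{ρ(ξ - t)} is beaten
by e^{-γξ}, so the bound is independent of τ. It is the tool for integrating from infinity. -/
theorem norm_sub_ratePropagator_le_exp (hP : IsResolution P) (hδ : 0 ≤ δ)
    (hlam : ∀ i, 0 ≤ lam i) (hU : IsModalSolution P lam δ 0 g U) (hg : ContinuousOn g (Ici 0))
    {γ ρ M C T : ℝ} (hγ : ρ < γ) (hM0 : 0 ≤ M)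
    (hM : ∀ t, t ≤ 0 → ∀ y, ‖ratePropagator P lam δ r t y‖ ≤ M * Real.exp (-(ρ * t)) * ‖y‖)
    (hT : 0 < T) (hC0 : 0 ≤ C) (hC : ∀ t, T ≤ t → ‖g t‖ ≤ C * Real.exp (-(γ * t)))
    {s t τ : ℝ} (hs : T ≤ s) (hts : t ≤ s) (hsτ : s ≤ τ) :
    ‖ratePropagator P lam δ r (t - τ) (U τ) - ratePropagator P lam δ r (t - s) (U s)‖ ≤
      M * C / (γ - ρ) * (Real.exp (-(ρ * t)) * Real.exp (-((γ - ρ) * s))) := by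
  have hε : 0 < γ - ρ := sub_pos.mpr hγ
  have h1 := norm_sub_ratePropagator_le hP hδ hlam hU hg (r := r) (T := t) (hT.trans_le hs) hsτ
    (B := fun ξ => -(M * C / (γ - ρ) * Real.exp (-(ρ * t))) * Real.exp (-((γ - ρ) * ξ)))
    (fun τ hτ => (hasDerivAt_exp_neg_mul (γ - ρ) τ).const_mul _) ?_
  · refine h1.trans ?_
    have : 0 ≤ M * C / (γ - ρ) * Real.exp (-(ρ * t)) * Real.exp (-((γ - ρ) * τ)) := by positivity
    nlinarith
  · intro ξ hξ
    calc _ ≤ M * Real.exp (-(ρ * (t - ξ))) * ‖((0, 0, g ξ) : H × H × H)‖ :=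
          hM _ (by linarith [hξ.1]) _
      _ ≤ M * Real.exp (-(ρ * (t - ξ))) * (C * Real.exp (-(γ * ξ))) := by
          rw [norm_triple]
          gcongr
          exact hC ξ (hs.trans hξ.1)
      _ = M * C * (Real.exp (-(ρ * (t - ξ))) * Real.exp (-(γ * ξ))) := by ring
      _ = M * C * (Real.exp (-(ρ * t)) * Real.exp (-((γ - ρ) * ξ))) := by
          rw [← Real.exp_add, ← Real.exp_add]; ring_nf
      _ = _ := by field_simp

theorem isCompatible_of_modal (hU : IsModalSolution P lam δ 0 g U) {t : ℝ} (ht : 0 ≤ t) :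
    IsCompatible P lam (U t) := hU.sqrt t ht

/-- If the forcing decays faster than `e^{-rt}`, then the component of rate `r` of a solution
has an asymptotic profile. -/
theorem exists_tendsto_ratePropagator (hP : IsResolution P) (hδ : 0 ≤ δ)
    (hlam : ∀ i, 0 ≤ lam i) (hU : IsModalSolution P lam δ 0 g U) (hg : ContinuousOn g (Ici 0))
    {γ : ℝ} (hγ : r < γ) (hgO : g =O[atTop] fun t => Real.exp (-(γ * t))) :
    ∃ z, IsCompatible P lam z ∧ ratePropagator P lam δ r 0 z = z ∧
      Tendsto (fun t => ratePropagator P lam δ r (-t) (U t)) atTop (𝓝 z) := by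
  obtain ⟨ρ, h1, h2⟩ := exists_between hγ
  obtain ⟨M, hM0, hM⟩ := norm_ratePropagator_le_of_gt (lam := lam) hP hδ h1
  obtain ⟨C, hC0, hb⟩ := hgO.exists_pos
  obtain ⟨T₀, hT₀⟩ := eventually_atTop.mp hb.bound
  set T := max 1 T₀ with hT
  have hC : ∀ t, T ≤ t → ‖g t‖ ≤ C * Real.exp (-(γ * t)) := fun t ht => by
    simpa using hT₀ t ((le_max_right _ _).trans ht)
  have hTpos : 0 < T := one_pos.trans_le (le_max_left _ _)
  have hε : 0 < γ - ρ := sub_pos.mpr h2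
  -- The tail estimate pulled back to time 0.
  have hcauchy : CauchySeq fun t => ratePropagator P lam δ r (-t) (U t) := by
    rw [Metric.cauchySeq_iff']
    intro ε hε'
    have hlim : Tendsto (fun s => M * C / (γ - ρ) *
        (Real.exp (-(ρ * 0)) * Real.exp (-((γ - ρ) * s)))) atTop (𝓝 0) := by
      have : Tendsto (fun s => Real.exp (-((γ - ρ) * s))) atTop (𝓝 0) :=
        Real.tendsto_exp_neg_atTop_nhds_zero.comp (tendsto_id.const_mul_atTop hε)
      simpa using (this.const_mul (Real.exp (-(ρ * 0)))).const_mul (M * C / (γ - ρ))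
    obtain ⟨N, hN, hNT⟩ := ((hlim.eventually (gt_mem_nhds hε')).and
      (eventually_ge_atTop T)).exists
    refine ⟨N, fun τ hτ => ?_⟩
    rw [dist_eq_norm]
    have := norm_sub_ratePropagator_le_exp hP hδ hlam hU hg h2 hM0.le hM hTpos hC0.le hC
      (t := 0) hNT (hTpos.le.trans hNT) hτ
    simp only [zero_sub] at this
    exact this.trans_lt hN
  obtain ⟨z, hz⟩ := cauchySeq_tendsto_of_complete hcauchy
  refine ⟨z, fun i => ?_, ?_, hz⟩
  · have l1 : Tendsto (fun t => P i (ratePropagator P lam δ r (-t) (U t)).2.1) atTop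
        (𝓝 (P i z.2.1)) :=
      ((P i).continuous.comp (continuous_fst.comp continuous_snd)).continuousAt.tendsto.comp hz
    have l2 : Tendsto (fun t => Real.sqrt (lam i) • P i (ratePropagator P lam δ r (-t) (U t)).1)
        atTop (𝓝 (Real.sqrt (lam i) • P i z.1)) :=
      (((P i).continuous.comp continuous_fst).const_smul _).continuousAt.tendsto.comp hz
    refine tendsto_nhds_unique l1 (l2.congr' ?_)
    filter_upwards [eventually_ge_atTop 0] with t ht
    exact ((isCompatible_of_modal hU ht).ratePropagator hP hδ r (-t) i).symm
  · have l1 := ((ratePropagator P lam δ r 0).continuous.tendsto z).comp hz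
    refine tendsto_nhds_unique l1 (hz.congr' ?_)
    filter_upwards [eventually_ge_atTop 0] with t ht
    simp only [Function.comp_apply]
    rw [ratePropagator_ratePropagator hP hδ hlam (isCompatible_of_modal hU ht), zero_add]

/-- Let τ tend to infinity in the tail estimate based at t: S(t - τ)U(τ) = S(t)S(-τ)U(τ) tends to
S(t)z. -/
theorem ratePropagator_sub_isBigO (hP : IsResolution P) (hδ : 0 ≤ δ)
    (hlam : ∀ i, 0 ≤ lam i) (hU : IsModalSolution P lam δ 0 g U) (hg : ContinuousOn g (Ici 0))
    {γ : ℝ} (hγ : r < γ) (hgO : g =O[atTop] fun t => Real.exp (-(γ * t))) {z : H × H × H}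
    (hz : Tendsto (fun t => ratePropagator P lam δ r (-t) (U t)) atTop (𝓝 z)) :
    (fun t => ratePropagator P lam δ r 0 (U t) - ratePropagator P lam δ r t z) =O[atTop]
      fun t => Real.exp (-(γ * t)) := by
  obtain ⟨ρ, h1, h2⟩ := exists_between hγ
  obtain ⟨M, hM0, hM⟩ := norm_ratePropagator_le_of_gt (lam := lam) hP hδ h1
  obtain ⟨C, hC0, hb⟩ := hgO.exists_pos
  obtain ⟨T₀, hT₀⟩ := eventually_atTop.mp hb.bound
  set T := max 1 T₀ with hT
  have hC : ∀ t, T ≤ t → ‖g t‖ ≤ C * Real.exp (-(γ * t)) := fun t ht => by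
    simpa using hT₀ t ((le_max_right _ _).trans ht)
  have hTpos : 0 < T := one_pos.trans_le (le_max_left _ _)
  refine IsBigO.of_bound (M * C / (γ - ρ)) ?_
  filter_upwards [eventually_ge_atTop T] with t ht
  have hlim : Tendsto (fun τ => ‖ratePropagator P lam δ r (t - τ) (U τ) -
      ratePropagator P lam δ r 0 (U t)‖) atTop
      (𝓝 ‖ratePropagator P lam δ r t z - ratePropagator P lam δ r 0 (U t)‖) := by
    have l1 := ((ratePropagator P lam δ r t).continuous.tendsto z).comp hz
    refine ((l1.congr' ?_).sub_const _).norm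
    filter_upwards [eventually_ge_atTop 0] with τ hτ
    simp only [Function.comp_apply]
    rw [ratePropagator_ratePropagator hP hδ hlam (isCompatible_of_modal hU hτ), sub_eq_add_neg]
  rw [norm_sub_rev, Real.norm_of_nonneg (Real.exp_nonneg _)]
  refine le_of_tendsto hlim ?_
  filter_upwards [eventually_ge_atTop t] with τ hτ
  have := norm_sub_ratePropagator_le_exp hP hδ hlam hU hg h2 hM0.le hM hTpos hC0.le hC
      (t := t) ht le_rfl hτ
  rw [sub_self] at this
  refine this.trans (le_of_eq ?_)
  rw [← Real.exp_add]
  ring_nf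

/-- A solution of a superlinear inequality that decays faster than a certain exponential
vanishes. -/
theorem exists_rate_forall_eq_zero (hP : IsResolution P) (hδ : 0 ≤ δ)
    (hlam : ∀ i, 0 ≤ lam i) (hU : IsModalSolution P lam δ 0 g U) (hg : ContinuousOn g (Ici 0))
    (D : Finset ℝ) (hD : ∀ r i, Selects lam δ r i → r ∈ D) {K : ℝ} (hK0 : 0 ≤ K)
    (hK : ∀ t, 0 < t → ‖g t‖ ≤ K * ‖U t‖) :
    ∃ η, ∀ Φ, (∀ t, 0 < t → ‖U t‖ ≤ Φ * Real.exp (-(η * t))) → ∀ t, 0 < t → U t = 0 := by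
  obtain ⟨κ, hκ⟩ : ∃ κ, ∀ r ∈ D, r < κ := by
    obtain ⟨b, hb⟩ := D.bddAbove
    exact ⟨b + 1, fun r hr => (hb hr).trans_lt (by linarith)⟩
  have hex : ∀ r : ℝ, ∃ M, 0 < M ∧ (r ∈ D → ∀ t, t ≤ 0 → ∀ y,
      ‖ratePropagator P lam δ r t y‖ ≤ M * Real.exp (-(κ * t)) * ‖y‖) := by
    intro r
    by_cases hr : r ∈ D
    · obtain ⟨M, h1, h2⟩ := norm_ratePropagator_le_of_gt (P := P) (lam := lam) hP hδ (hκ r hr)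
      exact ⟨M, h1, fun _ => h2⟩
    · exact ⟨1, one_pos, fun h => absurd h hr⟩
  choose M hM0 hM using hex
  set S := ∑ r ∈ D, M r with hS
  have hS0 : 0 ≤ S := Finset.sum_nonneg fun r _ => (hM0 r).le
  -- κ exceeds all rates, and η is so large that integration from infinity costs a factor SK/(η - κ)
  -- ≤ 1/2. Any bound Φe^{-ηt} can therefore be halved repeatedly.
  set η := κ + (2 * S * K + 1) with hη
  have hpos : 0 < 2 * S * K + 1 := by positivity
  have hηκ : η - κ = 2 * S * K + 1 := by rw [hη]; ring
  have hhalf : ∀ Φ, (∀ t, 0 < t → ‖U t‖ ≤ Φ * Real.exp (-(η * t))) →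
      ∀ t, 0 < t → ‖U t‖ ≤ Φ / 2 * Real.exp (-(η * t)) := by
    intro Φ hΦ s hs
    have hΦ0 : 0 ≤ Φ := by
      have := (norm_nonneg _).trans (hΦ s hs)
      exact nonneg_of_mul_nonneg_left this (Real.exp_pos _)
    have hcomp : ∀ r ∈ D, ‖ratePropagator P lam δ r 0 (U s)‖ ≤
        M r * (K * Φ) / (η - κ) * Real.exp (-(η * s)) := by
      intro r hr
      -- The first term bounds the contribution of the endpoint τ; it vanishes in the limit because
      -- η > κ.
      have hlim : Tendsto (fun τ => M r * Φ * Real.exp (-(κ * s)) * Real.exp (-((η - κ) * τ)) +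
          M r * (K * Φ) / (η - κ) * Real.exp (-(η * s))) atTop
          (𝓝 (M r * (K * Φ) / (η - κ) * Real.exp (-(η * s)))) := by
        have : Tendsto (fun s => Real.exp (-((η - κ) * s))) atTop (𝓝 0) :=
          Real.tendsto_exp_neg_atTop_nhds_zero.comp (tendsto_id.const_mul_atTop (hηκ ▸ hpos))
        simpa using (this.const_mul (M r * Φ * Real.exp (-(κ * s)))).add_const
          (M r * (K * Φ) / (η - κ) * Real.exp (-(η * s)))
      refine ge_of_tendsto hlim ?_
      filter_upwards [eventually_ge_atTop s] with τ hτ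
      have h1 := norm_sub_ratePropagator_le_exp hP hδ hlam hU hg (γ := η) (ρ := κ)
        (C := K * Φ) (by linarith) (hM0 r).le (hM r hr) hs (by positivity) (fun t ht => by
          have ht0 := hs.trans_le ht
          calc ‖g t‖ ≤ K * ‖U t‖ := hK t ht0
            _ ≤ K * (Φ * Real.exp (-(η * t))) := by gcongr; exact hΦ t ht0
            _ = _ := by ring) (t := s) le_rfl le_rfl hτ
      rw [sub_self] at h1
      have h2 : ‖ratePropagator P lam δ r (s - τ) (U τ)‖ ≤
          M r * Φ * Real.exp (-(κ * s)) * Real.exp (-((η - κ) * τ)) := by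
        calc _ ≤ M r * Real.exp (-(κ * (s - τ))) * ‖U τ‖ := hM r hr _ (by linarith) _
          _ ≤ M r * Real.exp (-(κ * (s - τ))) * (Φ * Real.exp (-(η * τ))) := by
            have := (hM0 r).le
            gcongr
            exact hΦ τ (hs.trans_le hτ)
          _ = M r * Φ * (Real.exp (-(κ * (s - τ))) * Real.exp (-(η * τ))) := by ring
          _ = M r * Φ * (Real.exp (-(κ * s)) * Real.exp (-((η - κ) * τ))) := by
            rw [← Real.exp_add, ← Real.exp_add]; ring_nf
          _ = _ := by ring
      have h3 : Real.exp (-(κ * s)) * Real.exp (-((η - κ) * s)) = Real.exp (-(η * s)) := by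
        rw [← Real.exp_add]; ring_nf
      rw [h3] at h1
      calc _ = ‖ratePropagator P lam δ r (s - τ) (U τ) -
            (ratePropagator P lam δ r (s - τ) (U τ) - ratePropagator P lam δ r 0 (U s))‖ := by
            rw [sub_sub_cancel]
        _ ≤ _ := (norm_sub_le _ _).trans (add_le_add h2 h1)
    calc ‖U s‖ = ‖∑ r ∈ D, ratePropagator P lam δ r 0 (U s)‖ := by
          rw [sum_ratePropagator_zero hP hδ D hD]
      _ ≤ ∑ r ∈ D, M r * (K * Φ) / (η - κ) * Real.exp (-(η * s)) :=
          norm_sum_le_of_le _ hcomp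
      _ = S * (K * Φ) / (η - κ) * Real.exp (-(η * s)) := by
          rw [hS, Finset.sum_mul, Finset.sum_div, Finset.sum_mul]
      _ ≤ Φ / 2 * Real.exp (-(η * s)) := by
          refine mul_le_mul_of_nonneg_right ?_ (Real.exp_nonneg _)
          rw [hηκ, div_le_div_iff₀ hpos two_pos]
          nlinarith
  refine ⟨η, fun Φ hΦ t ht => ?_⟩
  have hn : ∀ n : ℕ, ∀ t, 0 < t → ‖U t‖ ≤ Φ * (1 / 2) ^ n * Real.exp (-(η * t)) := by
    intro n
    induction n with
    | zero => simpa using hΦ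
    | succ n ih =>
      intro t ht
      refine (hhalf _ ih t ht).trans (le_of_eq ?_)
      ring
  have hlim : Tendsto (fun n : ℕ => Φ * (1 / 2 : ℝ) ^ n * Real.exp (-(η * t))) atTop (𝓝 0) := by
    have := tendsto_pow_atTop_nhds_zero_of_lt_one (r := (1 / 2 : ℝ)) (by norm_num) (by norm_num)
    simpa using (this.const_mul Φ).mul_const (Real.exp (-(η * t)))
  have := ge_of_tendsto' hlim fun n => hn n t ht
  exact norm_le_zero_iff.mp this

end LinearEstimates

/-! ### Nonlinear part: slow or exponential, and exponential profiles. -/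

section SlowFast

variable {H ι : Type*} [NormedAddCommGroup H] [InnerProductSpace ℝ H] [CompleteSpace H]
  {P : ι → H →L[ℝ] H} {lam : ι → ℝ} {δ : ℝ} {g : ℝ → H} {U : ℝ → H × H × H} {r : ℝ}

theorem exists_gt_forall_lt (D : Finset ℝ) {θ b : ℝ} (h : θ < b) :
    ∃ γ, θ < γ ∧ γ < b ∧ ∀ r ∈ D, θ < r → γ < r := by
  induction D using Finset.induction_on with
  | empty =>
    obtain ⟨γ, h1, h2⟩ := exists_between h
    exact ⟨γ, h1, h2, by simp⟩
  | insert a D _ ih =>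
    obtain ⟨γ, h1, h2, h3⟩ := ih
    by_cases ha : θ < a
    · obtain ⟨γ', h4, h5⟩ := exists_between (lt_min h1 ha)
      have h6 := h5.trans_le (min_le_left _ _)
      refine ⟨γ', h4, h6.trans h2, fun r hr hθ => ?_⟩
      rcases Finset.mem_insert.mp hr with rfl | hr
      · exact h5.trans_le (min_le_right _ _)
      · exact h6.trans (h3 r hr hθ)
    · refine ⟨γ, h1, h2, fun r hr hθ => ?_⟩
      rcases Finset.mem_insert.mp hr with rfl | hr
      · exact absurd hθ ha
      · exact h3 r hr hθ

theorem Selects.nonneg (hδ : 0 < δ) (hlam : ∀ i, 0 ≤ lam i) {i : ι} (h : Selects lam δ r i) :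
    0 ≤ r := by
  rcases h with ⟨rfl, -⟩ | ⟨-, h⟩
  · exact hδ.le
  · have := hlam i
    rw [h] at this
    by_contra hr
    push Not at hr
    nlinarith

/-- Rate 0 selects only λ = 0, where the flow is constant, so the neutral component changes only
through the forcing. -/
theorem ratePropagator_rate_zero (P : ι → H →L[ℝ] H) (lam : ι → ℝ) (hδ : 0 < δ) (t : ℝ) :
    ratePropagator P lam δ 0 t = ratePropagator P lam δ 0 0 := by
  have h1 : ∀ i, rateKernel lam δ 0 i t = rateKernel lam δ 0 i 0 := fun i => by
    simp [rateKernel, hδ.ne]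
  have h2 : ∀ i, rateKernelDeriv lam δ 0 i t = rateKernelDeriv lam δ 0 i 0 := fun i => by
    simp [rateKernelDeriv, hδ.ne]
  simp only [ratePropagator, propagator, h1, h2]

/-- On ker A the factor √λ vanishes and the kernel of rate 0 has zero derivative. Hence A^{1/2}u and
u' belong wholly to the stable part. -/
theorem ratePropagator_rate_zero_snd (hP : IsResolution P) (hδ : 0 < δ) {y : H × H × H}
    (hy : IsCompatible P lam y) :
    (ratePropagator P lam δ 0 0 y).2 = 0 := by
  have hK := (exists_isKernel_rate lam hδ.le 0).choose_spec
  have hd : ∀ i, rateKernelDeriv lam δ 0 i 0 = 0 := fun i => by simp [rateKernelDeriv, hδ.ne]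
  have hl : ∀ i, Real.sqrt (lam i) * rateKernel lam δ 0 i 0 = 0 := fun i => by
    by_cases h : Selects lam δ 0 i
    · rcases h with ⟨h, -⟩ | ⟨-, h⟩
      · exact absurd h hδ.ne
      · simp [h]
    · rw [rateKernel_of_not h, mul_zero]
  refine Prod.ext (hP.total _ fun i => ?_) (hP.total _ fun i => ?_)
  · have h := hy.ratePropagator hP hδ.le 0 0 i
    rw [h, ratePropagator, hK.proj_fst hP hδ.le, hd, zero_add, smul_add, smul_smul, smul_smul,
      hl, mul_left_comm, hl]
    simp
  · rw [ratePropagator, hK.proj_thd hP, hd, hl]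
    simp

theorem add_rpow_le {x y s : ℝ} (hx : 0 ≤ x) (hy : 0 ≤ y) (hs : 0 ≤ s) :
    (x + y) ^ s ≤ 2 ^ s * (x ^ s + y ^ s) := by
  have h1 : x + y ≤ 2 * max x y := by
    rw [two_mul]; exact add_le_add (le_max_left _ _) (le_max_right _ _)
  calc (x + y) ^ s ≤ (2 * max x y) ^ s := by gcongr
    _ = 2 ^ s * (max x y) ^ s := Real.mul_rpow (by norm_num) (hx.trans (le_max_left _ _))
    _ ≤ _ := by
      gcongr
      rcases max_cases x y with ⟨h, -⟩ | ⟨h, -⟩ <;> rw [h]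
      · exact le_add_of_nonneg_right (by positivity)
      · exact le_add_of_nonneg_left (by positivity)

theorem tendsto_rpow_zero {f : ℝ → ℝ} {s : ℝ} (hs : 0 < s) (hf : Tendsto f atTop (𝓝 0)) :
    Tendsto (fun t => f t ^ s) atTop (𝓝 0) := by
  have := hf.rpow_const (p := s) (Or.inr hs.le)
  simpa [Real.zero_rpow hs.ne'] using this

/-- A decaying solution of the nonlinear inequality is either slow or decays exponentially. -/
theorem slow_or_exponential (hP : IsResolution P) (hδ : 0 < δ)
    (hlam : ∀ i, 0 ≤ lam i) (hU : IsModalSolution P lam δ 0 g U) (hg : ContinuousOn g (Ici 0))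
    (D : Finset ℝ) (hD : ∀ r, r ∈ D ↔ ∃ i, Selects lam δ r i) {K₀ p q : ℝ} (hK₀ : 0 ≤ K₀)
    (hp : 0 < p) (hq : 0 < q)
    (hnl : ∀ t, 0 ≤ t → ‖g t‖ ≤ K₀ * (‖(U t).1‖ ^ (1 + p) + ‖(U t).2.1‖ ^ (1 + q)))
    (hlim1 : Tendsto (fun t => ‖(U t).1‖) atTop (𝓝 0))
    (hlim2 : Tendsto (fun t => ‖(U t).2.1‖) atTop (𝓝 0)) :
    (∃ c M : ℝ, 0 < c ∧ 0 < M ∧ ∀ᶠ t in atTop, c / (1 + t) ^ (1 / p) ≤ ‖(U t).1‖ ∧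
      ‖(U t).2.2‖ + ‖(U t).2.1‖ ≤ M * ‖(U t).1‖ ^ (1 + p)) ∨
    ∃ η : ℝ, 0 < η ∧ U =O[atTop] fun t => Real.exp (-(η * t)) := by
  have hD' : ∀ r i, Selects lam δ r i → r ∈ D := fun r i h => (hD r).mpr ⟨i, h⟩
  -- ν is positive and below every positive rate; the bound 1 is arbitrary.
  obtain ⟨ν, hν, -, hνD⟩ := exists_gt_forall_lt D (one_pos (α := ℝ))
  have hνD' : ∀ r ∈ D, r ≠ 0 → ν < r := fun r hr h0 => by
    obtain ⟨i, hi⟩ := (hD r).mp hr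
    exact hνD r hr (lt_of_le_of_ne (hi.nonneg hδ hlam) h0.symm)
  set R := majorant g ν (Real.exp ν * ‖U 1‖) with hRdef
  have hR0 : ∀ t, 1 ≤ t → 0 ≤ R t := fun t ht => majorant_nonneg g ν (by positivity) ht
  have hRd : ∀ t, 1 ≤ t → HasDerivAt R (-ν * R t + ‖g t‖) t := fun t ht =>
    hasDerivAt_majorant hg ν _ (one_pos.trans_le ht)
  have hgl : Tendsto (fun t => ‖g t‖) atTop (𝓝 0) := by
    have h1 := (tendsto_rpow_zero (s := 1 + p) (by positivity) hlim1).add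
      (tendsto_rpow_zero (s := 1 + q) (by positivity) hlim2)
    have h2 := h1.const_mul K₀
    rw [add_zero, mul_zero] at h2
    refine squeeze_zero' (Eventually.of_forall fun t => norm_nonneg _) ?_ h2
    filter_upwards [eventually_ge_atTop 0] with t ht using hnl t ht
  have hRl : Tendsto R atTop (𝓝 0) := tendsto_zero_of_deriv_eq hν hRd hR0 hgl
  obtain ⟨M, hM0, hM⟩ : ∃ M, 0 < M ∧ ∀ t, 1 ≤ t →
      ‖U t - ratePropagator P lam δ 0 0 (U t)‖ ≤ M * R t := by
    have hex : ∀ r : ℝ, ∃ M, 0 < M ∧ (r ∈ D.erase 0 → ∀ t, 1 ≤ t →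
        ‖ratePropagator P lam δ r 0 (U t)‖ ≤ M * R t) := by
      intro r
      by_cases hr : r ∈ D.erase 0
      · obtain ⟨M, h1, h2⟩ := norm_ratePropagator_le_majorant hP hδ.le hlam hU hg
          (hνD' r (Finset.mem_of_mem_erase hr) (Finset.ne_of_mem_erase hr))
        exact ⟨M, h1, fun _ => h2⟩
      · exact ⟨1, one_pos, fun h => absurd h hr⟩
    choose M hM0 hM using hex
    refine ⟨∑ r ∈ D.erase 0, M r + 1,
      add_pos_of_nonneg_of_pos (Finset.sum_nonneg fun r _ => (hM0 r).le) one_pos, fun t ht => ?_⟩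
    rw [sub_ratePropagator_eq_sum hP hδ.le D hD']
    refine (norm_sum_le_of_le _ fun r hr => hM r hr t ht).trans ?_
    rw [← Finset.sum_mul]
    gcongr
    · exact hR0 t ht
    · linarith
  set a : ℝ → H := fun t => (ratePropagator P lam δ 0 0 (U t)).1 with hadef
  have hrest : ∀ t, 1 ≤ t → ‖(U t).1 - a t‖ ≤ M * R t ∧ ‖(U t).2.1‖ ≤ M * R t ∧
      ‖(U t).2.2‖ ≤ M * R t := by
    intro t ht
    have h1 := hM t ht
    have h2 := ratePropagator_rate_zero_snd hP hδ
      (isCompatible_of_modal hU (one_pos.le.trans ht))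
    have h3 : (U t - ratePropagator P lam δ 0 0 (U t)).2 = (U t).2 := by
      rw [Prod.snd_sub, h2, sub_zero]
    refine ⟨(norm_fst_le _).trans h1, ?_, ?_⟩
    · rw [← h3]; exact (norm_fst_le _).trans ((norm_snd_le _).trans h1)
    · rw [← h3]; exact (norm_snd_le _).trans ((norm_snd_le _).trans h1)
  have hUa : ∀ t, 1 ≤ t → ‖(U t).1‖ ≤ ‖a t‖ + M * R t := by
    intro t ht
    have h1 := (hrest t ht).1
    have h2 : ‖(U t).1‖ ≤ ‖a t‖ + ‖(U t).1 - a t‖ := norm_le_norm_add_norm_sub' _ _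
    linarith
  set a' : ℝ → H := fun t => (ratePropagator P lam δ 0 0 (0, 0, g t)).1 with ha'def
  have had : ∀ t, 1 ≤ t → HasDerivAt a (a' t) t := by
    intro t ht
    have h1 := hasDerivAt_ratePropagator hP hδ.le hlam hU hg 0 0 (one_pos.trans_le ht)
    simp only [ratePropagator_rate_zero P lam hδ (0 - _)] at h1
    exact (ContinuousLinearMap.fst ℝ H (H × H)).hasFDerivAt.comp_hasDerivAt t h1
  obtain ⟨M', hM'0, hM'⟩ := norm_ratePropagator_le (lam := lam) hP hδ.le 0
  have ha'b : ∀ t, ‖a' t‖ ≤ M' * ‖g t‖ := by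
    intro t
    have h1 := hM' 0 (0, 0, g t)
    rw [norm_triple] at h1
    simpa using (norm_fst_le _).trans h1
  have hal : Tendsto a atTop (𝓝 0) := by
    have h1 : Tendsto (fun t => ‖(U t).1‖ + M * R t) atTop (𝓝 0) := by
      simpa using hlim1.add (hRl.const_mul M)
    refine squeeze_zero_norm' ?_ h1
    filter_upwards [eventually_ge_atTop 1] with t ht
    have h2 : ‖a t‖ ≤ ‖(U t).1‖ + ‖(U t).1 - a t‖ := norm_le_norm_add_norm_sub _ _
    linarith [(hrest t ht).1]
  set K := K₀ * 2 ^ (1 + p) with hKdef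
  have hK0 : 0 ≤ K := by positivity
  -- Every contribution of R to the nonlinearity is superlinear, so for large t it costs at most
  -- half of the damping; this is why ν/2 appears below.
  have hgb : ∀ᶠ t in atTop, ‖g t‖ ≤ K * ‖a t‖ ^ (1 + p) + ν / 2 * R t := by
    have h1 : Tendsto (fun t => K * M * (M * R t) ^ p + K₀ * M * (M * R t) ^ q) atTop (𝓝 0) := by
      have h2 : Tendsto (fun t => M * R t) atTop (𝓝 0) := by simpa using hRl.const_mul M
      simpa using ((tendsto_rpow_zero hp h2).const_mul (K * M)).add
        ((tendsto_rpow_zero hq h2).const_mul (K₀ * M))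
    filter_upwards [h1.eventually (gt_mem_nhds (half_pos hν)), eventually_ge_atTop 1] with t ht ht1
    have hR := hR0 t ht1
    have hMR : 0 ≤ M * R t := by positivity
    have e : ∀ s : ℝ, 0 < s → (M * R t) ^ (1 + s) = M * R t * (M * R t) ^ s := fun s hs => by
      rw [Real.rpow_add_of_nonneg hMR one_pos.le hs.le, Real.rpow_one]
    calc ‖g t‖ ≤ K₀ * (‖(U t).1‖ ^ (1 + p) + ‖(U t).2.1‖ ^ (1 + q)) := hnl t (one_pos.le.trans ht1)
      _ ≤ K₀ * ((‖a t‖ + M * R t) ^ (1 + p) + (M * R t) ^ (1 + q)) := by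
          gcongr
          · exact hUa t ht1
          · exact (hrest t ht1).2.1
      _ ≤ K₀ * (2 ^ (1 + p) * (‖a t‖ ^ (1 + p) + (M * R t) ^ (1 + p)) + (M * R t) ^ (1 + q)) := by
          gcongr
          exact add_rpow_le (norm_nonneg _) hMR (by positivity)
      _ = K * ‖a t‖ ^ (1 + p) + (K * M * (M * R t) ^ p + K₀ * M * (M * R t) ^ q) * R t := by
          rw [e p hp, e q hq, hKdef]; ring
      _ ≤ _ := by gcongr
  -- One constant for both hypotheses of the dichotomy, the bound on a' and the inequality for R'.
  set C := M' * (K + ν / 2) + K + 1 with hCdef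
  have hC0 : 0 < C := by positivity
  have hKC : K ≤ C := by
    have : 0 ≤ M' * (K + ν / 2) := by positivity
    linarith
  have hdich := neutral_stable_dichotomy (a := a) (a' := a') (R := R)
    (R' := fun t => -ν * R t + ‖g t‖) (ν := ν / 2) hp (half_pos hν) hC0
    ((eventually_ge_atTop 1).mono had) ((eventually_ge_atTop 1).mono hRd) ?_ ?_ hal
  rotate_left
  · filter_upwards [hgb, eventually_ge_atTop 1] with t ht ht1
    have hR := hR0 t ht1
    have hx : 0 ≤ ‖a t‖ ^ (1 + p) := by positivity
    calc ‖a' t‖ ≤ M' * ‖g t‖ := ha'b t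
      _ ≤ M' * (K * ‖a t‖ ^ (1 + p) + ν / 2 * R t) := by gcongr
      _ ≤ M' * ((K + ν / 2) * ‖a t‖ ^ (1 + p) + (K + ν / 2) * R t) := by
          gcongr <;> linarith
      _ = M' * (K + ν / 2) * (‖a t‖ ^ (1 + p) + R t) := by ring
      _ ≤ _ := by gcongr; linarith
  · filter_upwards [hgb, eventually_ge_atTop 1] with t ht ht1
    have hx : K * ‖a t‖ ^ (1 + p) ≤ C * ‖a t‖ ^ (1 + p) := by gcongr
    linarith
  set N := 2 * C / (ν / 2) with hN
  have hN0 : 0 < N := by positivity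
  rcases hdich with hslow | hfast
  · left
    obtain ⟨c, hc, hlow⟩ := polynomial_lower_bound (a := a) (a' := a') hp
      (C := M' * (K + ν / 2 * N) + 1) (by positivity)
      ((eventually_ge_atTop 1).mono had) (hslow.mono fun t ht => ht.1) (by
        filter_upwards [hgb, hslow] with t ht hs
        have hx : 0 ≤ ‖a t‖ ^ (1 + p) := by positivity
        calc ‖a' t‖ ≤ M' * ‖g t‖ := ha'b t
          _ ≤ M' * (K * ‖a t‖ ^ (1 + p) + ν / 2 * (N * ‖a t‖ ^ (1 + p))) := by
              gcongr
              refine ht.trans ?_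
              gcongr
              exact hs.2
          _ ≤ _ := by nlinarith)
    -- The stable part is of order ‖a‖^{1+p}, eventually at most ‖a‖/2, so a may be replaced by u up
    -- to a factor 2.
    have hsmall : ∀ᶠ t in atTop, M * N * ‖a t‖ ^ p < 1 / 2 := by
      have h0 : Tendsto (fun t => ‖a t‖) atTop (𝓝 0) := by simpa using hal.norm
      have h1 : Tendsto (fun t => M * N * ‖a t‖ ^ p) atTop (𝓝 0) := by
        simpa using (tendsto_rpow_zero hp h0).const_mul (M * N)
      exact h1.eventually (gt_mem_nhds (by norm_num))
    refine ⟨c / 2, 2 * M * N * 2 ^ (1 + p), by positivity, by positivity, ?_⟩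
    filter_upwards [hslow, hlow, hsmall, eventually_ge_atTop 1] with t hs hl hsm ht1
    have hx : 0 < ‖a t‖ := norm_pos_iff.mpr hs.1
    have e : ‖a t‖ ^ (1 + p) = ‖a t‖ * ‖a t‖ ^ p := by
      rw [Real.rpow_add hx, Real.rpow_one]
    have hMR : M * R t ≤ M * N * ‖a t‖ ^ (1 + p) := by
      rw [mul_assoc]; gcongr; exact hs.2
    have hhalf : M * N * ‖a t‖ ^ (1 + p) ≤ ‖a t‖ / 2 := by
      rw [e]; nlinarith
    have hu : ‖a t‖ ≤ 2 * ‖(U t).1‖ := by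
      have h2 : ‖a t‖ ≤ ‖(U t).1‖ + ‖(U t).1 - a t‖ := norm_le_norm_add_norm_sub _ _
      linarith [(hrest t ht1).1]
    constructor
    · rw [div_right_comm]; linarith
    · calc ‖(U t).2.2‖ + ‖(U t).2.1‖ ≤ M * R t + M * R t :=
            add_le_add (hrest t ht1).2.2 (hrest t ht1).2.1
        _ ≤ 2 * M * N * ‖a t‖ ^ (1 + p) := by linarith
        _ ≤ 2 * M * N * (2 * ‖(U t).1‖) ^ (1 + p) := by gcongr
        _ = _ := by rw [Real.mul_rpow (by norm_num) (norm_nonneg _)]; ring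
  · right
    obtain ⟨T₀, hT₀⟩ := eventually_atTop.mp (hfast.and hgb)
    set T := max 1 T₀ with hT
    have hRdec : ∀ t, T ≤ t →
        R t ≤ Real.exp (ν / 4 * T) * R T * Real.exp (-(ν / 4 * t)) := fun t ht => by
      refine exp_decay_of_deriv_le (fun s hs => hRd s ((le_max_left _ _).trans hs))
        (fun s hs => ?_) ht
      obtain ⟨h1, h2⟩ := hT₀ s ((le_max_right _ _).trans hs)
      -- With N = 4C/ν the neutral part of the forcing costs ν/4 and the stable part ν/2; a damping
      -- ν/4 remains.
      have h3 : K * ‖a s‖ ^ (1 + p) ≤ ν / 4 * R s := by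
        calc K * ‖a s‖ ^ (1 + p) ≤ C * ‖a s‖ ^ (1 + p) := by gcongr
          _ = ν / 4 * (N * ‖a s‖ ^ (1 + p)) := by rw [hN]; field_simp; ring
          _ ≤ _ := by gcongr
      linarith
    set Q := Real.exp (ν / 4 * T) * R T with hQ
    have hQ0 : 0 ≤ Q := mul_nonneg (Real.exp_nonneg _) (hR0 T (le_max_left _ _))
    -- The neutral part is controlled only through ‖a‖^{1+p} ≤ R/N, hence the loss of a factor 1 + p
    -- in the exponent.
    set η := ν / 4 * (1 / (1 + p)) with hη
    have hη0 : 0 < η := by positivity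
    have hηle : η ≤ ν / 4 := by
      have : 1 / (1 + p) ≤ 1 := by rw [div_le_one (by positivity)]; linarith
      calc η ≤ ν / 4 * 1 := by rw [hη]; gcongr
        _ = _ := mul_one _
    refine ⟨η, hη0, IsBigO.of_bound ((Q / N) ^ (1 / (1 + p)) + M * Q) ?_⟩
    filter_upwards [eventually_ge_atTop T] with t ht
    have ht1 : 1 ≤ t := (le_max_left _ _).trans ht
    have h1 := hRdec t ht
    have h2 : ‖a t‖ ^ (1 + p) ≤ Q / N * Real.exp (-(ν / 4 * t)) := by
      rw [div_mul_eq_mul_div, le_div_iff₀ hN0]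
      linarith [(hT₀ t ((le_max_right _ _).trans ht)).1]
    have h3 : ‖a t‖ ≤ (Q / N) ^ (1 / (1 + p)) * Real.exp (-(η * t)) := by
      have h4 := Real.rpow_le_rpow (by positivity) h2 (z := 1 / (1 + p)) (by positivity)
      rw [← Real.rpow_mul (norm_nonneg _), mul_one_div_cancel (by positivity), Real.rpow_one,
        Real.mul_rpow (by positivity) (Real.exp_nonneg _), ← Real.exp_mul] at h4
      refine h4.trans (le_of_eq ?_)
      rw [hη]; ring_nf
    have h5 : ‖ratePropagator P lam δ 0 0 (U t)‖ = ‖a t‖ := by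
      have h6 := ratePropagator_rate_zero_snd hP hδ
        (isCompatible_of_modal hU (one_pos.le.trans ht1))
      rw [Prod.norm_def, h6, norm_zero, max_eq_left (norm_nonneg _)]
    have h7 : Real.exp (-(ν / 4 * t)) ≤ Real.exp (-(η * t)) := by gcongr
    rw [Real.norm_of_nonneg (Real.exp_nonneg _)]
    calc ‖U t‖ ≤ ‖ratePropagator P lam δ 0 0 (U t)‖ + ‖U t - ratePropagator P lam δ 0 0 (U t)‖ :=
          norm_le_norm_add_norm_sub' _ _
      _ ≤ (Q / N) ^ (1 / (1 + p)) * Real.exp (-(η * t)) + M * (Q * Real.exp (-(η * t))) := by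
          rw [h5]
          refine add_le_add h3 ((hM t ht1).trans ?_)
          gcongr
          exact h1.trans (by gcongr)
      _ = _ := by ring

theorem exists_global_exp_bound (hU : ContinuousOn U (Ici 0)) {η : ℝ}
    (hO : U =O[atTop] fun t => Real.exp (-(η * t))) :
    ∃ Φ, 0 < Φ ∧ ∀ t, 0 ≤ t → ‖U t‖ ≤ Φ * Real.exp (-(η * t)) := by
  obtain ⟨C, hC, hb⟩ := hO.exists_pos
  obtain ⟨T, hT⟩ := eventually_atTop.mp hb.bound
  have hcont : ContinuousOn (fun t => ‖U t‖ * Real.exp (η * t)) (Icc 0 T) :=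
    (hU.mono Icc_subset_Ici_self).norm.mul (Continuous.continuousOn (by fun_prop))
  obtain ⟨B, hB⟩ := isCompact_Icc.exists_bound_of_continuousOn hcont
  refine ⟨max B C, lt_max_of_lt_right hC, fun t ht => ?_⟩
  rcases le_total t T with h | h
  · have h1 := hB t ⟨ht, h⟩
    rw [Real.norm_of_nonneg (by positivity)] at h1
    calc ‖U t‖ = ‖U t‖ * Real.exp (η * t) * Real.exp (-(η * t)) := by
          rw [mul_assoc, ← Real.exp_add]; simp
      _ ≤ _ := by gcongr; exact h1.trans (le_max_left _ _)
  · have h1 := hT t h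
    rw [Real.norm_of_nonneg (Real.exp_nonneg _)] at h1
    exact h1.trans (by gcongr; exact le_max_right _ _)

/-- The nonlinearity improves the decay rate. -/
theorem forcing_isBigO {K₀ p q : ℝ} (hK₀ : 0 ≤ K₀) (hp : 0 < p) (hq : 0 < q)
    (hnl : ∀ t, 0 ≤ t → ‖g t‖ ≤ K₀ * (‖(U t).1‖ ^ (1 + p) + ‖(U t).2.1‖ ^ (1 + q))) {η γ : ℝ}
    (hγp : γ ≤ (1 + p) * η) (hγq : γ ≤ (1 + q) * η)
    (hO : U =O[atTop] fun t => Real.exp (-(η * t))) :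
    g =O[atTop] fun t => Real.exp (-(γ * t)) := by
  obtain ⟨C, hC, hb⟩ := hO.exists_pos
  refine IsBigO.of_bound (K₀ * (C ^ (1 + p) + C ^ (1 + q))) ?_
  filter_upwards [hb.bound, eventually_ge_atTop 0] with t ht ht0
  rw [Real.norm_of_nonneg (Real.exp_nonneg _)] at ht ⊢
  have key : ∀ s x : ℝ, 0 < s → 0 ≤ x → x ≤ ‖U t‖ → γ ≤ (1 + s) * η →
      x ^ (1 + s) ≤ C ^ (1 + s) * Real.exp (-(γ * t)) := by
    intro s x hs hx hxU hγ
    calc x ^ (1 + s) ≤ (C * Real.exp (-(η * t))) ^ (1 + s) := by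
          gcongr; exact hxU.trans ht
      _ = C ^ (1 + s) * Real.exp (-((1 + s) * η * t)) := by
          rw [Real.mul_rpow hC.le (Real.exp_nonneg _), ← Real.exp_mul]; ring_nf
      _ ≤ _ := by gcongr
  refine (hnl t ht0).trans ?_
  rw [mul_assoc, add_mul]
  gcongr
  · exact key p _ hp (norm_nonneg _) (norm_fst_le _) hγp
  · exact key q _ hq (norm_nonneg _) ((norm_fst_le _).trans (norm_snd_le _)) hγq

/-- A nonzero exponentially decaying solution of the nonlinear inequality is fast. -/
theorem exists_profile (hP : IsResolution P) (hδ : 0 < δ)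
    (hlam : ∀ i, 0 ≤ lam i) (hU : IsModalSolution P lam δ 0 g U) (hg : ContinuousOn g (Ici 0))
    (D : Finset ℝ) (hD : ∀ r, r ∈ D ↔ ∃ i, Selects lam δ r i) {K₀ p q : ℝ} (hK₀ : 0 ≤ K₀)
    (hp : 0 < p) (hq : 0 < q)
    (hnl : ∀ t, 0 ≤ t → ‖g t‖ ≤ K₀ * (‖(U t).1‖ ^ (1 + p) + ‖(U t).2.1‖ ^ (1 + q)))
    (hexp : ∃ η : ℝ, 0 < η ∧ U =O[atTop] fun t => Real.exp (-(η * t)))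
    (hne : ∃ t, 0 < t ∧ U t ≠ 0) :
    ∃ r₀ ∈ D, 0 < r₀ ∧ ∃ z, z ≠ 0 ∧ IsCompatible P lam z ∧ ratePropagator P lam δ r₀ 0 z = z ∧
      ∀ γ, (∀ r ∈ D, r₀ < r → γ < r) → γ < (1 + p) * r₀ → γ < (1 + q) * r₀ →
        (fun t => U t - ratePropagator P lam δ r₀ t z) =O[atTop] fun t => Real.exp (-(γ * t)) := by
  have hD' : ∀ r i, Selects lam δ r i → r ∈ D := fun r i h => (hD r).mpr ⟨i, h⟩
  obtain ⟨η₁, hη₁, hO₁⟩ := hexp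
  obtain ⟨B, hB0, hB⟩ := exists_global_exp_bound hU.cont hO₁
  have hUB : ∀ t, 0 < t → ‖U t‖ ≤ B := fun t ht => by
    refine (hB t ht.le).trans ?_
    have : Real.exp (-(η₁ * t)) ≤ 1 := Real.exp_le_one_iff.mpr (by rw [neg_nonpos]; positivity)
    calc B * Real.exp (-(η₁ * t)) ≤ B * 1 := by gcongr
      _ = B := mul_one B
  -- On a bounded trajectory the superlinear bound is a linear one, as the vanishing criterion
  -- needs.
  have hglin : ∀ t, 0 < t → ‖g t‖ ≤ K₀ * (B ^ p + B ^ q) * ‖U t‖ := by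
    intro t ht
    have key : ∀ s x : ℝ, 0 < s → 0 ≤ x → x ≤ ‖U t‖ → x ^ (1 + s) ≤ B ^ s * ‖U t‖ := by
      intro s x hs hx hxU
      rw [Real.rpow_add_of_nonneg hx one_pos.le hs.le, Real.rpow_one, mul_comm]
      gcongr
      exact hxU.trans (hUB t ht)
    refine (hnl t ht.le).trans ?_
    rw [mul_assoc, add_mul]
    gcongr
    · exact key p _ hp (norm_nonneg _) (norm_fst_le _)
    · exact key q _ hq (norm_nonneg _) ((norm_fst_le _).trans (norm_snd_le _))
  obtain ⟨η₂, hη₂⟩ := exists_rate_forall_eq_zero hP hδ.le hlam hU hg D hD' (by positivity) hglin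
  set Θ : Set ℝ := {η | U =O[atTop] fun t => Real.exp (-(η * t))} with hΘ
  have hbdd : BddAbove Θ := by
    refine ⟨η₂, fun η hη => ?_⟩
    by_contra hlt
    push Not at hlt
    obtain ⟨Φ, -, hΦ⟩ := exists_global_exp_bound hU.cont (isBigO_exp_of_le hlt.le hη)
    obtain ⟨t, ht, hUt⟩ := hne
    exact hUt (hη₂ Φ (fun s hs => hΦ s hs.le) t ht)
  have hΘne : Θ.Nonempty := ⟨η₁, hO₁⟩
  set θ := sSup Θ with hθ
  have hθpos : 0 < θ := hη₁.trans_le (le_csSup hbdd hO₁)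
  have hbelow : ∀ η, η < θ → U =O[atTop] fun t => Real.exp (-(η * t)) := by
    intro η hη
    obtain ⟨η', h1, h2⟩ := exists_lt_of_lt_csSup hΘne hη
    exact isBigO_exp_of_le h2.le h1
  set σ := min p q with hσ
  have hσ0 : 0 < σ := lt_min hp hq
  have hgO : ∀ γ, γ < (1 + σ) * θ → g =O[atTop] fun t => Real.exp (-(γ * t)) := by
    intro γ hγ
    have h1 : γ / (1 + σ) < θ := by rw [div_lt_iff₀ (by positivity)]; linarith
    obtain ⟨η, h2, h3⟩ := exists_between (max_lt h1 hθpos)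
    have hη0 : 0 < η := (le_max_right _ _).trans_lt h2
    have h4 : γ < (1 + σ) * η := by
      have := (le_max_left _ _).trans_lt h2
      rw [div_lt_iff₀ (by positivity)] at this
      linarith
    refine forcing_isBigO hK₀ hp hq hnl ?_ ?_ (hbelow η h3)
    · refine h4.le.trans ?_
      gcongr
      exact min_le_left _ _
    · refine h4.le.trans ?_
      gcongr
      exact min_le_right _ _
  -- The forcing beats the optimal rate of the solution, which leaves room for an asymptotic
  -- expansion at θ.
  have hθσ : θ < (1 + σ) * θ := by nlinarith
  obtain ⟨γ₁, hγ₁, hγ₁'⟩ := exists_between hθσ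
  obtain ⟨z, hzc, hz0, hz⟩ := exists_tendsto_ratePropagator hP hδ.le hlam hU hg hγ₁ (hgO γ₁ hγ₁')
  have hasym : ∀ γ, (∀ r ∈ D, θ < r → γ < r) → γ < (1 + σ) * θ →
      (fun t => U t - ratePropagator P lam δ θ t z) =O[atTop] fun t => Real.exp (-(γ * t)) := by
    intro γ hγD hγ
    obtain ⟨γ₂, hγ₂, hγ₂'⟩ := exists_between (max_lt hγ hθσ)
    have hγγ₂ : γ < γ₂ := (le_max_left _ _).trans_lt hγ₂
    have hθγ₂ : θ < γ₂ := (le_max_right _ _).trans_lt hγ₂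
    have e : (fun t => U t - ratePropagator P lam δ θ t z) = fun t =>
        (∑ s ∈ D.erase θ, ratePropagator P lam δ s 0 (U t)) +
          (ratePropagator P lam δ θ 0 (U t) - ratePropagator P lam δ θ t z) := by
      funext t
      rw [← sub_ratePropagator_eq_sum hP hδ.le D hD']
      abel
    rw [e]
    refine IsBigO.add (IsBigO.fun_sum fun s hs => ?_) ?_
    · have hsθ := Finset.ne_of_mem_erase hs
      rcases lt_or_gt_of_ne hsθ with hlt | hgt
      · obtain ⟨w, -, hw0, hw⟩ := exists_tendsto_ratePropagator hP hδ.le hlam hU hg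
          (hlt.trans hθγ₂) (hgO γ₂ hγ₂')
        -- U decays faster than e^{-st}, so pulling it back by S_s gives 0: a rate below θ leaves no
        -- profile.
        have hwz : w = 0 := by
          obtain ⟨ρ, h1, h2⟩ := exists_between hlt
          obtain ⟨η, h3, h4⟩ := exists_between h2
          obtain ⟨M, hM0, hM⟩ := norm_ratePropagator_le_of_gt (lam := lam) hP hδ.le h1
          obtain ⟨Φ, hΦ0, hΦ⟩ := exists_global_exp_bound hU.cont (hbelow η h4)
          refine tendsto_nhds_unique hw ?_
          have hlim : Tendsto (fun t => M * Φ * Real.exp (-((η - ρ) * t))) atTop (𝓝 0) := by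
            have : Tendsto (fun t => Real.exp (-((η - ρ) * t))) atTop (𝓝 0) :=
              Real.tendsto_exp_neg_atTop_nhds_zero.comp
                (tendsto_id.const_mul_atTop (sub_pos.mpr h3))
            simpa using this.const_mul (M * Φ)
          refine squeeze_zero_norm' ?_ hlim
          filter_upwards [eventually_ge_atTop 0] with t ht
          calc ‖ratePropagator P lam δ s (-t) (U t)‖ ≤ M * Real.exp (-(ρ * -t)) * ‖U t‖ :=
                hM _ (neg_nonpos.mpr ht) _
            _ ≤ M * Real.exp (-(ρ * -t)) * (Φ * Real.exp (-(η * t))) := by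
                gcongr; exact hΦ t ht
            _ = M * Φ * (Real.exp (-(ρ * -t)) * Real.exp (-(η * t))) := by ring
            _ = _ := by rw [← Real.exp_add]; ring_nf
        have h5 := ratePropagator_sub_isBigO hP hδ.le hlam hU hg (hlt.trans hθγ₂) (hgO γ₂ hγ₂') hw
        simp only [hwz, map_zero, sub_zero] at h5
        exact isBigO_exp_of_le hγγ₂.le h5
      · exact ratePropagator_isBigO_of_lt hP hδ.le hlam hU hg
          (hγD s (Finset.mem_of_mem_erase hs) hgt) (hgO γ hγ)
    · exact isBigO_exp_of_le hγγ₂.le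
        (ratePropagator_sub_isBigO hP hδ.le hlam hU hg hθγ₂ (hgO γ₂ hγ₂') hz)
  -- A zero profile would give U an exponent γ > θ, against the definition of θ.
  have hzne : z ≠ 0 := by
    intro h0
    obtain ⟨γ, h1, h2, h3⟩ := exists_gt_forall_lt D hθσ
    have h4 := hasym γ h3 h2
    simp only [h0, map_zero, sub_zero] at h4
    exact absurd (le_csSup hbdd h4) (not_le.mpr h1)
  refine ⟨θ, ?_, hθpos, z, hzne, hzc, hz0, fun γ h1 h2 h3 => hasym γ h1 ?_⟩
  -- If θ were not a rate, its projection would vanish and z with it.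
  · rw [hD]
    by_contra hcon
    push Not at hcon
    apply hzne
    rw [← hz0, ratePropagator_eq_zero hP hδ.le hcon]
  · rcases min_cases p q with ⟨h, -⟩ | ⟨h, -⟩
    · rw [hσ, h]; exact h2
    · rw [hσ, h]; exact h3

end SlowFast

/-! ### The set of decay rates of the operator. -/

section Operator

variable {H : Type*} [NormedAddCommGroup H] [InnerProductSpace ℝ H]
  {A : H →ₗ.[ℝ] H} {δ : ℝ}

theorem mem_decayRates_iff {r : ℝ} : r ∈ decayRates A δ ↔
    ∃ l : spec A, Selects (fun l : spec A => (l : ℝ)) δ r l := by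
  constructor
  · rintro ⟨l, hl, z, hz, rfl⟩
    refine ⟨⟨l, hl⟩, ?_⟩
    have hre := congrArg Complex.re hz
    have him := congrArg Complex.im hz
    simp [pow_two] at hre him
    -- The imaginary part of the equation: a root is real or has real part δ.
    have h1 : z.im * (z.re - δ) = 0 := by linarith
    rcases mul_eq_zero.mp h1 with h | h
    · rw [h] at hre
      by_cases hr : z.re = δ
      · left
        refine ⟨hr, ?_⟩
        rw [hr] at hre
        simp only
        nlinarith
      · right
        refine ⟨hr, ?_⟩
        simp only
        linarith
    · left
      have hr : z.re = δ := by linarith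
      refine ⟨hr, ?_⟩
      rw [hr] at hre
      simp only
      nlinarith [mul_self_nonneg z.im]
  · rintro ⟨⟨l, hl⟩, ⟨hr, h⟩ | ⟨hr, h⟩⟩
    · refine ⟨l, hl, ⟨δ, Real.sqrt (l - δ ^ 2)⟩, ?_, hr.symm⟩
      have hs : Real.sqrt (l - δ ^ 2) * Real.sqrt (l - δ ^ 2) = l - δ ^ 2 :=
        Real.mul_self_sqrt (sub_nonneg.mpr h)
      rw [pow_two δ] at hs
      apply Complex.ext
      · simp [pow_two]
        linarith
      · simp [pow_two]
        ring
    · refine ⟨l, hl, r, ?_, by simp⟩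
      simp only at h
      rw [h]
      push_cast
      ring

/-- A rate other than δ comes from an eigenvalue in the compact interval [0, δ²], which contains
finitely many because they do not accumulate. -/
theorem decayRates_finite (hnonneg : IsNonneg A) (hspec : HasDiscreteSpectrum A) :
    (decayRates A δ).Finite := by
  have hfin : (spec A ∩ Icc 0 (δ ^ 2)).Finite := by
    by_contra hinf
    obtain ⟨a, -, ha⟩ := Set.Infinite.exists_accPt_of_subset_isCompact hinf isCompact_Icc
      inter_subset_right
    exact hspec.2.2 a (ha.mono (principal_mono.mpr inter_subset_left))
  refine (((finite_singleton δ).union (hfin.image fun l => δ - Real.sqrt (δ ^ 2 - l))).union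
    (hfin.image fun l => δ + Real.sqrt (δ ^ 2 - l))).subset ?_
  intro r hr
  obtain ⟨l, hl⟩ := mem_decayRates_iff.mp hr
  rcases lt_or_ge (l : ℝ) (δ ^ 2) with h | h
  · have hmem : (l : ℝ) ∈ spec A ∩ Icc 0 (δ ^ 2) :=
      ⟨l.2, nonneg_of_mem_spec hnonneg hspec l.2, h.le⟩
    rcases (selects_iff_of_lt (lam := fun l : spec A => (l : ℝ)) l h).mp hl with rfl | rfl
    · exact Or.inl (Or.inr ⟨l, hmem, rfl⟩)
    · exact Or.inr ⟨l, hmem, rfl⟩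
  · exact Or.inl (Or.inl ((selects_iff_of_le (lam := fun l : spec A => (l : ℝ)) l h).mp hl))

theorem lt_of_coe_lt_nextRate {γ r₀ r : ℝ} (h : (γ : EReal) < nextRate A δ r₀)
    (hr : r ∈ decayRates A δ) (hr₀ : r₀ < r) : γ < r :=
  EReal.coe_lt_coe_iff.mp (h.trans_le (sInf_le ⟨r, ⟨hr, hr₀⟩, rfl⟩))

theorem exists_coe_lt_nextRate (D : Finset ℝ) (hD : ∀ r, r ∈ decayRates A δ → r ∈ D) {r₀ b : ℝ}
    (h : r₀ < b) : ∃ γ : ℝ, r₀ < γ ∧ γ < b ∧ (γ : EReal) < nextRate A δ r₀ := by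
  obtain ⟨γ', h1, h2, h3⟩ := exists_gt_forall_lt D h
  -- The extra step down from γ' keeps the inequality strict when passing to the infimum.
  obtain ⟨γ, h4, h5⟩ := exists_between h1
  refine ⟨γ, h4, h5.trans h2, (EReal.coe_lt_coe_iff.mpr h5).trans_le (le_sInf ?_)⟩
  rintro _ ⟨r, ⟨hr, hr₀⟩, rfl⟩
  exact EReal.coe_le_coe_iff.mpr (h3 r (hD r hr) hr₀).le

end Operator

/-! ### Homogeneous solutions and their components. -/

section Homogeneous

variable {H ι : Type*} [NormedAddCommGroup H] [InnerProductSpace ℝ H] [CompleteSpace H]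
  {P : ι → H →L[ℝ] H} {lam : ι → ℝ} {δ : ℝ} {V : ℝ → H × H × H}

/-- S_r(t - s)V(s) is constant in s. The integrated form reaches the endpoint s = 0, where no
derivative is available. -/
theorem homogeneous_ratePropagator_eq (hP : IsResolution P) (hδ : 0 ≤ δ) (hlam : ∀ i, 0 ≤ lam i)
    (hV : IsModalSolution P lam δ 0 (fun _ => 0) V) (r : ℝ) {t : ℝ} (ht : 0 ≤ t) :
    ratePropagator P lam δ r 0 (V t) = ratePropagator P lam δ r t (V 0) := by
  have h := sub_eq_integral_of_separating
    (fun _ : Unit => ContinuousLinearMap.id ℝ (H × H × H)) (fun x hx => hx ())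
    (f := fun s => ratePropagator P lam δ r (t - s) (V s)) (F := fun _ => 0) ht
    (((exists_isKernel_rate lam hδ r).choose_spec.continuousOn_propagator hP hδ hV.cont
      (continuous_const.sub continuous_id)).mono Icc_subset_Ici_self) continuousOn_const
    (fun _ s hs => by
      have h1 := hasDerivAt_ratePropagator hP hδ hlam hV continuousOn_const r t hs.1
      refine h1.congr_deriv ?_
      exact map_zero (ratePropagator P lam δ r (t - s)))
  rw [intervalIntegral.integral_zero, sub_self, sub_zero] at h
  exact sub_eq_zero.mp h

theorem homogeneous_eq_sum (hP : IsResolution P) (hδ : 0 ≤ δ) (hlam : ∀ i, 0 ≤ lam i)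
    (hV : IsModalSolution P lam δ 0 (fun _ => 0) V) (D : Finset ℝ)
    (hD : ∀ r i, Selects lam δ r i → r ∈ D) {t : ℝ} (ht : 0 ≤ t) :
    V t = ∑ r ∈ D, ratePropagator P lam δ r t (V 0) := by
  conv_lhs => rw [← sum_ratePropagator_zero hP hδ D hD (V t)]
  exact Finset.sum_congr rfl fun r _ => homogeneous_ratePropagator_eq hP hδ hlam hV r ht

/-- z = S(-t)S(t)z, and S(-t) grows at most like e^{γt}. -/
theorem eq_zero_of_tendsto_exp (hP : IsResolution P) (hδ : 0 ≤ δ) (hlam : ∀ i, 0 ≤ lam i)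
    {z : H × H × H} (hzc : IsCompatible P lam z) {r γ : ℝ} (hz : ratePropagator P lam δ r 0 z = z)
    (hγ : r < γ)
    (h : Tendsto (fun t => ‖ratePropagator P lam δ r t z‖ * Real.exp (γ * t)) atTop (𝓝 0)) :
    z = 0 := by
  obtain ⟨M, hM0, hM⟩ := norm_ratePropagator_le_of_gt (lam := lam) hP hδ hγ
  have h1 : Tendsto (fun t => M * (‖ratePropagator P lam δ r t z‖ * Real.exp (γ * t))) atTop
      (𝓝 0) := by simpa using h.const_mul M
  have h2 : ‖z‖ ≤ 0 := by
    refine ge_of_tendsto h1 ?_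
    filter_upwards [eventually_ge_atTop 0] with t ht
    have h3 := hM (-t) (neg_nonpos.mpr ht) (ratePropagator P lam δ r t z)
    rw [ratePropagator_ratePropagator hP hδ hlam hzc, neg_add_cancel, hz] at h3
    calc ‖z‖ ≤ _ := h3
      _ = _ := by rw [mul_neg, neg_neg]; ring
  exact norm_le_zero_iff.mp h2

/-- The relations satisfied by the modes of a vector in the range of the rate projection. -/
theorem proj_of_ratePropagator_eq (hP : IsResolution P) (hδ : 0 ≤ δ) (hlam : ∀ i, 0 ≤ lam i)
    {z : H × H × H} (hzc : IsCompatible P lam z) {r : ℝ} (hr : r ≠ δ)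
    (hz : ratePropagator P lam δ r 0 z = z) (i : ι) : P i z.2.2 = -r • P i z.1 := by
  have hK := (exists_isKernel_rate lam hδ r).choose_spec
  conv_lhs => rw [← hz]
  conv_rhs => rw [← hz]
  rw [ratePropagator, hK.proj_fst hP hδ, hK.proj_thd hP, hzc i, smul_smul, mul_right_comm,
    Real.mul_self_sqrt (hlam i)]
  by_cases h : Selects lam δ r i
  · rcases h with ⟨h, -⟩ | ⟨-, h⟩
    · exact absurd h hr
    · rw [rateKernelDeriv_of_ne hr h, rateKernel_of_ne hr h, h]
      module
  · simp [rateKernel_of_not h, rateKernelDeriv_of_not h]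

theorem proj_ratePropagator_of_not (hP : IsResolution P) (hδ : 0 ≤ δ) {r t : ℝ} {i : ι}
    (h : ¬ Selects lam δ r i) (z : H × H × H) : P i (ratePropagator P lam δ r t z).1 = 0 := by
  have hK := (exists_isKernel_rate lam hδ r).choose_spec
  rw [ratePropagator, hK.proj_fst hP hδ]
  simp [rateKernel_of_not h, rateKernelDeriv_of_not h]

/-- Two conditions under which a component of a solution vanishes. -/
theorem ratePropagator_eq_zero_of_modes (hP : IsResolution P) (hδ : 0 ≤ δ) (hlam : ∀ i, 0 ≤ lam i)
    {z : H × H × H} (hzc : IsCompatible P lam z) {r : ℝ}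
    (h1 : r = δ → ∀ i, δ ^ 2 ≤ lam i → P i z.1 = 0 ∧ P i z.2.2 = 0)
    (h2 : r ≠ δ → ∀ i, lam i = r * (2 * δ - r) → P i z.2.2 + (2 * δ - r) • P i z.1 = 0) (t : ℝ) :
    ratePropagator P lam δ r t z = 0 := by
  have hK := (exists_isKernel_rate lam hδ r).choose_spec
  have hfst : ∀ i, P i (ratePropagator P lam δ r t z).1 = 0 := by
    intro i
    rw [ratePropagator, hK.proj_fst hP hδ]
    by_cases h : Selects lam δ r i
    · rcases h with ⟨hr, h⟩ | ⟨hr, h⟩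
      · simp [h1 hr i h]
      · rw [rateKernelDeriv_of_ne hr h, rateKernel_of_ne hr h,
          eq_neg_of_add_eq_zero_left (h2 hr i h)]
        module
    · simp [rateKernel_of_not h, rateKernelDeriv_of_not h]
  refine ext_triple hP (fun i => by simpa using hfst i) (fun i => ?_) (fun i => ?_)
  · rw [hzc.ratePropagator hP hδ r t i, hfst]
    simp
  · rw [ratePropagator, hK.proj_thd hP, hzc i, smul_smul, mul_right_comm,
      Real.mul_self_sqrt (hlam i)]
    by_cases h : Selects lam δ r i
    · rcases h with ⟨hr, h⟩ | ⟨hr, h⟩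
      · simp [h1 hr i h]
      · rw [rateKernelDeriv_of_ne hr h, rateKernel_of_ne hr h,
          eq_neg_of_add_eq_zero_left (h2 hr i h), h]
        simp only [Prod.snd_zero, map_zero]
        module
    · simp [rateKernel_of_not h, rateKernelDeriv_of_not h]

end Homogeneous

/-! ### Pure solutions and the mutual exclusion of the alternatives. -/

section PureSolutions

variable {H : Type*} [NormedAddCommGroup H] [InnerProductSpace ℝ H] [CompleteSpace H]
  {A : H →ₗ.[ℝ] H} {δ : ℝ}

/-- The propagator of the component of decay rate `r`, for the operator `A`. -/
abbrev specPropagator (A : H →ₗ.[ℝ] H) (δ r t : ℝ) : (H × H × H) →L[ℝ] (H × H × H) :=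
  ratePropagator (specProj A) (fun l : spec A => (l : ℝ)) δ r t

/-- A pure solution is given by the propagator of its rate. -/
theorem IsPureSolution.eq_propagator (hP : IsResolution (specProj A))
    (hlam : ∀ l : spec A, (0 : ℝ) ≤ l) (hδ : 0 < δ) (D : Finset ℝ)
    (hD : ∀ r, r ∈ D ↔ r ∈ decayRates A δ) {r₀ : ℝ} (hr₀ : r₀ ∈ decayRates A δ) {v : ℝ → H}
    (hv : IsPureSolution A δ r₀ v) {t : ℝ} (ht : 0 ≤ t) :
    stateCurve A v t = specPropagator A δ r₀ t (stateCurve A v 0) := by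
  obtain ⟨hw, hcomp⟩ := hv
  have hV := hw.isModalSolution hP hlam continuousOn_const
  have hD' : ∀ r (i : spec A), Selects (fun l : spec A => (l : ℝ)) δ r i → r ∈ D := fun r i h =>
    (hD r).mpr (mem_decayRates_iff.mpr ⟨i, h⟩)
  rw [homogeneous_eq_sum hP hδ.le hlam hV D hD' ht, Finset.sum_eq_single r₀]
  · intro r hrD hr
    have hc := hcomp r ((hD r).mp hrD) hr
    apply ratePropagator_eq_zero_of_modes hP hδ.le hlam (isCompatible_of_modal hV le_rfl)
    -- At rate δ many modes share the component; its vanishing at all times, projected on one mode,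
    -- kills that mode, and then its initial velocity by differentiation at 0.
    · rintro rfl l hl
      have hzero : ∀ s, 0 ≤ s → specProj A l (v s) = 0 := by
        intro s hs
        have h1 := hc s hs
        set y : spec A → H := fun m => modeComponent r m r (fun s => eigenproj A m (v s))
          (eigenproj A m (v 0)) (eigenproj A m (vel v 0)) s with hy
        have hy1 : ∀ m : spec A, y m = if (m : ℝ) < r ^ 2 then 0 else specProj A m (v s) := by
          intro m
          simp only [hy, modeComponent, if_true]
          split_ifs with h2 h3
          · nlinarith
          · rfl
          · rfl
        have hy2 : ∀ m, specProj A m (y m) = y m := by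
          intro m
          rw [hy1]
          split_ifs
          · exact map_zero _
          · exact hP.comp_self _ _
        have hsum : Summable y := by
          rw [hP.summable_iff hy2]
          refine Summable.of_nonneg_of_le (fun m => by positivity) (fun m => ?_)
            (hP.norm_sq_proj_hasSum (v s)).summable
          rw [hy1]
          split_ifs
          · simp
          · exact le_rfl
        have h2 := hP.proj_hasSum hy2 hsum.hasSum l
        have h3 : ∑' m, y m = 0 := h1
        rw [h3, map_zero, hy1, if_neg (not_lt.mpr hl)] at h2
        exact h2.symm
      refine ⟨hzero 0 le_rfl, ?_⟩
      have h1 : HasDerivWithinAt v (vel v 0) (Ici 0) 0 :=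
        (hw.1.2.2.differentiableOn one_ne_zero 0 self_mem_Ici).hasDerivWithinAt
      have h2 : HasDerivWithinAt (fun s => specProj A l (v s)) (specProj A l (vel v 0)) (Ici 0) 0 :=
        (specProj A l).hasFDerivAt.comp_hasDerivWithinAt 0 h1
      have h3 : HasDerivWithinAt (fun s => specProj A l (v s)) 0 (Ici 0) 0 :=
        (hasDerivWithinAt_const (0 : ℝ) (Ici 0) (0 : H)).congr (fun s hs => hzero s hs)
          (hzero 0 le_rfl)
      exact (uniqueDiffOn_Ici (0 : ℝ) 0 self_mem_Ici).eq_deriv _ h2 h3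
    -- For r ≠ δ only the eigenvalue r(2δ - r) has r as a root, so the series has a single term and
    -- time 0 suffices.
    · intro hrδ l hl
      have h1 := hc 0 le_rfl
      have hroot : ∀ m : spec A, r ^ 2 - 2 * δ * r + m = 0 → m = l := fun m hm =>
        Subtype.ext (by rw [hl]; linarith)
      have hlt : (l : ℝ) < δ ^ 2 := by
        have : 0 < (r - δ) ^ 2 := by
          have := sub_ne_zero.mpr hrδ
          positivity
        rw [hl]; nlinarith
      rw [component, tsum_eq_single l] at h1
      · rw [modeComponent, if_pos hlt, if_pos (by rw [hl]; ring)] at h1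
        refine (smul_eq_zero.mp h1).resolve_left ?_
        have : 2 * δ - r - r ≠ 0 := by
          intro h; apply hrδ; linarith
        simp [this]
      · intro m hm
        rw [modeComponent]
        split_ifs with h2 h3
        · exact absurd (hroot m h3) hm
        · rfl
        · rfl
  · intro h
    exact absurd ((hD r₀).mpr hr₀) h

theorem isModalSolution_specPropagator (hP : IsResolution (specProj A))
    (hlam : ∀ l : spec A, (0 : ℝ) ≤ l) (hδ : 0 < δ) (r : ℝ) {z : H × H × H}
    (hz : IsCompatible (specProj A) (fun l : spec A => (l : ℝ)) z) (a : ℝ) :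
    IsModalSolution (specProj A) (fun l => (l : ℝ)) δ a (fun _ => 0)
      (fun t => specPropagator A δ r t z) :=
  (exists_isKernel_rate _ hδ.le r).choose_spec.isModalSolution hP hδ.le hlam hz a

theorem stateCurve_specPropagator (hP : IsResolution (specProj A))
    (hlam : ∀ l : spec A, (0 : ℝ) ≤ l) (hδ : 0 < δ) (r : ℝ) {z : H × H × H}
    (hz : IsCompatible (specProj A) (fun l : spec A => (l : ℝ)) z) {t : ℝ} (ht : 0 ≤ t) :
    stateCurve A (fun s => (specPropagator A δ r s z).1) t = specPropagator A δ r t z := by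
  have hV := isModalSolution_specPropagator hP hlam hδ r hz (-1)
  refine Prod.ext rfl (Prod.ext ?_ ?_)
  · exact sqrtOp_eq_of_proj hP (hV.sqrt t (by linarith))
  · exact hV.vel_eq hP (by norm_num) ht

theorem isPureSolution_specPropagator (hP : IsResolution (specProj A))
    (hlam : ∀ l : spec A, (0 : ℝ) ≤ l) (hδ : 0 < δ) {r₀ : ℝ} {z : H × H × H}
    (hzc : IsCompatible (specProj A) (fun l : spec A => (l : ℝ)) z)
    (hz : specPropagator A δ r₀ 0 z = z) :
    IsPureSolution A δ r₀ (fun s => (specPropagator A δ r₀ s z).1) := by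
  have hV := isModalSolution_specPropagator hP hlam hδ r₀ hzc (-1)
  refine ⟨hV.isWeakSolution hP hlam (by norm_num), fun r _ hr t ht => ?_⟩
  rw [component]
  convert tsum_zero with l
  have hvel : vel (fun s => (specPropagator A δ r₀ s z).1) 0 = z.2.2 := by
    rw [hV.vel_eq hP (by norm_num) le_rfl, hz]
  rw [modeComponent]
  split_ifs with h1 h2 h3
  · rw [hvel, hz]
    -- A mode selected by r₀ has velocity -r₀ times its position, and the other root is r = 2δ - r₀;
    -- so the coefficient of that root vanishes.
    have key : specProj A l z.2.2 + (2 * δ - r) • specProj A l z.1 = 0 := by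
      by_cases hs : Selects (fun l : spec A => (l : ℝ)) δ r₀ l
      · have hr₀ : r₀ ≠ δ ∧ (l : ℝ) = r₀ * (2 * δ - r₀) := by
          rcases hs with ⟨-, h⟩ | h
          · exact absurd h1 (not_lt.mpr h)
          · exact h
        have h4 := proj_of_ratePropagator_eq hP hδ.le hlam hzc hr₀.1 hz l
        have h5 : (r - r₀) * (r + r₀ - 2 * δ) = 0 := by
          have := hr₀.2
          linarith
        have h6 := (mul_eq_zero.mp h5).resolve_left (sub_ne_zero.mpr hr)
        have h7 : 2 * δ - r = r₀ := by linarith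
        rw [h4, h7]
        module
      · have h4 := proj_ratePropagator_of_not (P := specProj A) (t := 0) hP hδ.le hs z
        rw [hz] at h4
        have hK := (exists_isKernel_rate (fun l : spec A => (l : ℝ)) hδ.le r₀).choose_spec
        have h5 : specProj A l z.2.2 = 0 := by
          rw [← hz, specPropagator, ratePropagator, hK.proj_thd hP]
          simp [rateKernel_of_not hs, rateKernelDeriv_of_not hs]
        rw [h4, h5]
        simp
    have key' : eigenproj A l z.2.2 + (2 * δ - r) • eigenproj A l z.1 = 0 := key
    rw [key', smul_zero]
  · rfl
  · refine proj_ratePropagator_of_not (P := specProj A) hP hδ.le ?_ z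
    rw [selects_iff_of_le (lam := fun l : spec A => (l : ℝ)) l (not_lt.mp h1)]
    rintro rfl
    exact hr h3
  · rfl

theorem stateCurve_eq_zero (hP : IsResolution (specProj A)) {u : ℝ → H} (hu : IsNull u) {t : ℝ}
    (ht : 0 ≤ t) : stateCurve A u t = 0 := by
  have h1 : vel u t = 0 := by
    have h2 : EqOn u (fun _ => (0 : H)) (Ici 0) := fun s hs => hu s hs
    rw [vel, derivWithin_congr h2 (hu t ht)]
    simp
  refine Prod.ext (hu t ht) (Prod.ext ?_ h1)
  change sqrtOp A (u t) = 0
  rw [hu t ht]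
  exact sqrtOp_eq_of_proj hP (fun l => by simp)

theorem stateCurve_sub (hP : IsResolution (specProj A)) {u v : ℝ → H} {t : ℝ}
    (hu : u t ∈ sqrtDomain A) (hv : v t ∈ sqrtDomain A) :
    stateCurve A u t - stateCurve A v t = (u t - v t, sqrtOp A (u t - v t), vel u t - vel v t) := by
  refine Prod.ext rfl (Prod.ext ?_ rfl)
  refine (sqrtOp_eq_of_proj hP fun l => ?_).symm
  change specProj A l (sqrtOp A (u t) - sqrtOp A (v t)) = _
  rw [map_sub, map_sub, proj_sqrtOp hP hu, proj_sqrtOp hP hv, smul_sub]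

theorem norm_le_sqrtNorm (A : H →ₗ.[ℝ] H) (x : H) : ‖x‖ ≤ sqrtNorm A x :=
  Real.le_sqrt_of_sq_le (by nlinarith [sq_nonneg ‖sqrtOp A x‖])

theorem norm_sqrtOp_le_sqrtNorm (A : H →ₗ.[ℝ] H) (x : H) : ‖sqrtOp A x‖ ≤ sqrtNorm A x :=
  Real.le_sqrt_of_sq_le (by nlinarith [sq_nonneg ‖x‖])

theorem sqrtNorm_le (A : H →ₗ.[ℝ] H) (x : H) : sqrtNorm A x ≤ ‖x‖ + ‖sqrtOp A x‖ := by
  apply Real.sqrt_le_left (by positivity) |>.mpr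
  nlinarith [mul_nonneg (norm_nonneg x) (norm_nonneg (sqrtOp A x))]

theorem norm_stateCurve_sub_le (hP : IsResolution (specProj A)) {u v : ℝ → H} {t : ℝ}
    (hu : u t ∈ sqrtDomain A) (hv : v t ∈ sqrtDomain A) :
    ‖stateCurve A u t - stateCurve A v t‖ ≤ ‖vel u t - vel v t‖ + sqrtNorm A (u t - v t) := by
  rw [stateCurve_sub hP hu hv, Prod.norm_def, Prod.norm_def]
  have h1 := norm_le_sqrtNorm A (u t - v t)
  have h2 := norm_sqrtOp_le_sqrtNorm A (u t - v t)
  have h3 := norm_nonneg (vel u t - vel v t)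
  have h4 : 0 ≤ sqrtNorm A (u t - v t) := Real.sqrt_nonneg _
  refine max_le ?_ (max_le ?_ ?_) <;> simp only <;> linarith

theorem le_norm_stateCurve_sub (hP : IsResolution (specProj A)) {u v : ℝ → H} {t : ℝ}
    (hu : u t ∈ sqrtDomain A) (hv : v t ∈ sqrtDomain A) :
    ‖vel u t - vel v t‖ + sqrtNorm A (u t - v t) ≤ 3 * ‖stateCurve A u t - stateCurve A v t‖ := by
  have e := stateCurve_sub hP hu hv
  have h1 : ‖u t - v t‖ ≤ ‖stateCurve A u t - stateCurve A v t‖ := by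
    rw [e]; exact norm_fst_le (u t - v t, sqrtOp A (u t - v t), vel u t - vel v t)
  have h2 : ‖(sqrtOp A (u t - v t), vel u t - vel v t)‖ ≤
      ‖stateCurve A u t - stateCurve A v t‖ := by
    rw [e]; exact norm_snd_le (u t - v t, sqrtOp A (u t - v t), vel u t - vel v t)
  have h3 := (norm_fst_le (sqrtOp A (u t - v t), vel u t - vel v t)).trans h2
  have h4 := (norm_snd_le (sqrtOp A (u t - v t), vel u t - vel v t)).trans h2
  have h5 := sqrtNorm_le A (u t - v t)
  simp only at h3 h4
  linarith

/-- A fast solution approaches a nonzero pure state at a rate faster than that of the state. -/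
theorem IsFast.exists_state (hP : IsResolution (specProj A))
    (hlam : ∀ l : spec A, (0 : ℝ) ≤ l) (hδ : 0 < δ) (D : Finset ℝ)
    (hD : ∀ r, r ∈ D ↔ r ∈ decayRates A δ) {p q : ℝ} (hp : 0 < p) (hq : 0 < q) {u : ℝ → H}
    (hu : HasEnergyRegularity A u) (h : IsFast A δ p q u) :
    ∃ r₀ γ : ℝ, ∃ z, 0 < r₀ ∧ r₀ < γ ∧ z ≠ 0 ∧
      IsCompatible (specProj A) (fun l : spec A => (l : ℝ)) z ∧
      specPropagator A δ r₀ 0 z = z ∧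
      Tendsto (fun t => ‖stateCurve A u t - specPropagator A δ r₀ t z‖ * Real.exp (γ * t)) atTop
        (𝓝 0) := by
  obtain ⟨r₀, hr₀D, hr₀, v, hv, hvne, hlim⟩ := h
  have hr₀p : r₀ < min ((1 + p) * r₀) ((1 + q) * r₀) := lt_min (by nlinarith) (by nlinarith)
  obtain ⟨γ, h1, h2, h3⟩ := exists_coe_lt_nextRate D (fun r hr => (hD r).mpr hr) hr₀p
  have hVeq : ∀ t, 0 ≤ t → stateCurve A v t = specPropagator A δ r₀ t (stateCurve A v 0) :=
    fun t ht => hv.eq_propagator hP hlam hδ D hD hr₀D ht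
  have hV := hv.1.isModalSolution hP hlam continuousOn_const
  refine ⟨r₀, γ, stateCurve A v 0, hr₀, h1, ?_, isCompatible_of_modal hV le_rfl,
    (hVeq 0 le_rfl).symm, ?_⟩
  · intro h0
    apply hvne
    intro t ht
    have h4 := hVeq t ht
    rw [h0, map_zero] at h4
    exact congrArg Prod.fst h4
  · have h4 := hlim γ (lt_min h3 (lt_min
      (EReal.coe_lt_coe_iff.mpr (h2.trans_le (min_le_left _ _)))
      (EReal.coe_lt_coe_iff.mpr (h2.trans_le (min_le_right _ _)))))
    refine squeeze_zero' (Eventually.of_forall fun t => by positivity) ?_ h4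
    filter_upwards [eventually_ge_atTop 0] with t ht
    rw [← hVeq t ht]
    gcongr
    exact norm_stateCurve_sub_le hP (hu.1 t ht) (hv.1.1.1 t ht)

/-- A solution asymptotic to a nonzero state of rate `r₀` is fast. -/
theorem isFast_of_isBigO (hP : IsResolution (specProj A)) (hlam : ∀ l : spec A, (0 : ℝ) ≤ l)
    (hδ : 0 < δ) (D : Finset ℝ) (hD : ∀ r, r ∈ D ↔ r ∈ decayRates A δ) {p q : ℝ} {u : ℝ → H}
    (hu : HasEnergyRegularity A u) {r₀ : ℝ} (hr₀D : r₀ ∈ D) (hr₀ : 0 < r₀) {z : H × H × H}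
    (hz0 : z ≠ 0) (hzc : IsCompatible (specProj A) (fun l : spec A => (l : ℝ)) z)
    (hz : specPropagator A δ r₀ 0 z = z)
    (hasym : ∀ γ, (∀ r ∈ D, r₀ < r → γ < r) → γ < (1 + p) * r₀ → γ < (1 + q) * r₀ →
      (fun t => stateCurve A u t - specPropagator A δ r₀ t z) =O[atTop]
        fun t => Real.exp (-(γ * t))) :
    IsFast A δ p q u := by
  set v : ℝ → H := fun s => (specPropagator A δ r₀ s z).1 with hv
  have hpure : IsPureSolution A δ r₀ v := isPureSolution_specPropagator hP hlam hδ hzc hz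
  have hstate : ∀ t, 0 ≤ t → stateCurve A v t = specPropagator A δ r₀ t z := fun t ht =>
    stateCurve_specPropagator hP hlam hδ r₀ hzc ht
  have hvdom : ∀ t, 0 ≤ t → v t ∈ sqrtDomain A := hpure.1.1.1
  clear_value v
  refine ⟨r₀, (hD r₀).mp hr₀D, hr₀, v, hpure, fun hnull => hz0 ?_, fun γ hγ => ?_⟩
  · rw [← hz, ← hstate 0 le_rfl]
    exact stateCurve_eq_zero hP hnull le_rfl
  have hγ1 := hγ.trans_le (min_le_left _ _)
  have hγ2 := EReal.coe_lt_coe_iff.mp ((hγ.trans_le (min_le_right _ _)).trans_le (min_le_left _ _))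
  have hγ3 := EReal.coe_lt_coe_iff.mp ((hγ.trans_le (min_le_right _ _)).trans_le (min_le_right _ _))
  -- An exponent γ' slightly above γ and still admissible turns the O-bound into convergence to 0 at
  -- γ.
  obtain ⟨γ', h1, h2, h3⟩ := exists_gt_forall_lt D (lt_min hγ2 hγ3)
  have hO := hasym γ'
    (fun r hr hr₀r => h3 r hr (lt_of_coe_lt_nextRate hγ1 ((hD r).mp hr) hr₀r))
    (h2.trans_le (min_le_left _ _)) (h2.trans_le (min_le_right _ _))
  obtain ⟨C, hC, hb⟩ := hO.exists_pos
  have hlim : Tendsto (fun t => 3 * C * Real.exp (-((γ' - γ) * t))) atTop (𝓝 0) := by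
    have : Tendsto (fun t => Real.exp (-((γ' - γ) * t))) atTop (𝓝 0) :=
      Real.tendsto_exp_neg_atTop_nhds_zero.comp (tendsto_id.const_mul_atTop (sub_pos.mpr h1))
    simpa using this.const_mul (3 * C)
  refine squeeze_zero' (Eventually.of_forall fun t =>
    mul_nonneg (add_nonneg (norm_nonneg _) (Real.sqrt_nonneg _)) (Real.exp_nonneg _)) ?_ hlim
  filter_upwards [eventually_ge_atTop 0, hb.bound] with t ht hbt
  rw [Real.norm_of_nonneg (Real.exp_nonneg _), ← hstate t ht] at hbt
  have h4 := le_norm_stateCurve_sub hP (hu.1 t ht) (hvdom t ht)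
  have h5 : 3 * C * Real.exp (-((γ' - γ) * t)) =
      3 * (C * Real.exp (-(γ' * t))) * Real.exp (γ * t) := by
    rw [show -((γ' - γ) * t) = -(γ' * t) + γ * t by ring, Real.exp_add]
    ring
  rw [h5]
  exact mul_le_mul_of_nonneg_right (h4.trans (mul_le_mul_of_nonneg_left hbt (by norm_num)))
    (Real.exp_nonneg _)

theorem not_isNull_and_isSlow {p : ℝ} {u : ℝ → H} : ¬ (IsNull u ∧ IsSlow A p u) := by
  rintro ⟨hnull, T, M, -, hT, hM, -, h, -⟩
  have h1 := h T le_rfl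
  rw [hnull T hT, norm_zero] at h1
  have : 0 < M / (1 + T) ^ (1 / p) := by positivity
  linarith

/-- If u vanished, its nonzero pure profile would itself be o(e^{-γt}) with γ > r₀. -/
theorem not_isNull_and_isFast (hP : IsResolution (specProj A)) (hlam : ∀ l : spec A, (0 : ℝ) ≤ l)
    (hδ : 0 < δ) (D : Finset ℝ) (hD : ∀ r, r ∈ D ↔ r ∈ decayRates A δ) {p q : ℝ} (hp : 0 < p)
    (hq : 0 < q) {u : ℝ → H} (hreg : HasEnergyRegularity A u) :
    ¬ (IsNull u ∧ IsFast A δ p q u) := by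
  rintro ⟨hnull, hfast⟩
  obtain ⟨r₀, γ, z, -, hγ, hz0, hzc, hz, hlim⟩ := hfast.exists_state hP hlam hδ D hD hp hq hreg
  apply hz0
  refine eq_zero_of_tendsto_exp hP hδ.le hlam hzc hz hγ (hlim.congr' ?_)
  filter_upwards [eventually_ge_atTop 0] with t ht
  rw [stateCurve_eq_zero hP hnull ht, zero_sub, norm_neg]

/-- A fast solution is O(e^{-r₀t/2}), which eventually falls below every multiple of (1 + t)^{-1/p}.
-/
theorem not_isSlow_and_isFast (hP : IsResolution (specProj A)) (hlam : ∀ l : spec A, (0 : ℝ) ≤ l)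
    (hδ : 0 < δ) (D : Finset ℝ) (hD : ∀ r, r ∈ D ↔ r ∈ decayRates A δ) {p q : ℝ} (hp : 0 < p)
    (hq : 0 < q) {u : ℝ → H} (hreg : HasEnergyRegularity A u) :
    ¬ (IsSlow A p u ∧ IsFast A δ p q u) := by
  rintro ⟨⟨T, M, -, hT, hM, -, h, -⟩, hfast⟩
  obtain ⟨r₀, γ, z, hr₀, hγ, -, -, -, hlim⟩ := hfast.exists_state hP hlam hδ D hD hp hq hreg
  obtain ⟨N, hN0, hN⟩ := norm_ratePropagator_le_of_lt (P := specProj A)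
    (lam := fun l : spec A => (l : ℝ)) hP hδ.le (half_lt_self hr₀)
  have hexp := tendsto_rpow_mul_exp_neg_mul_atTop_nhds_zero (1 / p) (r₀ / 2) (half_pos hr₀)
  -- The limit of x^{1/p}e^{-r₀x/2} is used at x = 1 + t; this produces the factor e^{r₀/2}.
  have hshift : Tendsto (fun t : ℝ => 1 + t) atTop atTop :=
    tendsto_atTop_add_const_left _ _ tendsto_id
  have h1 := ((hexp.comp hshift).const_mul ((1 + N * ‖z‖) * Real.exp (r₀ / 2)))
  rw [mul_zero] at h1
  obtain ⟨t, ht1, ht2, ht3⟩ := ((h1.eventually (gt_mem_nhds hM)).and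
    ((hlim.eventually (gt_mem_nhds one_pos)).and (eventually_ge_atTop T))).exists
  have ht0 : 0 ≤ t := hT.trans ht3
  have h2 : ‖u t‖ ≤ (1 + N * ‖z‖) * Real.exp (-(r₀ / 2 * t)) := by
    have h3 : ‖u t‖ ≤ ‖stateCurve A u t‖ := norm_fst_le (stateCurve A u t)
    have h4 : ‖stateCurve A u t‖ ≤ ‖specPropagator A δ r₀ t z‖ +
        ‖stateCurve A u t - specPropagator A δ r₀ t z‖ := norm_le_norm_add_norm_sub' _ _
    have h5 := hN t ht0 z
    have h6 : ‖stateCurve A u t - specPropagator A δ r₀ t z‖ ≤ Real.exp (-(r₀ / 2 * t)) := by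
      have h7 : ‖stateCurve A u t - specPropagator A δ r₀ t z‖ =
          ‖stateCurve A u t - specPropagator A δ r₀ t z‖ * Real.exp (γ * t) *
            Real.exp (-(γ * t)) := by
        rw [mul_assoc, ← Real.exp_add]; simp
      rw [h7]
      calc _ ≤ 1 * Real.exp (-(γ * t)) := by gcongr
        _ ≤ Real.exp (-(r₀ / 2 * t)) := by
          rw [one_mul]
          gcongr
          linarith
    nlinarith
  have h3 := h t ht3
  have hpos : 0 < (1 + t) ^ (1 / p) := by positivity
  rw [div_le_iff₀ hpos] at h3
  simp only [Function.comp_apply] at ht1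
  have h4 : (1 + N * ‖z‖) * Real.exp (r₀ / 2) * ((1 + t) ^ (1 / p) *
      Real.exp (-(r₀ / 2) * (1 + t))) =
      (1 + N * ‖z‖) * Real.exp (-(r₀ / 2 * t)) * (1 + t) ^ (1 / p) := by
    have e : Real.exp (-(r₀ / 2 * t)) =
        Real.exp (r₀ / 2) * Real.exp (-(r₀ / 2) * (1 + t)) := by
      rw [← Real.exp_add]; ring_nf
    rw [e]; ring
  rw [h4] at ht1
  have h5 : ‖u t‖ * (1 + t) ^ (1 / p) ≤
      (1 + N * ‖z‖) * Real.exp (-(r₀ / 2 * t)) * (1 + t) ^ (1 / p) := by gcongr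
  linarith

end PureSolutions

end DissipativeEvolution

end

/-! ### The classification theorem. -/

open DissipativeEvolution
theorem theorem3p1 {H : Type*} [NormedAddCommGroup H] [InnerProductSpace ℝ H] [CompleteSpace H]
    [TopologicalSpace.SeparableSpace H]
    (A : H →ₗ.[ℝ] H) (hdense : Dense (A.domain : Set H)) (hself : IsSelfAdjoint A)
    (hnonneg : IsNonneg A) (hspec : HasDiscreteSpectrum A)
    (δ K₀ p q : ℝ) (hδ : 0 < δ) (hK₀ : 0 ≤ K₀) (hp : 0 < p) (hq : 0 < q)
    (u : ℝ → H) (hu : IsGlobalSolution A δ K₀ p q u)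
    (hdecay : Tendsto (fun t => sqrtNorm A (u t)) atTop (𝓝 0)) :
    (IsNull u ∨ IsSlow A p u ∨ IsFast A δ p q u) ∧
      ¬ (IsNull u ∧ IsSlow A p u) ∧
      ¬ (IsNull u ∧ IsFast A δ p q u) ∧
      ¬ (IsSlow A p u ∧ IsFast A δ p q u) := by
  have hP := isResolution_specProj hdense hself hnonneg hspec
  have hlam : ∀ l : spec A, (0 : ℝ) ≤ l := fun l => nonneg_of_mem_spec hnonneg hspec l.2
  obtain ⟨hreg, g, hg, hw, hnl⟩ := hu
  have hU := hw.isModalSolution hP hlam hg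
  obtain ⟨D, hDeq⟩ := (decayRates_finite (δ := δ) hnonneg hspec).exists_finset
  have hD : ∀ r, r ∈ D ↔ ∃ l : spec A, Selects (fun l : spec A => (l : ℝ)) δ r l := fun r =>
    (hDeq r).trans mem_decayRates_iff
  refine ⟨?_, not_isNull_and_isSlow, not_isNull_and_isFast hP hlam hδ D hDeq hp hq hreg,
    not_isSlow_and_isFast hP hlam hδ D hDeq hp hq hreg⟩
  -- The split concerns positive times, where the modal equations hold; the value at 0 is recovered
  -- by continuity.
  · by_cases hzero : ∀ t, 0 < t → stateCurve A u t = 0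
    · left
      have h1 : ∀ t, 0 < t → u t = 0 := fun t ht => congrArg Prod.fst (hzero t ht)
      intro t ht
      rcases ht.eq_or_lt with rfl | ht
      · have hc : Tendsto u (𝓝[>] 0) (𝓝 (u 0)) :=
          (hreg.2.2.continuousOn 0 self_mem_Ici).mono_left (nhdsWithin_mono _ Ioi_subset_Ici_self)
        refine tendsto_nhds_unique hc (tendsto_const_nhds.congr' ?_)
        filter_upwards [self_mem_nhdsWithin] with s hs using (h1 s hs).symm
      · exact h1 t ht
    · right
      push Not at hzero
      rcases slow_or_exponential hP hδ hlam hU hg D hD hK₀ hp hq hnl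
        (squeeze_zero (fun t => norm_nonneg _) (fun t => norm_le_sqrtNorm A (u t)) hdecay)
        (squeeze_zero (fun t => norm_nonneg _) (fun t => norm_sqrtOp_le_sqrtNorm A (u t)) hdecay)
        with ⟨c, M, hc, hM, h⟩ | hexp
      · left
        obtain ⟨T, hT⟩ := eventually_atTop.mp h
        exact ⟨max 0 T, c, M, le_max_left _ _, hc, hM,
          fun t ht => (hT t ((le_max_right _ _).trans ht)).1,
          fun t ht => (hT t ((le_max_right _ _).trans ht)).2⟩
      · right
        obtain ⟨r₀, hr₀D, hr₀, z, hz0, hzc, hz, hasym⟩ :=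
          exists_profile hP hδ hlam hU hg D hD hK₀ hp hq hnl hexp hzero
        exact isFast_of_isBigO hP hlam hδ D hDeq hreg hr₀D hr₀ hz0 hzc hz hasym
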